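/- Let $N\ge 2$, and let $\chi,\varphi\in C^\infty(\mathbb R^N;\mathbb R)$ satisfy $\operatorname{Supp}\chi\subset\{|\xi|\le \frac43\}$, $\operatorname{Supp}\varphi\subset\{\frac34\le|\xi|\le\frac83\}$, $\chi(\xi)+\sum_{q\ge0}\varphi(2^{-q}\xi)=1$ for all $\xi$, and $\sum_{q\in\mathbb Z}\varphi(2^{-q}\xi)=1$ for $\xi\ne0$. Put $\dot\Delta_q=\varphi(2^{-q}D)$ and $\dot S_q=\chi(2^{-q}D)$. Let $\mathcal S'_h$ be the set of tempered distributions $f$ on $\mathbb R^N$ with $\lim_{q\to-\infty}\|\dot S_qf\|_{L^\infty}=0$; for $f\in\mathcal S'_h$ put $f_L=\sum_{q<1}\dot\Delta_qf$ and $f_H=f-f_L=\sum_{q\ge1}\dot\Delta_qf$. For $\sigma\in\mathbb R$, $\dot B^\sigma_{2,1}$ is the set of $f\in\mathcal S'_h$ with $\|f\|_{\dot B^\sigma_{2,1}}=\sum_{q\in\mathbb Z}2^{q\sigma}\|\dot\Delta_qf\|_{L^2}<\infty$. For $T\in(0,\infty)$ and $r\in[1,\infty]$, $\widetilde L^r_T(\dot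 B^\sigma_{2,1})$ is the space of ($\mathcal S'_h$-valued, measurable in time) $f$ on $(0,T)$ with $$\|f\|_{\widetilde L^r_T(\dot B^\sigma_{2,1})}=\sum_{q\in\mathbb Z}2^{q\sigma}\big\|\,\|\dot\Delta_qf(t)\|_{L^2}\big\|_{L^r(0,T)}<\infty .$$ Let $s\ge0$ and let $K:\mathbb R\to\mathbb R$ be smooth with $K(0)=0$. Then there is a nondecreasing function $C:[0,\infty)\to[0,\infty)$, depending only on $N$, $\chi$, $\varphi$, $s$ and $K'$, such that the following holds for all $r\in[1,\infty]$ and $T\in(0,\infty)$. Let $u$ be a real-valued measurable function on $(0,T)\times\mathbb R^N$ with $u\in L^\infty_T(\dot B^{N/2}_{2,1})$, $u_L\in\widetilde L^r_T(\dot B^{N/2+s}_{2,1})$ and $u_H\in\widetilde L^r_T(\dot B^{N/2}_{2,1})$. Then $u\in L^\infty_T(L^\infty)$, $K(u(t))\in\mathcal S'_h$ for almost every $t\in(0,T)$, $K(u)_L\in\widetilde L^r_T(\dot B^{N/2+s}_{2,1})$, $K(u)_H\in\widetilde L^r_T(\dot B^{N/2}_{2,1})$, and $$\|K(u)_L\|_{\widetilde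 L^r_T(\dot B^{N/2+s}_{2,1})}\le C\big(\|u\|_{L^\infty_T(L^\infty)}\big)\Big(\|u_L\|_{\widetilde L^r_T(\dot B^{N/2+s}_{2,1})}+\|u_H\|_{\widetilde L^r_T(\dot B^{N/2}_{2,1})}\Big),$$ $$\|K(u)_H\|_{\widetilde L^r_T(\dot B^{N/2}_{2,1})}\le C\big(\|u\|_{L^\infty_T(L^\infty)}\big)\Big(\|u_L\|_{\widetilde L^r_T(\dot B^{N/2+s}_{2,1})}+\|u_H\|_{\widetilde L^r_T(\dot B^{N/2}_{2,1})}\Big).$$ -/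

import Mathlib

open MeasureTheory Filter Topology Set
open scoped ENNReal NNReal SchwartzMap ContDiff

noncomputable section

namespace HybridBesov

/-- The space `ℝ^N` with its Euclidean norm. -/
abbrev E (N : ℕ) : Type := EuclideanSpace ℝ (Fin N)

/-- A Littlewood–Paley couple `(χ, φ)` on `ℝ^N`: a smooth dyadic partition of unity.
(The sums over `q` have only finitely many nonzero terms at each `ξ`.) -/
structure LPCouple (N : ℕ) where
  χ : E N → ℝ
  φ : E N → ℝ
  smooth_χ : ContDiff ℝ ∞ χ
  smooth_φ : ContDiff ℝ ∞ φ
  supp_χ : tsupport χ ⊆ {ξ | ‖ξ‖ ≤ 4 / 3}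
  supp_φ : tsupport φ ⊆ {ξ | 3 / 4 ≤ ‖ξ‖ ∧ ‖ξ‖ ≤ 8 / 3}
  inhom : ∀ ξ : E N, HasSum (fun q : ℕ => φ ((2 : ℝ) ^ (-(q : ℤ)) • ξ)) (1 - χ ξ)
  hom : ∀ ξ : E N, ξ ≠ 0 → HasSum (fun q : ℤ => φ ((2 : ℝ) ^ (-q) • ξ)) 1

variable {N : ℕ}

/-- The Fourier multiplier `m(D)`, `D = -i∇`, on tempered distributions. Mathlib's Fourier
transform has the kernel `exp(-2πi x·ξ)`, so that `D` has the symbol `2πξ`. -/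
def multiplier (m : E N → ℝ) : 𝓢'(E N, ℂ) →L[ℂ] 𝓢'(E N, ℂ) :=
  TemperedDistribution.fourierMultiplierCLM ℂ (fun ξ : E N => ((m ((2 * Real.pi) • ξ) : ℝ) : ℂ))

/-- The dyadic block `Δ_q = φ(2^{-q} D)`. -/
def block (P : LPCouple N) (q : ℤ) : 𝓢'(E N, ℂ) →L[ℂ] 𝓢'(E N, ℂ) :=
  multiplier (fun ξ => P.φ ((2 : ℝ) ^ (-q) • ξ))

/-- The low-frequency cut-off `S_q = χ(2^{-q} D)`. -/
def cutoff (P : LPCouple N) (q : ℤ) : 𝓢'(E N, ℂ) →L[ℂ] 𝓢'(E N, ℂ) :=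
  multiplier (fun ξ => P.χ ((2 : ℝ) ^ (-q) • ξ))

/-- The `L^p` norm of a tempered distribution; it is `∞` if the distribution is not (given by)
a function in `L^p`. -/
def distNorm (p : ℝ≥0∞) [Fact (1 ≤ p)] (f : 𝓢'(E N, ℂ)) : ℝ≥0∞ :=
  ⨅ (g : Lp ℂ p (volume : Measure (E N))) (_ : (g : 𝓢'(E N, ℂ)) = f), ‖g‖ₑ

/-- The class `𝓢'_h`: tempered distributions `f` with `‖S_q f‖_{L^∞} → 0` as `q → -∞`. -/
def MemSh (P : LPCouple N) (f : 𝓢'(E N, ℂ)) : Prop :=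
  Tendsto (fun q : ℤ => distNorm ⊤ (cutoff P q f)) atBot (𝓝 0)

/-- `f_L = ∑_{q < 1} Δ_q f`, the limit in `𝓢'` of the sums over `-m < q ≤ 0`
(it exists for every `f` in `𝓢'_h`). -/
def lowPart (P : LPCouple N) (f : 𝓢'(E N, ℂ)) : 𝓢'(E N, ℂ) :=
  limUnder atTop (fun m : ℕ => ∑ q ∈ Finset.Ioc (-(m : ℤ)) 0, block P q f)

/-- `f_H = f - f_L`, which is `∑_{q ≥ 1} Δ_q f` for `f` in `𝓢'_h`. -/
def highPart (P : LPCouple N) (f : 𝓢'(E N, ℂ)) : 𝓢'(E N, ℂ) :=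
  f - lowPart P f

/-- The norm of the homogeneous Besov space with indices `s, 2, 1`. -/
def besovNorm (P : LPCouple N) (s : ℝ) (f : 𝓢'(E N, ℂ)) : ℝ≥0∞ :=
  ∑' q : ℤ, (2 : ℝ≥0∞) ^ ((q : ℝ) * s) * distNorm 2 (block P q f)

/-- Lebesgue measure on the time interval `(0, T)`. -/
abbrev timeMeasure (T : ℝ) : Measure ℝ := volume.restrict (Ioo 0 T)

/-- `u` is in `L^∞(0, T; B)` with `B` the homogeneous Besov space with indices `s, 2, 1`.
As `B` is separable, measurability in time is that of the pairings with test functions. -/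
structure MemLinftyBesov (P : LPCouple N) (T s : ℝ) (u : ℝ → 𝓢'(E N, ℂ)) : Prop where
  meas : ∀ g : 𝓢(E N, ℂ), AEStronglyMeasurable (fun t => u t g) (timeMeasure T)
  mem : ∀ᵐ t ∂timeMeasure T, MemSh P (u t) ∧ besovNorm P s (u t) < ⊤
  bound : eLpNorm (fun t => besovNorm P s (u t)) ⊤ (timeMeasure T) < ⊤

/-- The Chemin–Lerner norm: the time norm is taken before the sum over the dyadic blocks. -/
def clNorm (P : LPCouple N) (T : ℝ) (r : ℝ≥0∞) (s : ℝ) (u : ℝ → 𝓢'(E N, ℂ)) : ℝ≥0∞ :=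
  ∑' q : ℤ, (2 : ℝ≥0∞) ^ ((q : ℝ) * s) *
    eLpNorm (fun t => distNorm 2 (block P q (u t))) r (timeMeasure T)

/-- `u` is in the Chemin–Lerner space with time exponent `r` and Besov indices `s, 2, 1`. -/
structure MemCL (P : LPCouple N) (T : ℝ) (r : ℝ≥0∞) (s : ℝ) (u : ℝ → 𝓢'(E N, ℂ)) : Prop where
  meas : ∀ g : 𝓢(E N, ℂ), AEStronglyMeasurable (fun t => u t g) (timeMeasure T)
  mem : ∀ᵐ t ∂timeMeasure T, MemSh P (u t)
  bound : clNorm P T r s u < ⊤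

/-- The tempered distribution `f` is given by the real function `v`. -/
def IsGivenBy (f : 𝓢'(E N, ℂ)) (v : E N → ℝ) : Prop :=
  ∀ g : 𝓢(E N, ℂ), Integrable (fun x => g x * (v x : ℂ)) ∧ f g = ∫ x, g x * (v x : ℂ)

/-- The norm of `L^∞(0, T; L^∞(ℝ^N))`. -/
def supNorm (T : ℝ) (v : ℝ → E N → ℝ) : ℝ≥0∞ :=
  eLpNorm (fun t => eLpNorm (v t) ⊤ volume) ⊤ (timeMeasure T)

end HybridBesov

end

/-!
The composition is treated by Meyer's first linearization
`K(u) = ∑_j (K(S_{j+1} u) - K(S_j u))`. Each increment is `Δ_j u` times a smooth function of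
`(S_j u, S_{j+1} u)`, so that its derivatives of order `k` cost `2^{jk}` and a constant depending
only on the size of `u`. Bernstein's inequality (for `q ≤ j`) and its reverse for the frequency
annulus (for `j ≤ q`) show that `Δ_q` of the `j`-th increment, weighted by `2^{qa}` at low and
`2^{qb}` at high frequencies, is at most `2^{-δ|q-j|}` times the equally weighted norm of `Δ_j u`,
with `δ = min a b > 0`. The Schur test and Minkowski's inequality in time sum these estimates.
-/

noncomputable section

namespace HybridBesov

open scoped Convolution FourierTransform LineDeriv

set_option maxSynthPendingDepth 3

universe u

section Young

variable {α : Type*} [MeasurableSpace α] {μ : Measure α}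

theorem lintegral_mul_le_eLpNorm_mul_eLpNorm (p q : ℝ≥0∞) [p.HolderConjugate q]
    {f g : α → ℝ≥0∞} (hf : AEMeasurable f μ) (hg : AEMeasurable g μ) :
    ∫⁻ x, f x * g x ∂μ ≤ eLpNorm f p μ * eLpNorm g q μ := by
  have top_one {f g : α → ℝ≥0∞} (hg : AEMeasurable g μ) :
      ∫⁻ x, f x * g x ∂μ ≤ eLpNorm f ⊤ μ * eLpNorm g 1 μ := by
    simp only [eLpNorm_one_eq_lintegral_enorm, enorm_eq_self, eLpNorm_exponent_top]
    rw [← lintegral_const_mul'' _ hg]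
    refine lintegral_mono_ae ?_
    filter_upwards [ae_le_eLpNormEssSup (f := f) (μ := μ)] with x hx
    gcongr
    exact hx
  rcases eq_or_ne p ⊤ with rfl | hp
  · obtain rfl : q = 1 := (ENNReal.HolderConjugate.eq_top_iff_eq_one ⊤ q).1 rfl
    exact top_one hg
  rcases eq_or_ne q ⊤ with rfl | hq
  · obtain rfl : p = 1 := (ENNReal.HolderConjugate.eq_top_iff_eq_one ⊤ p).1 rfl
    simpa only [mul_comm] using top_one hf
  rw [eLpNorm_eq_lintegral_rpow_enorm_toReal (ENNReal.HolderConjugate.ne_zero p q) hp,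
    eLpNorm_eq_lintegral_rpow_enorm_toReal (ENNReal.HolderConjugate.ne_zero q p) hq]
  exact ENNReal.lintegral_mul_le_Lp_mul_Lq μ
    (ENNReal.HolderConjugate.toReal_of_ne_top hp hq) hf hg

theorem lintegral_mul_rpow_le {f g : α → ℝ≥0∞} (hf : AEMeasurable f μ) (hg : AEMeasurable g μ)
    {t : ℝ} (ht : 1 ≤ t) :
    (∫⁻ x, f x * g x ∂μ) ^ t ≤ (∫⁻ x, f x ^ t * g x ∂μ) * (∫⁻ x, g x ∂μ) ^ (t - 1) := by
  have t_pos : 0 < t := one_pos.trans_le ht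
  have holder := ENNReal.lintegral_mul_norm_pow_le ((hf.pow_const t).mul hg) hg
    (inv_nonneg.2 t_pos.le) (sub_nonneg.2 (inv_le_one_of_one_le₀ ht))
    (by ring : t⁻¹ + (1 - t⁻¹) = 1)
  have integrand (x : α) : (f x ^ t * g x) ^ t⁻¹ * g x ^ (1 - t⁻¹) = f x * g x := by
    rw [ENNReal.mul_rpow_of_nonneg _ _ (inv_nonneg.2 t_pos.le), ENNReal.rpow_rpow_inv t_pos.ne',
      mul_assoc, ← ENNReal.rpow_add_of_nonneg _ _ (inv_nonneg.2 t_pos.le)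
        (sub_nonneg.2 (inv_le_one_of_one_le₀ ht)), add_sub_cancel, ENNReal.rpow_one]
  simp only [Pi.mul_apply, integrand] at holder
  calc (∫⁻ x, f x * g x ∂μ) ^ t
      ≤ ((∫⁻ x, f x ^ t * g x ∂μ) ^ t⁻¹ * (∫⁻ x, g x ∂μ) ^ (1 - t⁻¹)) ^ t := by gcongr
    _ = (∫⁻ x, f x ^ t * g x ∂μ) * (∫⁻ x, g x ∂μ) ^ (t - 1) := by
      rw [ENNReal.mul_rpow_of_nonneg _ _ t_pos.le, ENNReal.rpow_inv_rpow t_pos.ne',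
        ← ENNReal.rpow_mul, sub_mul, one_mul, inv_mul_cancel₀ t_pos.ne']

variable {G : Type*} [AddCommGroup G] [MeasurableSpace G] [MeasurableAdd₂ G] [MeasurableNeg G]
  {μ : Measure G} [μ.IsAddLeftInvariant]

theorem lconvolution_le_eLpNorm_mul_eLpNorm [μ.IsNegInvariant] (p q : ℝ≥0∞)
    [p.HolderConjugate q] {f g : G → ℝ≥0∞}
    (hf : AEMeasurable f μ) (hg : Measurable g) (x : G) :
    (f ⋆ₗ[μ] g) x ≤ eLpNorm f p μ * eLpNorm g q μ := by
  have reflect : MeasurePreserving (fun y => -y + x) μ μ :=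
    (measurePreserving_add_right μ x).comp (Measure.measurePreserving_neg μ)
  have h := lintegral_mul_le_eLpNorm_mul_eLpNorm p q hf
    (hg.comp reflect.measurable).aemeasurable
  rwa [eLpNorm_comp_measurePreserving hg.aestronglyMeasurable reflect] at h

variable [SFinite μ]

theorem lintegral_lconvolution {f g : G → ℝ≥0∞} (hf : AEMeasurable f μ) (hg : Measurable g) :
    ∫⁻ x, (f ⋆ₗ[μ] g) x ∂μ = (∫⁻ x, f x ∂μ) * ∫⁻ x, g x ∂μ := by
  simp only [lconvolution_def]
  rw [lintegral_lintegral_swap (hf.comp_snd.mul (hg.comp (by fun_prop)).aemeasurable),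
    ← lintegral_mul_const'' _ hf]
  refine lintegral_congr fun y => ?_
  rw [lintegral_const_mul _ (by fun_prop), lintegral_add_left_eq_self]

theorem eLpNorm_lconvolution_le [μ.IsNegInvariant] {p : ℝ≥0∞} (hp : 1 ≤ p)
    {f g : G → ℝ≥0∞} (hf : AEMeasurable f μ)
    (hg : Measurable g) : eLpNorm (f ⋆ₗ[μ] g) p μ ≤ eLpNorm f p μ * ∫⁻ x, g x ∂μ := by
  rcases eq_or_ne p ⊤ with rfl | p_ne_top
  · rw [eLpNorm_exponent_top (f := f ⋆ₗ[μ] g)]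
    refine essSup_le_of_ae_le _ (Eventually.of_forall fun x => ?_)
    have h := lconvolution_le_eLpNorm_mul_eLpNorm ⊤ 1 hf hg x
    rwa [eLpNorm_one_eq_lintegral_enorm] at h
  have p_ne_zero : p ≠ 0 := (one_pos.trans_le hp).ne'
  have one_le : 1 ≤ p.toReal := by
    simpa using ENNReal.toReal_mono p_ne_top hp
  have t_pos : 0 < p.toReal := one_pos.trans_le one_le
  simp only [eLpNorm_eq_lintegral_rpow_enorm_toReal p_ne_zero p_ne_top, enorm_eq_self, one_div]
  rw [ENNReal.rpow_inv_le_iff t_pos, ENNReal.mul_rpow_of_nonneg _ _ t_pos.le,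
    ENNReal.rpow_inv_rpow t_pos.ne']
  set A := ∫⁻ x, g x ∂μ
  calc ∫⁻ x, (f ⋆ₗ[μ] g) x ^ p.toReal ∂μ
      ≤ ∫⁻ x, ((fun y => f y ^ p.toReal) ⋆ₗ[μ] g) x * A ^ (p.toReal - 1) ∂μ := by
        refine lintegral_mono fun x => ?_
        have h := lintegral_mul_rpow_le hf (g := fun y => g (-y + x)) (by fun_prop) one_le
        rwa [show ∫⁻ y, g (-y + x) ∂μ = A by
          simp only [neg_add_eq_sub, lintegral_sub_left_eq_self, A]] at h
    _ = (∫⁻ x, f x ^ p.toReal ∂μ) * A * A ^ (p.toReal - 1) := by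
        rw [lintegral_mul_const'' _ (aemeasurable_lconvolution (by fun_prop) hg.aemeasurable),
          lintegral_lconvolution (by fun_prop) hg]
    _ = (∫⁻ x, f x ^ p.toReal ∂μ) * A ^ p.toReal := by
        rw [mul_assoc]
        congr 1
        nth_rw 1 [← ENNReal.rpow_one A]
        rw [← ENNReal.rpow_add_of_nonneg _ _ zero_le_one (sub_nonneg.2 one_le), add_sub_cancel]

end Young

section Tame

variable {H : Type*} [NormedAddCommGroup H]

section Weight

variable [NormedSpace ℝ H]

/-- The weight `(1 + ‖y‖) ^ (-(d + 1))` on a space of dimension `d`. -/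
def weight (y : H) : ℝ := ((1 + ‖y‖) ^ (Module.finrank ℝ H + 1))⁻¹

theorem weight_pos (y : H) : 0 < weight y := by unfold weight; positivity

theorem weight_le_one (y : H) : weight y ≤ 1 :=
  inv_le_one_of_one_le₀ (one_le_pow₀ (by linarith [norm_nonneg y]))

theorem continuous_weight : Continuous (weight (H := H)) :=
  Continuous.inv₀ (by fun_prop) fun y => by positivity

theorem weight_sub_le (x y : H) :
    weight (x - y) ≤ (1 + ‖x‖) ^ (Module.finrank ℝ H + 1) * weight y := by
  unfold weight
  rw [← div_eq_mul_inv, le_div_iff₀ (by positivity), inv_mul_le_iff₀ (by positivity), ← mul_pow]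
  refine pow_le_pow_left₀ (by positivity) ?_ _
  have norm_le : ‖y‖ ≤ ‖x‖ + ‖x - y‖ := by simpa using norm_sub_le x (x - y)
  nlinarith [norm_nonneg x, norm_nonneg (x - y)]

theorem exists_one_add_norm_pow_mul_norm_le {F : Type*} [NormedAddCommGroup F] [NormedSpace ℝ F]
    (h : 𝓢(H, F)) (n : ℕ) : ∃ C : ℝ, 0 ≤ C ∧ ∀ x, (1 + ‖x‖) ^ n * ‖h x‖ ≤ C := by
  refine ⟨2 ^ n * ((Finset.Iic (n, 0)).sup fun m => SchwartzMap.seminorm ℝ m.1 m.2) h,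
    by positivity, fun x => ?_⟩
  simpa using SchwartzMap.one_add_le_sup_seminorm_apply (𝕜 := ℝ) (m := (n, 0)) le_rfl le_rfl h x

theorem exists_pow_mul_norm_schwartz_le_weight {F : Type*} [NormedAddCommGroup F]
    [NormedSpace ℝ F] (h : 𝓢(H, F)) (n : ℕ) :
    ∃ C : ℝ, 0 ≤ C ∧ ∀ x, (1 + ‖x‖) ^ n * ‖h x‖ ≤ C * weight x := by
  obtain ⟨C, hC, hb⟩ := exists_one_add_norm_pow_mul_norm_le h (n + (Module.finrank ℝ H + 1))
  refine ⟨C, hC, fun x => ?_⟩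
  rw [weight, ← div_eq_mul_inv, le_div_iff₀ (by positivity), mul_right_comm, ← pow_add]
  exact hb x

theorem exists_weight_mul_norm_schwartz_sub_le {F : Type*} [NormedAddCommGroup F] [NormedSpace ℝ F]
    (h : 𝓢(H, F)) :
    ∃ C : ℝ, 0 ≤ C ∧ ∀ x y, weight x * ‖h (x - y)‖ ≤ C * (weight (x - y) * weight y) := by
  obtain ⟨C, hC, hb⟩ := exists_pow_mul_norm_schwartz_le_weight h (Module.finrank ℝ H + 1)
  refine ⟨C, hC, fun x y => ?_⟩
  have peetre := weight_sub_le (x - y) (-y)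
  have weight_neg : weight (-y) = weight y := by simp only [weight, norm_neg]
  rw [sub_neg_eq_add, sub_add_cancel, weight_neg] at peetre
  have := weight_pos y
  calc weight x * ‖h (x - y)‖
      ≤ (1 + ‖x - y‖) ^ (Module.finrank ℝ H + 1) * weight y * ‖h (x - y)‖ := by gcongr
    _ = (1 + ‖x - y‖) ^ (Module.finrank ℝ H + 1) * ‖h (x - y)‖ * weight y := by ring
    _ ≤ C * weight (x - y) * weight y := mul_le_mul_of_nonneg_right (hb _) this.le
    _ = C * (weight (x - y) * weight y) := mul_assoc ..

theorem exists_norm_schwartz_le_weight {F : Type*} [NormedAddCommGroup F] [NormedSpace ℝ F]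
    (h : 𝓢(H, F)) : ∃ C : ℝ, 0 ≤ C ∧ ∀ x, ‖h x‖ ≤ C * weight x := by
  simpa using exists_pow_mul_norm_schwartz_le_weight h 0

theorem exists_norm_schwartz_sub_le_weight {F : Type*} [NormedAddCommGroup F] [NormedSpace ℝ F]
    (h : 𝓢(H, F)) (x₀ : H) :
    ∃ C : ℝ, 0 ≤ C ∧ ∀ x ∈ Metric.ball x₀ 1, ∀ y, ‖h (x - y)‖ ≤ C * weight y := by
  obtain ⟨C, hC, hb⟩ := exists_norm_schwartz_le_weight h
  refine ⟨C * (1 + (‖x₀‖ + 1)) ^ (Module.finrank ℝ H + 1), by positivity, fun x hx y => ?_⟩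
  have norm_le : ‖x‖ ≤ ‖x₀‖ + 1 := by
    rw [mem_ball_iff_norm] at hx
    linarith [norm_le_norm_add_norm_sub' x x₀]
  have := weight_pos y
  calc ‖h (x - y)‖ ≤ C * weight (x - y) := hb _
    _ ≤ C * ((1 + ‖x‖) ^ (Module.finrank ℝ H + 1) * weight y) := by
      gcongr; exact weight_sub_le x y
    _ ≤ C * ((1 + (‖x₀‖ + 1)) ^ (Module.finrank ℝ H + 1) * weight y) := by gcongr
    _ = _ := by ring

variable [FiniteDimensional ℝ H] [MeasurableSpace H] [BorelSpace H]

theorem integrable_weight (μ : Measure H) [μ.IsAddHaarMeasure] :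
    Integrable (weight (H := H)) μ := by
  have h := integrable_one_add_norm (E := H) (μ := μ) (r := (Module.finrank ℝ H : ℝ) + 1)
    (by linarith)
  refine h.congr (Eventually.of_forall fun y => ?_)
  simp only [weight]
  rw [Real.rpow_neg (by positivity)]
  norm_cast

end Weight

variable [NormedSpace ℝ H] [MeasurableSpace H] {E : Type*} [NormedAddCommGroup E]

/-- Measurable functions that are integrable against `weight`: the ordinary functions for which
convolutions with, and pairings against, Schwartz functions are absolutely convergent. -/
structure Tame (V : H → E) (μ : Measure H) : Prop where
  aestronglyMeasurable : AEStronglyMeasurable V μ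
  integrable : Integrable (fun y => weight y * ‖V y‖) μ

variable [BorelSpace H] {μ : Measure H} {V : H → E}

theorem Tame.mono {F : Type*} [NormedAddCommGroup F] {W : H → F} (hW : Tame W μ)
    (hV : AEStronglyMeasurable V μ) (h : ∀ x, ‖V x‖ ≤ ‖W x‖) : Tame V μ where
  aestronglyMeasurable := hV
  integrable := hW.integrable.mono
    (continuous_weight.aestronglyMeasurable.mul hV.norm) (Eventually.of_forall fun x => by
      simpa [abs_of_pos (weight_pos x)] using
        mul_le_mul_of_nonneg_left (h x) (weight_pos x).le)

variable [FiniteDimensional ℝ H]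

theorem Tame.locallyIntegrable (hV : Tame V μ) : LocallyIntegrable V μ := by
  rw [locallyIntegrable_iff]
  intro k hk
  have h := hV.integrable.integrableOn (s := k) |>.continuousOn_mul
    (continuous_weight.inv₀ fun y => (weight_pos y).ne').continuousOn hk
  refine (integrable_norm_iff hV.aestronglyMeasurable.restrict).1
    (h.congr (Eventually.of_forall fun y => ?_))
  exact inv_mul_cancel_left₀ (weight_pos y).ne' _

variable [μ.IsAddHaarMeasure]

theorem Tame.of_ae_bound (hV : AEStronglyMeasurable V μ) {R : ℝ} (h : ∀ᵐ y ∂μ, ‖V y‖ ≤ R) :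
    Tame V μ := by
  refine ⟨hV, ((integrable_weight μ).mul_const R).mono'
    (continuous_weight.aestronglyMeasurable.mul hV.norm) ?_⟩
  filter_upwards [h] with y hy
  rw [norm_mul, norm_norm, Real.norm_of_nonneg (weight_pos y).le]
  exact mul_le_mul_of_nonneg_left hy (weight_pos y).le

theorem Tame.of_memLp {p : ℝ≥0∞} (hp : 1 ≤ p) (hV : MemLp V p μ) : Tame V μ := by
  rcases eq_or_ne p ⊤ with rfl | p_ne_top
  · exact .of_ae_bound hV.1 (ae_le_lpNorm_exponent_top hV)
  have t_one_le : 1 ≤ p.toReal := by simpa using ENNReal.toReal_mono p_ne_top hp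
  have dominant := (integrable_weight μ).add
    (hV.integrable_norm_rpow (one_pos.trans_le hp).ne' p_ne_top)
  refine ⟨hV.1, dominant.mono' (continuous_weight.aestronglyMeasurable.mul hV.1.norm)
    (Eventually.of_forall fun y => ?_)⟩
  have w_pos := weight_pos y
  rw [norm_mul, norm_norm, Real.norm_of_nonneg w_pos.le, Pi.add_apply]
  rcases le_total ‖V y‖ 1 with small | large
  · exact (mul_le_of_le_one_right w_pos.le small).trans
      (le_add_of_nonneg_right (by positivity))
  · calc weight y * ‖V y‖ ≤ ‖V y‖ ^ p.toReal :=
          (mul_le_of_le_one_left (norm_nonneg _) (weight_le_one y)).trans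
            (Real.self_le_rpow_of_one_le large t_one_le)
      _ ≤ _ := le_add_of_nonneg_left w_pos.le

end Tame

section ConvolutionSchwartz

theorem enorm_convolution_le {H E' F G : Type*} [AddCommGroup H] [MeasurableSpace H]
    {μ : Measure H} [NormedAddCommGroup E'] [NormedSpace ℝ E'] [NormedAddCommGroup F]
    [NormedSpace ℝ F] [NormedAddCommGroup G] [NormedSpace ℝ G] (L : E' →L[ℝ] F →L[ℝ] G)
    (V : H → E') (h : H → F) (x : H) :
    ‖(V ⋆[L, μ] h) x‖ₑ ≤ ‖L‖ₑ * ((fun y => ‖V y‖ₑ) ⋆ₗ[μ] fun y => ‖h y‖ₑ) x := by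
  rw [convolution, lconvolution, ← lintegral_const_mul' _ _ enorm_ne_top]
  refine (enorm_integral_le_lintegral_enorm _).trans (lintegral_mono fun y => ?_)
  rw [neg_add_eq_sub, ← mul_assoc]
  exact L.le_opENorm₂ _ _

variable {H E' F G : Type*} [NormedAddCommGroup H] [NormedSpace ℝ H] [FiniteDimensional ℝ H]
  [MeasurableSpace H] [BorelSpace H]
  [NormedAddCommGroup E'] [NormedSpace ℝ E'] [NormedAddCommGroup F] [NormedSpace ℝ F]
  [NormedAddCommGroup G] [NormedSpace ℝ G] {μ : Measure H} {V : H → E'}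

theorem Tame.convolutionExistsAt (hV : Tame V μ) (L : E' →L[ℝ] F →L[ℝ] G) (h : 𝓢(H, F)) (x : H) :
    ConvolutionExistsAt V h x L μ := by
  obtain ⟨C, -, hC⟩ := exists_norm_schwartz_sub_le_weight h x
  refine ((hV.integrable.const_mul (‖L‖ * C)).mono' (L.aestronglyMeasurable_comp₂
    hV.aestronglyMeasurable (by fun_prop)) (Eventually.of_forall fun y => ?_))
  calc ‖L (V y) (h (x - y))‖ ≤ ‖L‖ * ‖V y‖ * ‖h (x - y)‖ := L.le_opNorm₂ _ _
    _ ≤ ‖L‖ * ‖V y‖ * (C * weight y) := by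
      gcongr
      exact hC x (Metric.mem_ball_self one_pos) y
    _ = ‖L‖ * C * (weight y * ‖V y‖) := by ring

theorem Tame.hasFDerivAt_convolution (hV : Tame V μ) (L : E' →L[ℝ] F →L[ℝ] G) (h : 𝓢(H, F))
    (x : H) : HasFDerivAt (V ⋆[L, μ] h)
      ((V ⋆[L.precompR H, μ] SchwartzMap.fderivCLM ℝ H F h) x) x := by
  obtain ⟨C, -, hC⟩ := exists_norm_schwartz_sub_le_weight (SchwartzMap.fderivCLM ℝ H F h) x
  refine hasFDerivAt_integral_of_dominated_of_fderiv_le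
    (bound := fun y => ‖L‖ * C * (weight y * ‖V y‖))
    (F' := fun z y => L.precompR H (V y) (SchwartzMap.fderivCLM ℝ H F h (z - y)))
    (Metric.ball_mem_nhds x one_pos)
    (Eventually.of_forall fun z => (hV.convolutionExistsAt L h z).aestronglyMeasurable)
    (hV.convolutionExistsAt L h x) (hV.convolutionExistsAt _ _ x).aestronglyMeasurable
    (Eventually.of_forall fun y z hz => ?_) (hV.integrable.const_mul _)
    (Eventually.of_forall fun y z _ => ?_)
  · calc ‖L.precompR H (V y) (SchwartzMap.fderivCLM ℝ H F h (z - y))‖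
        ≤ ‖L.precompR H‖ * ‖V y‖ * ‖SchwartzMap.fderivCLM ℝ H F h (z - y)‖ :=
          (L.precompR H).le_opNorm₂ _ _
      _ ≤ ‖L‖ * ‖V y‖ * (C * weight y) := by
        gcongr
        · exact ContinuousLinearMap.norm_precompR_le H L
        · exact hC z hz y
      _ = ‖L‖ * C * (weight y * ‖V y‖) := by ring
  · have deriv_translate := ((h.hasFDerivAt (z - y)).comp z ((hasFDerivAt_id z).sub_const y))
    exact ((L (V y)).hasFDerivAt.comp z deriv_translate)

theorem Tame.fderiv_convolution (hV : Tame V μ) (L : E' →L[ℝ] F →L[ℝ] G) (h : 𝓢(H, F)) :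
    fderiv ℝ (V ⋆[L, μ] h) = V ⋆[L.precompR H, μ] SchwartzMap.fderivCLM ℝ H F h :=
  funext fun x => (hV.hasFDerivAt_convolution L h x).fderiv

end ConvolutionSchwartz

section Smoothness

variable {H : Type u} {E' : Type*} [NormedAddCommGroup H] [NormedSpace ℝ H]
  [FiniteDimensional ℝ H] [MeasurableSpace H] [BorelSpace H] [NormedAddCommGroup E']
  [NormedSpace ℝ E'] {μ : Measure H} {V : H → E'}

theorem Tame.contDiff_convolution (hV : Tame V μ) {F G : Type u} [NormedAddCommGroup F]
    [NormedSpace ℝ F] [NormedAddCommGroup G] [NormedSpace ℝ G] (L : E' →L[ℝ] F →L[ℝ] G)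
    (h : 𝓢(H, F)) : ContDiff ℝ ∞ (V ⋆[L, μ] h) := by
  refine contDiff_infty.2 fun k => ?_
  induction k generalizing F G with
  | zero => exact contDiff_zero.2 (continuous_iff_continuousAt.2 fun x =>
      (hV.hasFDerivAt_convolution L h x).continuousAt)
  | succ k ih =>
    rw [Nat.cast_succ, contDiff_succ_iff_fderiv, hV.fderiv_convolution L h]
    exact ⟨fun x => (hV.hasFDerivAt_convolution L h x).differentiableAt, by simp, ih _ _⟩

theorem Tame.enorm_iteratedFDeriv_convolution_le (hV : Tame V μ)
    {F G : Type u} [NormedAddCommGroup F] [NormedSpace ℝ F] [NormedAddCommGroup G]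
    [NormedSpace ℝ G] (L : E' →L[ℝ] F →L[ℝ] G) (h : 𝓢(H, F)) (k : ℕ) (x : H) :
    ‖iteratedFDeriv ℝ k (V ⋆[L, μ] h) x‖ₑ ≤
      ‖L‖ₑ * ((fun y => ‖V y‖ₑ) ⋆ₗ[μ] fun y => ‖iteratedFDeriv ℝ k h y‖ₑ) x := by
  induction k generalizing F G with
  | zero =>
    simpa only [← ofReal_norm, norm_iteratedFDeriv_zero] using enorm_convolution_le L V h x
  | succ k ih =>
    have norm_deriv (y : H) : ‖iteratedFDeriv ℝ k (SchwartzMap.fderivCLM ℝ H F h) y‖ₑ =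
        ‖iteratedFDeriv ℝ (k + 1) h y‖ₑ := by
      simp only [← ofReal_norm]
      exact congrArg _ norm_iteratedFDeriv_fderiv
    calc ‖iteratedFDeriv ℝ (k + 1) (V ⋆[L, μ] h) x‖ₑ
        = ‖iteratedFDeriv ℝ k (V ⋆[L.precompR H, μ] SchwartzMap.fderivCLM ℝ H F h) x‖ₑ := by
          rw [← hV.fderiv_convolution L h]
          simp only [← ofReal_norm, norm_iteratedFDeriv_fderiv]
      _ ≤ _ := ih (L.precompR H) (SchwartzMap.fderivCLM ℝ H F h)
      _ ≤ _ := by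
          simp only [norm_deriv]
          gcongr
          simpa only [← ofReal_norm] using
            ENNReal.ofReal_le_ofReal (ContinuousLinearMap.norm_precompR_le H L)

end Smoothness

section TameConvolution

variable {H E' F G : Type*} [NormedAddCommGroup H] [NormedSpace ℝ H] [FiniteDimensional ℝ H]
  [MeasurableSpace H] [BorelSpace H]
  [NormedAddCommGroup E'] [NormedAddCommGroup F] [NormedSpace ℝ F]
  {μ : Measure H} [μ.IsAddHaarMeasure] {V : H → E'}

theorem Tame.integrable_weight_mul_convolution_integrand (hV : Tame V μ) (h : 𝓢(H, F)) :
    Integrable (fun p : H × H => weight p.1 * (‖V p.2‖ * ‖h (p.1 - p.2)‖)) (μ.prod μ) := by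
  obtain ⟨C, -, hC⟩ := exists_weight_mul_norm_schwartz_sub_le h
  refine ((hV.integrable.convolution_integrand (.mul ℝ ℝ) (integrable_weight μ)).const_mul C).mono'
    ?_ (Eventually.of_forall fun p => ?_)
  · exact (continuous_weight.comp continuous_fst).aestronglyMeasurable.mul
      (hV.aestronglyMeasurable.comp_snd.norm.mul
        (h.continuous.comp (by fun_prop)).aestronglyMeasurable.norm)
  · have := weight_pos p.1
    rw [Real.norm_of_nonneg (by positivity), ContinuousLinearMap.mul_apply']
    calc weight p.1 * (‖V p.2‖ * ‖h (p.1 - p.2)‖)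
        = weight p.1 * ‖h (p.1 - p.2)‖ * ‖V p.2‖ := by ring
      _ ≤ C * (weight (p.1 - p.2) * weight p.2) * ‖V p.2‖ :=
          mul_le_mul_of_nonneg_right (hC _ _) (norm_nonneg _)
      _ = C * (weight p.2 * ‖V p.2‖ * weight (p.1 - p.2)) := by ring

variable [NormedSpace ℝ E'] [NormedAddCommGroup G] [NormedSpace ℝ G]

theorem Tame.convolution (hV : Tame V μ) (L : E' →L[ℝ] F →L[ℝ] G) (h : 𝓢(H, F)) :
    Tame (V ⋆[L, μ] h) μ := by
  have measurable : AEStronglyMeasurable (V ⋆[L, μ] h) μ :=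
    AEStronglyMeasurable.integral_prod_right' (f := fun p : H × H => L (V p.2) (h (p.1 - p.2)))
      (L.aestronglyMeasurable_comp₂ hV.aestronglyMeasurable.comp_snd
        (h.continuous.comp (continuous_fst.sub continuous_snd)).aestronglyMeasurable)
  have integrable := hV.integrable_weight_mul_convolution_integrand h
  refine ⟨measurable, (integrable.integral_prod_left.const_mul ‖L‖).mono'
    (continuous_weight.aestronglyMeasurable.mul measurable.norm) ?_⟩
  filter_upwards [integrable.prod_right_ae] with x hx
  have w_pos := weight_pos x
  calc ‖weight x * ‖(V ⋆[L, μ] h) x‖‖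
      = ‖∫ y, weight x • L (V y) (h (x - y)) ∂μ‖ := by
        rw [integral_smul, norm_smul, norm_mul, norm_norm]
        rfl
    _ ≤ ∫ y, ‖L‖ * (weight x * (‖V y‖ * ‖h (x - y)‖)) ∂μ := by
        refine norm_integral_le_of_norm_le (hx.const_mul ‖L‖) (Eventually.of_forall fun y => ?_)
        rw [norm_smul, Real.norm_of_nonneg w_pos.le, mul_left_comm, ← mul_assoc ‖L‖]
        exact mul_le_mul_of_nonneg_left (L.le_opNorm₂ _ _) w_pos.le
    _ = _ := integral_const_mul ..

end TameConvolution

section Density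

variable {H : Type*} [NormedAddCommGroup H] [InnerProductSpace ℝ H] [MeasurableSpace H]
  [BorelSpace H] {V W : H → ℂ}

theorem Tame.sub {μ : Measure H} (hV : Tame V μ) (hW : Tame W μ) : Tame (V - W) μ := by
  refine ⟨hV.1.sub hW.1, (hV.integrable.add hW.integrable).mono'
    (continuous_weight.aestronglyMeasurable.mul (hV.1.sub hW.1).norm)
    (Eventually.of_forall fun x => ?_)⟩
  rw [norm_mul, norm_norm, Real.norm_of_nonneg (weight_pos x).le, Pi.add_apply, ← mul_add]
  exact mul_le_mul_of_nonneg_left (norm_sub_le _ _) (weight_pos x).le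

theorem Tame.integrable_schwartz_mul {μ : Measure H} (hV : Tame V μ) (g : 𝓢(H, ℂ)) :
    Integrable (fun x => g x * V x) μ := by
  obtain ⟨C, -, hC⟩ := exists_norm_schwartz_le_weight g
  refine (hV.integrable.const_mul C).mono' (g.continuous.aestronglyMeasurable.mul hV.1)
    (Eventually.of_forall fun x => ?_)
  rw [norm_mul, ← mul_assoc]
  exact mul_le_mul_of_nonneg_right (hC x) (norm_nonneg _)

variable [FiniteDimensional ℝ H] {f g : 𝓢'(H, ℂ)}

/-- The tempered distribution `f` is integration against the function `V`. -/
structure HasDensity (f : 𝓢'(H, ℂ)) (V : H → ℂ) : Prop where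
  tame : Tame V volume
  apply_eq : ∀ g : 𝓢(H, ℂ), f g = ∫ x, g x * V x

theorem ae_eq_of_forall_integral_schwartz_mul_eq (hV : LocallyIntegrable V volume)
    (hW : LocallyIntegrable W volume)
    (h : ∀ g : 𝓢(H, ℂ), ∫ x, g x * V x = ∫ x, g x * W x) : V =ᵐ[volume] W := by
  refine ae_eq_of_integral_contDiff_smul_eq hV hW fun g g_smooth g_cpt => ?_
  have cpt : HasCompactSupport (Complex.ofRealCLM ∘ g) := g_cpt.comp_left rfl
  have smooth : ContDiff ℝ ∞ (Complex.ofRealCLM ∘ g) := by fun_prop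
  simpa using h (cpt.toSchwartzMap smooth)

theorem HasDensity.ae_eq (hV : HasDensity f V) (hW : HasDensity f W) : V =ᵐ[volume] W :=
  ae_eq_of_forall_integral_schwartz_mul_eq hV.tame.locallyIntegrable hW.tame.locallyIntegrable
    fun g => by rw [← hV.apply_eq, ← hW.apply_eq]

theorem HasDensity.congr (hf : HasDensity f V) (h : V =ᵐ[volume] W) : HasDensity f W where
  tame := ⟨hf.tame.1.congr h, hf.tame.integrable.congr (h.mono fun x hx => by simp only [hx])⟩
  apply_eq g := (hf.apply_eq g).trans (integral_congr_ae (h.mono fun x hx => by simp only [hx]))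

theorem HasDensity.zero : HasDensity (0 : 𝓢'(H, ℂ)) 0 :=
  ⟨⟨aestronglyMeasurable_zero, by simp⟩, fun g => by simp⟩

theorem HasDensity.sub (hf : HasDensity f V) (hg : HasDensity g W) :
    HasDensity (f - g) (V - W) where
  tame := hf.tame.sub hg.tame
  apply_eq h := by
    simp only [Pi.sub_apply, mul_sub]
    rw [integral_sub (hf.tame.integrable_schwartz_mul h) (hg.tame.integrable_schwartz_mul h),
      ← hf.apply_eq, ← hg.apply_eq]
    rfl

theorem HasDensity.add (hf : HasDensity f V) (hg : HasDensity g W) :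
    HasDensity (f + g) (V + W) := by
  simpa using hf.sub (HasDensity.zero.sub hg)

theorem HasDensity.sum {ι : Type*} (s : Finset ι) {f : ι → 𝓢'(H, ℂ)} {V : ι → H → ℂ}
    (h : ∀ i ∈ s, HasDensity (f i) (V i)) : HasDensity (∑ i ∈ s, f i) (∑ i ∈ s, V i) := by
  classical
  induction s using Finset.induction_on with
  | empty => simpa using HasDensity.zero
  | insert i s hi ih =>
    rw [Finset.sum_insert hi, Finset.sum_insert hi]
    exact (h i (s.mem_insert_self i)).add (ih fun j hj => h j (Finset.mem_insert_of_mem hj))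

theorem hasDensity_toTemperedDistribution {p : ℝ≥0∞} [hp : Fact (1 ≤ p)]
    (V : Lp ℂ p (volume : Measure H)) : HasDensity (V : 𝓢'(H, ℂ)) V :=
  ⟨.of_memLp hp.out (Lp.memLp V), fun g => by simp [Lp.toTemperedDistribution_apply]⟩

theorem exists_hasDensity {p : ℝ≥0∞} (hp : 1 ≤ p) (hV : MemLp V p volume) :
    ∃ f : 𝓢'(H, ℂ), HasDensity f V :=
  haveI : Fact (1 ≤ p) := ⟨hp⟩
  ⟨_, (hasDensity_toTemperedDistribution hV.toLp).congr hV.coeFn_toLp⟩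

end Density

section Dilation

variable {H : Type*} [NormedAddCommGroup H] [InnerProductSpace ℝ H]

/-- The dilation `x ↦ σ (l x)` of a Schwartz function. -/
def dilate (l : ℝˣ) : 𝓢(H, ℂ) →L[ℂ] 𝓢(H, ℂ) :=
  SchwartzMap.compCLMOfContinuousLinearEquiv ℂ (ContinuousLinearEquiv.smulLeft l)

@[simp]
theorem dilate_apply (l : ℝˣ) (σ : 𝓢(H, ℂ)) (x : H) : dilate l σ x = σ ((l : ℝ) • x) := rfl

theorem eLpNorm_comp_smul [MeasurableSpace H] [BorelSpace H] [FiniteDimensional ℝ H]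
    {F : Type*} [NormedAddCommGroup F] {f : H → F} (hf : AEStronglyMeasurable f volume)
    (l : ℝˣ) (p : ℝ≥0∞) :
    eLpNorm (fun x => f ((l : ℝ) • x)) p volume =
      ‖(l : ℝ)‖ₑ ^ (-(Module.finrank ℝ H * p.toReal⁻¹)) * eLpNorm f p volume := by
  have map_smul : Measure.map ((l : ℝ) • ·) (volume : Measure H) =
      (‖(l : ℝ)‖ₑ ^ (-(Module.finrank ℝ H : ℝ))) • volume := by
    rw [Measure.map_addHaar_smul _ l.ne_zero, ENNReal.rpow_neg, ENNReal.rpow_natCast, abs_inv,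
      abs_pow, ENNReal.ofReal_inv_of_pos (by have := abs_pos.2 l.ne_zero; positivity),
      ENNReal.ofReal_pow (abs_nonneg _), ← Real.norm_eq_abs, ofReal_norm]
  have pos : ‖(l : ℝ)‖ₑ ^ (-(Module.finrank ℝ H : ℝ)) ≠ 0 := by simp
  change eLpNorm (f ∘ ((l : ℝ) • ·)) p volume = _
  have hf' : AEStronglyMeasurable f (Measure.map ((l : ℝ) • ·) volume) := by
    rw [map_smul]
    exact hf.smul_measure _
  rw [← eLpNorm_map_measure hf' (measurable_const_smul _).aemeasurable, map_smul,
    eLpNorm_smul_measure_of_ne_zero pos, smul_eq_mul, ← ENNReal.rpow_mul, one_div,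
    ENNReal.toReal_inv, neg_mul]

end Dilation

section Multiplier

variable {H : Type*} [NormedAddCommGroup H] [InnerProductSpace ℝ H] [FiniteDimensional ℝ H]
  [MeasurableSpace H] [BorelSpace H] {f : 𝓢'(H, ℂ)} {V : H → ℂ}

theorem fourier_fourier_apply (σ : 𝓢(H, ℂ)) (ξ : H) : 𝓕 (𝓕 σ) ξ = σ (-ξ) := by
  have h : 𝓕⁻ (𝓕 σ) (-ξ) = σ (-ξ) := by rw [FourierTransform.fourierInv_fourier_eq]
  rw [← h, SchwartzMap.fourierInv_coe, Real.fourierInv_eq_fourier_neg, neg_neg,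
    SchwartzMap.fourier_coe]

theorem fourier_smulLeftCLM_fourierInv_apply (σ g : 𝓢(H, ℂ)) (y : H) :
    𝓕 (SchwartzMap.smulLeftCLM ℂ σ (𝓕⁻ g)) y = ∫ x, g x * 𝓕⁻ σ (x - y) := by
  have reflect : 𝓕 (SchwartzMap.smulLeftCLM ℂ σ (𝓕⁻ g)) =
      SchwartzMap.convolution (.mul ℂ ℂ) g (𝓕 σ) := by
    ext y
    change _ = 𝓕⁻ (SchwartzMap.pairing (.mul ℂ ℂ) (𝓕 g) (𝓕 (𝓕 σ))) y
    rw [SchwartzMap.fourierInv_coe, Real.fourierInv_eq_fourier_comp_neg, SchwartzMap.fourier_coe]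
    refine congrArg (fun F : H → ℂ => 𝓕 F y) (funext fun ξ => ?_)
    rw [SchwartzMap.smulLeftCLM_apply_apply σ.hasTemperateGrowth, SchwartzMap.pairing_apply_apply,
      fourier_fourier_apply, neg_neg, SchwartzMap.fourierInv_coe, Real.fourierInv_eq_fourier_neg,
      SchwartzMap.fourier_coe, smul_eq_mul, ContinuousLinearMap.mul_apply', mul_comm]
  rw [reflect, SchwartzMap.convolution_apply, convolution]
  refine integral_congr_ae (Eventually.of_forall fun x => ?_)
  simp only [ContinuousLinearMap.mul_apply', SchwartzMap.fourierInv_coe, SchwartzMap.fourier_coe,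
    Real.fourierInv_eq_fourier_neg, neg_sub]

theorem HasDensity.fourierMultiplierCLM (hf : HasDensity f V) (σ : 𝓢(H, ℂ)) :
    HasDensity (TemperedDistribution.fourierMultiplierCLM ℂ σ f)
      (V ⋆[.mul ℝ ℂ, volume] (𝓕⁻ σ : 𝓢(H, ℂ))) := by
  refine ⟨hf.tame.convolution _ _, fun g => ?_⟩
  obtain ⟨C, -, hC⟩ := exists_norm_schwartz_le_weight g
  have integrable : Integrable (fun p : H × H => g p.1 * (V p.2 * 𝓕⁻ σ (p.1 - p.2))) := by
    refine ((hf.tame.integrable_weight_mul_convolution_integrand (𝓕⁻ σ)).const_mul C).mono'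
      ((g.continuous.comp continuous_fst).aestronglyMeasurable.mul
        (hf.tame.aestronglyMeasurable.comp_snd.mul ((𝓕⁻ σ).continuous.comp
          (continuous_fst.sub continuous_snd)).aestronglyMeasurable))
      (Eventually.of_forall fun p => ?_)
    rw [norm_mul, norm_mul, ← mul_assoc C]
    exact mul_le_mul_of_nonneg_right (hC p.1) (mul_nonneg (norm_nonneg _) (norm_nonneg _))
  calc TemperedDistribution.fourierMultiplierCLM ℂ σ f g
      = ∫ y, ∫ x, g x * (V y * 𝓕⁻ σ (x - y)) := by
        rw [TemperedDistribution.fourierMultiplierCLM_apply_apply, hf.apply_eq]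
        simp only [fourier_smulLeftCLM_fourierInv_apply, ← integral_mul_const]
        congr! 4
        ring
    _ = ∫ x, ∫ y, g x * (V y * 𝓕⁻ σ (x - y)) := (integral_integral_swap integrable).symm
    _ = ∫ x, g x * (V ⋆[.mul ℝ ℂ, volume] (𝓕⁻ σ : 𝓢(H, ℂ))) x := by
        simp only [integral_const_mul]
        rfl

/-- The convolution kernel of the Fourier multiplier with the dilated symbol `ξ ↦ σ (l⁻¹ ξ)`. -/
def kernel (σ : 𝓢(H, ℂ)) (l : ℝˣ) : 𝓢(H, ℂ) := 𝓕⁻ (dilate l⁻¹ σ)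

theorem kernel_apply (σ : 𝓢(H, ℂ)) (l : ℝˣ) (x : H) :
    kernel σ l x = |(l : ℝ)| ^ Module.finrank ℝ H • kernel σ 1 ((l : ℝ) • x) := by
  have h := Measure.integral_comp_smul (volume : Measure H)
    (fun ξ : H => Complex.exp ((2 * Real.pi * inner ℝ ξ ((l : ℝ) • x) : ℝ) * Complex.I) • σ ξ)
    (l : ℝ)⁻¹
  rw [inv_pow, inv_inv, abs_pow] at h
  simp only [kernel, SchwartzMap.fourierInv_coe, Real.fourierInv_eq', dilate_apply, inv_one,
    Units.val_one, one_smul, Units.val_inv_eq_inv_val]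
  rw [← h]
  congr! 5 with ξ
  rw [real_inner_smul_left, real_inner_smul_right]
  field_simp

theorem iteratedFDeriv_kernel (σ : 𝓢(H, ℂ)) (l : ℝˣ) (k : ℕ) (x : H) :
    iteratedFDeriv ℝ k (kernel σ l) x =
      (|(l : ℝ)| ^ Module.finrank ℝ H * (l : ℝ) ^ k) •
        iteratedFDeriv ℝ k (kernel σ 1) ((l : ℝ) • x) := by
  have h : ⇑(kernel σ l) =
      (|(l : ℝ)| ^ Module.finrank ℝ H) • fun x => kernel σ 1 ((l : ℝ) • x) :=
    funext (kernel_apply σ l)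
  have smooth : ContDiff ℝ k fun x => kernel σ 1 ((l : ℝ) • x) :=
    ((kernel σ 1).smooth k).comp (contDiff_const_smul _)
  rw [h, iteratedFDeriv_const_smul_apply smooth.contDiffAt,
    iteratedFDeriv_comp_const_smul _ ((kernel σ 1).smooth k), smul_smul]

theorem eLpNorm_iteratedFDeriv_kernel (σ : 𝓢(H, ℂ)) (l : ℝˣ) (k : ℕ) (p : ℝ≥0∞) :
    eLpNorm (iteratedFDeriv ℝ k (kernel σ l)) p volume =
      ‖(l : ℝ)‖ₑ ^ (k + Module.finrank ℝ H * (1 - p.toReal⁻¹)) *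
        eLpNorm (iteratedFDeriv ℝ k (kernel σ 1)) p volume := by
  have h : iteratedFDeriv ℝ k (kernel σ l) = (|(l : ℝ)| ^ Module.finrank ℝ H * (l : ℝ) ^ k) •
      fun x => iteratedFDeriv ℝ k (kernel σ 1) ((l : ℝ) • x) :=
    funext (iteratedFDeriv_kernel σ l k)
  have meas : AEStronglyMeasurable (iteratedFDeriv ℝ k (kernel σ 1)) volume :=
    (((kernel σ 1).smooth k).continuous_iteratedFDeriv le_rfl).aestronglyMeasurable
  have hl : ‖(l : ℝ)‖ₑ ≠ 0 := by simp
  rw [h, eLpNorm_const_smul, eLpNorm_comp_smul meas, ← mul_assoc, enorm_mul, enorm_pow, enorm_pow,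
    Real.enorm_abs, ← ENNReal.rpow_natCast, ← ENNReal.rpow_natCast,
    ← ENNReal.rpow_add _ _ hl enorm_ne_top, ← ENNReal.rpow_add _ _ hl enorm_ne_top]
  congr 2
  ring

end Multiplier

section DistNorm

variable {N : ℕ} {p : ℝ≥0∞} [hp : Fact (1 ≤ p)] {f : 𝓢'(E N, ℂ)} {V : E N → ℂ}

theorem HasDensity.distNorm_eq (hf : HasDensity f V) : distNorm p f = eLpNorm V p volume := by
  refine le_antisymm ?_ (le_iInf₂ fun g hg => ?_)
  · by_cases hV : eLpNorm V p volume = ⊤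
    · exact hV ▸ le_top
    · have memLp : MemLp V p volume := ⟨hf.tame.1, lt_top_iff_ne_top.2 hV⟩
      refine (iInf₂_le memLp.toLp ?_).trans (Lp.enorm_toLp memLp).le
      ext g
      rw [hf.apply_eq, ((hasDensity_toTemperedDistribution memLp.toLp).congr
        memLp.coeFn_toLp).apply_eq]
  · rw [Lp.enorm_def, hf.ae_eq (hg ▸ hasDensity_toTemperedDistribution g) |> eLpNorm_congr_ae]

theorem exists_hasDensity_of_distNorm_lt_top (hf : distNorm p f < ⊤) :
    ∃ V, HasDensity f V ∧ MemLp V p volume := by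
  simp only [distNorm, iInf_lt_iff] at hf
  obtain ⟨g, rfl, -⟩ := hf
  exact ⟨g, hasDensity_toTemperedDistribution g, Lp.memLp g⟩

end DistNorm

section ApproximateIdentity

variable {H : Type*} [NormedAddCommGroup H] [InnerProductSpace ℝ H] (σ : 𝓢(H, ℂ))

theorem norm_schwartz_sub_zero_le (x : H) :
    ‖σ x - σ 0‖ ≤ SchwartzMap.seminorm ℝ 0 1 σ * ‖x‖ := by
  simpa using Convex.norm_image_sub_le_of_norm_fderiv_le (𝕜 := ℝ) (f := σ) (x := 0) (y := x)
    (fun y _ => σ.differentiableAt)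
    (fun y _ => norm_iteratedFDeriv_one (𝕜 := ℝ) (f := σ) (x := y) ▸
      SchwartzMap.norm_iteratedFDeriv_le_seminorm ℝ σ 1 y) convex_univ trivial trivial

theorem norm_iteratedFDeriv_comp_smul_sub_le {l : ℝ} (hl : |l| ≤ 1) (i : ℕ) (x : H) :
    ‖iteratedFDeriv ℝ i (fun y => σ (l • y) - σ 0) x‖ ≤
      |l| * ((SchwartzMap.seminorm ℝ 0 1 σ + SchwartzMap.seminorm ℝ 0 i σ) * (1 + ‖x‖)) := by
  have nonneg (j : ℕ) : 0 ≤ SchwartzMap.seminorm ℝ 0 j σ := apply_nonneg _ _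
  rcases i with _ | j
  · rw [norm_iteratedFDeriv_zero]
    calc ‖σ (l • x) - σ 0‖ ≤ SchwartzMap.seminorm ℝ 0 1 σ * ‖l • x‖ :=
          norm_schwartz_sub_zero_le σ _
      _ = |l| * (SchwartzMap.seminorm ℝ 0 1 σ * ‖x‖) := by
          rw [norm_smul, Real.norm_eq_abs]
          ring
      _ ≤ _ := by
          have := nonneg 0
          have := nonneg 1
          gcongr <;> linarith
  · have fderiv_eq : fderiv ℝ (fun y => σ (l • y) - σ 0) = fderiv ℝ fun y => σ (l • y) := by
      ext1 y
      rw [fderiv_sub_const]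
    rw [← norm_iteratedFDeriv_fderiv, fderiv_eq, norm_iteratedFDeriv_fderiv,
      iteratedFDeriv_comp_const_smul _ (σ.smooth (j + 1)), norm_smul, norm_pow, Real.norm_eq_abs]
    refine mul_le_mul (pow_le_of_le_one (abs_nonneg l) hl j.succ_ne_zero) ?_ (norm_nonneg _)
      (abs_nonneg l)
    calc ‖iteratedFDeriv ℝ (j + 1) σ (l • x)‖ ≤ SchwartzMap.seminorm ℝ 0 (j + 1) σ :=
          SchwartzMap.norm_iteratedFDeriv_le_seminorm ℝ σ _ _
      _ ≤ _ := by nlinarith [nonneg 1, nonneg (j + 1), norm_nonneg x]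

theorem exists_seminorm_dilate_smul_sub_le (ψ : 𝓢(H, ℂ)) (k n : ℕ) :
    ∃ C : ℝ, ∀ l : ℝˣ, |(l : ℝ)| ≤ 1 →
      SchwartzMap.seminorm ℂ k n (SchwartzMap.smulLeftCLM ℂ (dilate l σ) ψ - σ 0 • ψ) ≤
        |(l : ℝ)| * C := by
  set M : ℕ → ℝ := fun i => SchwartzMap.seminorm ℝ 0 1 σ + SchwartzMap.seminorm ℝ 0 i σ
  set B : ℕ → ℝ := fun i => SchwartzMap.seminorm ℝ k i ψ + SchwartzMap.seminorm ℝ (k + 1) i ψ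
  refine ⟨∑ i ∈ Finset.range (n + 1), n.choose i * M i * B (n - i), fun l hl =>
    SchwartzMap.seminorm_le_bound ℂ k n _ (by positivity) fun x => ?_⟩
  have coe_eq : ⇑(SchwartzMap.smulLeftCLM ℂ (dilate l σ) ψ - σ 0 • ψ) =
      fun y => (σ ((l : ℝ) • y) - σ 0) * ψ y := by
    ext y
    simp [SchwartzMap.smulLeftCLM_apply_apply (dilate l σ).hasTemperateGrowth, sub_mul]
  have smooth : ContDiff ℝ ∞ fun y : H => σ ((l : ℝ) • y) - σ 0 :=
    ((σ.smooth ⊤).comp (contDiff_const_smul _)).sub contDiff_const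
  have moment (i : ℕ) : ‖x‖ ^ k * (1 + ‖x‖) * ‖iteratedFDeriv ℝ i ψ x‖ ≤ B i := by
    have h₁ := SchwartzMap.le_seminorm ℝ k i ψ x
    have h₂ := SchwartzMap.le_seminorm ℝ (k + 1) i ψ x
    exact (by ring : _ = _).trans_le (add_le_add h₁ h₂)
  rw [coe_eq, Finset.mul_sum]
  calc _ ≤ ‖x‖ ^ k * ∑ i ∈ Finset.range (n + 1), (n.choose i : ℝ) *
          ‖iteratedFDeriv ℝ i (fun y => σ ((l : ℝ) • y) - σ 0) x‖ *
          ‖iteratedFDeriv ℝ (n - i) ψ x‖ := by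
        gcongr
        exact norm_iteratedFDeriv_mul_le smooth (ψ.smooth ⊤) x (mod_cast le_top)
    _ ≤ ‖x‖ ^ k * ∑ i ∈ Finset.range (n + 1), (n.choose i : ℝ) *
          (|(l : ℝ)| * (M i * (1 + ‖x‖))) * ‖iteratedFDeriv ℝ (n - i) ψ x‖ := by
        gcongr with i
        exact norm_iteratedFDeriv_comp_smul_sub_le σ hl i x
    _ = ∑ i ∈ Finset.range (n + 1), |(l : ℝ)| * (n.choose i * M i *
          (‖x‖ ^ k * (1 + ‖x‖) * ‖iteratedFDeriv ℝ (n - i) ψ x‖)) := by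
        rw [Finset.mul_sum]
        exact Finset.sum_congr rfl fun i _ => by ring
    _ ≤ _ := by
        gcongr with i
        exact moment _

variable [FiniteDimensional ℝ H] [MeasurableSpace H] [BorelSpace H]

theorem tendsto_fourierMultiplierCLM_dilate (f : 𝓢'(H, ℂ)) (g : 𝓢(H, ℂ)) {ι : Type*}
    {u : Filter ι} {l : ι → ℝˣ} (hl : Tendsto (fun i => (l i : ℝ)) u (𝓝 0)) :
    Tendsto (fun i => TemperedDistribution.fourierMultiplierCLM ℂ (dilate (l i) σ) f g) u
      (𝓝 (σ 0 * f g)) := by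
  have abs_tendsto : Tendsto (fun i => |(l i : ℝ)|) u (𝓝 0) := by simpa using hl.abs
  have symbol_tendsto : Tendsto (fun i => SchwartzMap.smulLeftCLM ℂ (dilate (l i) σ) (𝓕⁻ g)) u
      (𝓝 (σ 0 • 𝓕⁻ g)) := by
    rw [(schwartz_withSeminorms ℂ H ℂ).tendsto_nhds]
    rintro ⟨k, n⟩ ε hε
    obtain ⟨C, hC⟩ := exists_seminorm_dilate_smul_sub_le σ (𝓕⁻ g) k n
    have bound_tendsto : Tendsto (fun i => |(l i : ℝ)| * C) u (𝓝 0) := by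
      simpa using abs_tendsto.mul_const C
    filter_upwards [bound_tendsto.eventually_lt_const hε, abs_tendsto.eventually_le_const one_pos]
      with i hi hle
    exact (hC _ hle).trans_lt hi
  have continuous : Continuous fun ψ : 𝓢(H, ℂ) => f (𝓕 ψ) :=
    (map_continuous f).comp (FourierTransform.fourierCLM ℂ 𝓢(H, ℂ)).continuous
  simpa [Function.comp_def, FourierTransform.fourier_smul] using
    (continuous.tendsto _).comp symbol_tendsto

end ApproximateIdentity

namespace LPCouple

variable {N : ℕ} (P : LPCouple N)

theorem φ_eq_zero {ξ : E N} (h : ‖ξ‖ < 3 / 4 ∨ 8 / 3 < ‖ξ‖) : P.φ ξ = 0 := by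
  refine image_eq_zero_of_notMem_tsupport fun hξ => ?_
  have := P.supp_φ hξ
  rcases h with h | h <;> linarith [this.1, this.2]

theorem χ_eq_zero {ξ : E N} (h : 4 / 3 < ‖ξ‖) : P.χ ξ = 0 :=
  image_eq_zero_of_notMem_tsupport fun hξ => h.not_ge (P.supp_χ hξ)

theorem χ_eq_one {ξ : E N} (h : ‖ξ‖ < 3 / 4) : P.χ ξ = 1 := by
  have φ_zero (q : ℕ) : P.φ ((2 : ℝ) ^ (-(q : ℤ)) • ξ) = 0 := by
    refine P.φ_eq_zero (Or.inl ?_)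
    rw [norm_smul, Real.norm_of_nonneg (by positivity)]
    have : (2 : ℝ) ^ (-(q : ℤ)) ≤ 1 := zpow_le_one_of_nonpos₀ (by norm_num) (by omega)
    nlinarith [norm_nonneg ξ]
  have sum_eq := P.inhom ξ
  simp only [φ_zero] at sum_eq
  linarith [sum_eq.unique hasSum_zero]

theorem χ_sub (ξ : E N) : P.χ ((2 : ℝ)⁻¹ • ξ) - P.χ ξ = P.φ ξ := by
  have shifted : HasSum (fun q : ℕ => P.φ ((2 : ℝ) ^ (-((q + 1 : ℕ) : ℤ)) • ξ))
      (1 - P.χ ((2 : ℝ)⁻¹ • ξ)) := by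
    refine (P.inhom ((2 : ℝ)⁻¹ • ξ)).congr_fun fun q => ?_
    rw [smul_smul, Nat.cast_succ, neg_add, zpow_add₀ two_ne_zero, zpow_neg_one]
  have h := ((hasSum_nat_add_iff' 1).2 (P.inhom ξ)).unique shifted
  simp only [Finset.range_one, Finset.sum_singleton, Nat.cast_zero, neg_zero, zpow_zero,
    one_smul] at h
  linarith

theorem hasCompactSupport_χ : HasCompactSupport P.χ :=
  (isCompact_closedBall 0 (4 / 3)).of_isClosed_subset (isClosed_tsupport _) fun ξ hξ => by
    simpa using P.supp_χ hξ

theorem hasCompactSupport_φ : HasCompactSupport P.φ :=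
  (isCompact_closedBall 0 (8 / 3)).of_isClosed_subset (isClosed_tsupport _) fun ξ hξ => by
    simpa using (P.supp_φ hξ).2

theorem φ_mul_χ_of_le {q j : ℤ} (h : q + 2 ≤ j) (ξ : E N) :
    P.φ ((2 : ℝ) ^ (-q) • ξ) * P.χ ((2 : ℝ) ^ (-j) • ξ) = P.φ ((2 : ℝ) ^ (-q) • ξ) := by
  rcases lt_or_ge (8 / 3) ‖(2 : ℝ) ^ (-q) • ξ‖ with hξ | hξ
  · rw [P.φ_eq_zero (Or.inr hξ), zero_mul]
  · rw [P.χ_eq_one, mul_one]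
    rw [norm_smul, Real.norm_of_nonneg (by positivity)] at hξ ⊢
    have : (2 : ℝ) ^ (-j) * ‖ξ‖ ≤ (2 : ℝ) ^ (-(q + 2)) * ‖ξ‖ := by gcongr; norm_num
    rw [neg_add, zpow_add₀ two_ne_zero, show (2 : ℝ) ^ (-2 : ℤ) = 1 / 4 by norm_num] at this
    linarith

theorem φ_mul_χ_eq_zero {q j : ℤ} (h : j + 1 ≤ q) (ξ : E N) :
    P.φ ((2 : ℝ) ^ (-q) • ξ) * P.χ ((2 : ℝ) ^ (-j) • ξ) = 0 := by
  rcases lt_or_ge ‖(2 : ℝ) ^ (-q) • ξ‖ (3 / 4) with hξ | hξ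
  · rw [P.φ_eq_zero (Or.inl hξ), zero_mul]
  · rw [P.χ_eq_zero, mul_zero]
    rw [norm_smul, Real.norm_of_nonneg (by positivity)] at hξ ⊢
    have : (2 : ℝ) ^ (-q) * ‖ξ‖ ≤ (2 : ℝ) ^ (-(j + 1)) * ‖ξ‖ := by gcongr; norm_num
    rw [neg_add, zpow_add₀ two_ne_zero, show (2 : ℝ) ^ (-1 : ℤ) = 1 / 2 by norm_num] at this
    linarith

end LPCouple

section Symbols

variable {N : ℕ}

/-- The symbol `m(2π ·)` of the multiplier `m(D)`, in the normalisation of Mathlib's Fourier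
transform, as a Schwartz function. -/
def symbol (m : E N → ℝ) (m_smooth : ContDiff ℝ ∞ m) (m_cpt : HasCompactSupport m) : 𝓢(E N, ℂ) :=
  HasCompactSupport.toSchwartzMap (f := fun ξ => ((m ((2 * Real.pi) • ξ) : ℝ) : ℂ))
    ((m_cpt.comp_smul Real.two_pi_pos.ne').comp_left (g := ((↑) : ℝ → ℂ)) rfl)
    (Complex.ofRealCLM.contDiff.comp (m_smooth.comp (contDiff_id.const_smul _)))

/-- The symbol of the low-frequency cut-off at frequency `1`. -/
def LPCouple.symχ (P : LPCouple N) : 𝓢(E N, ℂ) := symbol P.χ P.smooth_χ P.hasCompactSupport_χ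

/-- The symbol of the dyadic block at frequency `1`. -/
def LPCouple.symφ (P : LPCouple N) : 𝓢(E N, ℂ) := symbol P.φ P.smooth_φ P.hasCompactSupport_φ

/-- The dyadic frequency `2 ^ q`, as a unit so that it can be used as a dilation factor. -/
def dyadic (q : ℤ) : ℝˣ := Units.mk0 2 two_ne_zero ^ q

@[simp]
theorem coe_dyadic (q : ℤ) : (dyadic q : ℝ) = 2 ^ q := by simp [dyadic]

variable (P : LPCouple N)

theorem dilate_symχ_apply (q : ℤ) (ξ : E N) :
    dilate (dyadic q)⁻¹ P.symχ ξ = P.χ ((2 : ℝ) ^ (-q) • (2 * Real.pi) • ξ) := by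
  change ((P.χ ((2 * Real.pi) • ((dyadic q)⁻¹ : ℝˣ).val • ξ) : ℝ) : ℂ) = _
  rw [smul_comm, Units.val_inv_eq_inv_val, coe_dyadic, zpow_neg]

theorem dilate_symφ_apply (q : ℤ) (ξ : E N) :
    dilate (dyadic q)⁻¹ P.symφ ξ = P.φ ((2 : ℝ) ^ (-q) • (2 * Real.pi) • ξ) := by
  change ((P.φ ((2 * Real.pi) • ((dyadic q)⁻¹ : ℝˣ).val • ξ) : ℝ) : ℂ) = _
  rw [smul_comm, Units.val_inv_eq_inv_val, coe_dyadic, zpow_neg]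

theorem block_eq (q : ℤ) : block P q =
    TemperedDistribution.fourierMultiplierCLM ℂ (dilate (dyadic q)⁻¹ P.symφ) := by
  unfold block multiplier
  congr 1
  ext ξ
  rw [dilate_symφ_apply]

theorem cutoff_eq (q : ℤ) : cutoff P q =
    TemperedDistribution.fourierMultiplierCLM ℂ (dilate (dyadic q)⁻¹ P.symχ) := by
  unfold cutoff multiplier
  congr 1
  ext ξ
  rw [dilate_symχ_apply]

theorem fourierMultiplierCLM_comp_apply (σ τ : 𝓢(E N, ℂ)) (f : 𝓢'(E N, ℂ)) :
    TemperedDistribution.fourierMultiplierCLM ℂ τ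
      (TemperedDistribution.fourierMultiplierCLM ℂ σ f) =
      TemperedDistribution.fourierMultiplierCLM ℂ (⇑σ * ⇑τ) f :=
  TemperedDistribution.fourierMultiplierCLM_fourierMultiplierCLM_apply σ.hasTemperateGrowth
    τ.hasTemperateGrowth f

theorem cutoff_block_comm (q j : ℤ) (f : 𝓢'(E N, ℂ)) :
    cutoff P j (block P q f) = block P q (cutoff P j f) := by
  simp only [cutoff_eq, block_eq, fourierMultiplierCLM_comp_apply, mul_comm]

theorem cutoff_comm (q j : ℤ) (f : 𝓢'(E N, ℂ)) :
    cutoff P j (cutoff P q f) = cutoff P q (cutoff P j f) := by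
  simp only [cutoff_eq, fourierMultiplierCLM_comp_apply, mul_comm]

theorem cutoff_block_eq_self {q j : ℤ} (h : q + 2 ≤ j) (f : 𝓢'(E N, ℂ)) :
    cutoff P j (block P q f) = block P q f := by
  rw [cutoff_eq, block_eq, fourierMultiplierCLM_comp_apply]
  congr 2
  ext ξ
  rw [Pi.mul_apply, dilate_symφ_apply, dilate_symχ_apply, ← Complex.ofReal_mul,
    P.φ_mul_χ_of_le h]

theorem cutoff_block_eq_zero {q j : ℤ} (h : j + 1 ≤ q) (f : 𝓢'(E N, ℂ)) :
    cutoff P j (block P q f) = 0 := by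
  have symbol_eq : ⇑(dilate (dyadic q)⁻¹ P.symφ) * ⇑(dilate (dyadic j)⁻¹ P.symχ) =
      fun _ => 0 := by
    ext ξ
    rw [Pi.mul_apply, dilate_symφ_apply, dilate_symχ_apply, ← Complex.ofReal_mul,
      P.φ_mul_χ_eq_zero h, Complex.ofReal_zero]
  rw [cutoff_eq, block_eq, fourierMultiplierCLM_comp_apply, symbol_eq,
    TemperedDistribution.fourierMultiplierCLM_const, zero_smul, zero_apply]

theorem cutoff_succ_sub (q : ℤ) (f : 𝓢'(E N, ℂ)) :
    cutoff P (q + 1) f - cutoff P q f = block P q f := by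
  have symbol_eq : ⇑(dilate (dyadic (q + 1))⁻¹ P.symχ) - ⇑(dilate (dyadic q)⁻¹ P.symχ) =
      dilate (dyadic q)⁻¹ P.symφ := by
    ext ξ
    rw [Pi.sub_apply, dilate_symχ_apply, dilate_symχ_apply, dilate_symφ_apply, ← P.χ_sub, neg_add,
      zpow_add₀ two_ne_zero, zpow_neg_one, mul_comm, mul_smul, Complex.ofReal_sub]
  simp only [cutoff_eq, block_eq, TemperedDistribution.fourierMultiplierCLM_apply]
  rw [← symbol_eq, TemperedDistribution.smulLeftCLM_sub (dilate _ _).hasTemperateGrowth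
    (dilate _ _).hasTemperateGrowth, sub_apply]
  exact (map_sub (FourierTransform.fourierInvCLM ℂ 𝓢'(E N, ℂ)) _ _).symm

theorem sum_block_Ico (f : 𝓢'(E N, ℂ)) {m n : ℤ} (h : m ≤ n) :
    ∑ q ∈ Finset.Ico m n, block P q f = cutoff P n f - cutoff P m f := by
  induction n, h using Int.leInduction with
  | base => simp
  | succ n h ih =>
    rw [← Finset.insert_Ico_right_eq_Ico_add_one h, Finset.sum_insert (by simp), ih,
      ← cutoff_succ_sub]
    abel

theorem tendsto_cutoff (f : 𝓢'(E N, ℂ)) (g : 𝓢(E N, ℂ)) :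
    Tendsto (fun q : ℤ => cutoff P q f g) atTop (𝓝 (f g)) := by
  have symχ_zero : P.symχ 0 = 1 := by
    change ((P.χ ((2 * Real.pi) • 0) : ℝ) : ℂ) = 1
    rw [smul_zero, P.χ_eq_one (by simp), Complex.ofReal_one]
  have dyadic_tendsto : Tendsto (fun q : ℤ => ((dyadic q)⁻¹ : ℝˣ).val) atTop (𝓝 0) := by
    simp only [Units.val_inv_eq_inv_val, coe_dyadic, ← Real.rpow_intCast]
    exact ((tendsto_rpow_atTop_of_base_gt_one 2 one_lt_two).comp
      tendsto_intCast_atTop_atTop).inv_tendsto_atTop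
  simpa only [cutoff_eq, symχ_zero, one_mul] using
    tendsto_fourierMultiplierCLM_dilate P.symχ f g dyadic_tendsto

end Symbols

section RegularAtZero

variable {N : ℕ} {P : LPCouple N} {f : 𝓢'(E N, ℂ)}

theorem enorm_apply_le_distNorm_top (hf : distNorm ⊤ f < ⊤) (g : 𝓢(E N, ℂ)) :
    ‖f g‖ₑ ≤ distNorm ⊤ f * ∫⁻ x, ‖g x‖ₑ := by
  obtain ⟨V, hV, -⟩ := exists_hasDensity_of_distNorm_lt_top hf
  rw [hV.distNorm_eq, hV.apply_eq, eLpNorm_exponent_top,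
    ← lintegral_const_mul _ g.continuous.enorm.measurable]
  refine (enorm_integral_le_lintegral_enorm _).trans (lintegral_mono_ae ?_)
  filter_upwards [ae_le_eLpNormEssSup (f := V) (μ := volume)] with x hx
  rw [enorm_mul, mul_comm]
  gcongr

theorem MemSh.tendsto_cutoff_atBot (hf : MemSh P f) (g : 𝓢(E N, ℂ)) :
    Tendsto (fun q => cutoff P q f g) atBot (𝓝 0) := by
  rw [tendsto_zero_iff_enorm_tendsto_zero]
  have bound : Tendsto (fun q => distNorm ⊤ (cutoff P q f) * ∫⁻ x, ‖g x‖ₑ) atBot (𝓝 0) := by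
    simpa using ENNReal.Tendsto.mul_const hf (Or.inr g.integrable.2.ne)
  refine tendsto_of_tendsto_of_tendsto_of_le_of_le' tendsto_const_nhds bound
    (Eventually.of_forall fun _ => zero_le) ?_
  filter_upwards [hf.eventually_lt_const ENNReal.zero_lt_top] with q hq
  exact enorm_apply_le_distNorm_top hq g

theorem MemSh.lowPart_eq (hf : MemSh P f) : lowPart P f = cutoff P 1 f := by
  refine Tendsto.limUnder_eq ?_
  rw [PointwiseConvergenceCLM.tendsto_iff_forall_tendsto]
  intro g
  have indices : Tendsto (fun m : ℕ => -(m : ℤ) + 1) atTop atBot :=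
    tendsto_atBot_add_const_right _ _ (tendsto_neg_atTop_atBot.comp tendsto_natCast_atTop_atTop)
  have limit := (tendsto_const_nhds (x := cutoff P 1 f g)).sub
    ((hf.tendsto_cutoff_atBot g).comp indices)
  rw [sub_zero] at limit
  refine limit.congr fun m => ?_
  have Ioc_eq : Finset.Ioc (-(m : ℤ)) 0 = Finset.Ico (-(m : ℤ) + 1) 1 := by
    ext q
    simp only [Finset.mem_Ioc, Finset.mem_Ico]
    omega
  rw [Ioc_eq, sum_block_Ico P f (by omega), sub_apply, Function.comp_apply]

theorem MemSh.tendsto_sum_block (hf : MemSh P f) (g : 𝓢(E N, ℂ)) :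
    Tendsto (fun n : ℕ => ∑ q ∈ Finset.Ico (-(n : ℤ)) n, block P q f g) atTop (𝓝 (f g)) := by
  have limit := ((tendsto_cutoff P f g).comp tendsto_natCast_atTop_atTop).sub
    ((hf.tendsto_cutoff_atBot g).comp (tendsto_neg_atTop_atBot.comp tendsto_natCast_atTop_atTop))
  rw [sub_zero] at limit
  refine limit.congr fun n => ?_
  simpa only [sub_apply, sum_apply, Function.comp_apply] using
    (DFunLike.congr_fun (sum_block_Ico P f (by omega : -(n : ℤ) ≤ n)) g).symm

end RegularAtZero

section ConvolutionNorm

variable {H : Type*} [NormedAddCommGroup H] [NormedSpace ℝ H] [FiniteDimensional ℝ H]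
  [MeasurableSpace H] [BorelSpace H] {μ : Measure H} [μ.IsAddHaarMeasure] {V : H → ℂ} {p : ℝ≥0∞}

theorem enorm_mul_le_one : ‖ContinuousLinearMap.mul ℝ ℂ‖ₑ ≤ 1 := by
  rw [← enorm_one (G := ℝ), enorm_le_iff_norm_le, norm_one]
  exact ContinuousLinearMap.opNorm_mul_le ℝ ℂ

theorem eLpNorm_convolution_le (hp : 1 ≤ p) (hV : AEStronglyMeasurable V μ) (h : 𝓢(H, ℂ)) :
    eLpNorm (V ⋆[.mul ℝ ℂ, μ] h) p μ ≤ eLpNorm V p μ * ∫⁻ x, ‖h x‖ₑ ∂μ := by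
  calc eLpNorm (V ⋆[.mul ℝ ℂ, μ] h) p μ
      ≤ eLpNorm ((fun y => ‖V y‖ₑ) ⋆ₗ[μ] fun y => ‖h y‖ₑ) p μ := by
        exact eLpNorm_mono_enorm fun x => (enorm_convolution_le _ V h x).trans
          (mul_le_of_le_one_left' enorm_mul_le_one)
    _ ≤ eLpNorm (fun y => ‖V y‖ₑ) p μ * ∫⁻ x, ‖h x‖ₑ ∂μ :=
        eLpNorm_lconvolution_le hp hV.enorm h.continuous.enorm.measurable
    _ = _ := by rw [eLpNorm_enorm]

end ConvolutionNorm

section AnnularSymbol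

variable {H : Type*} [NormedAddCommGroup H] [InnerProductSpace ℝ H]

/-- Symbols supported in an annulus: compactly supported and vanishing near the origin. -/
structure AnnularSymbol (σ : 𝓢(H, ℂ)) : Prop where
  hasCompactSupport : HasCompactSupport σ
  eventually_eq_zero : ∀ᶠ ξ in 𝓝 0, σ ξ = 0

namespace AnnularSymbol

variable {σ : 𝓢(H, ℂ)} (hσ : AnnularSymbol σ) (e : H)

include hσ in
theorem contDiff_inner_div_norm_sq_mul :
    ContDiff ℝ ∞ fun ξ : H => ((inner ℝ e ξ * (‖ξ‖ ^ 2)⁻¹ : ℝ) : ℂ) * σ ξ := by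
  refine contDiff_iff_contDiffAt.2 fun ξ => ?_
  by_cases h : ξ = 0
  · refine (contDiffAt_const (c := (0 : ℂ))).congr_of_eventuallyEq ?_
    filter_upwards [h ▸ hσ.eventually_eq_zero] with ξ hξ
    rw [hξ, mul_zero]
  · refine ContDiffAt.mul (Complex.ofRealCLM.contDiff.contDiffAt.comp ξ ?_)
      (σ.smooth ⊤).contDiffAt
    exact (contDiff_const.inner ℝ contDiff_id).contDiffAt.mul
      ((contDiff_norm_sq ℝ).contDiffAt.inv (pow_ne_zero 2 (norm_ne_zero_iff.2 h)))

/-- The symbol `⟪e, ξ⟫ (2πi |ξ|²)⁻¹ σ(ξ)`, which recovers `σ` from the symbol of a derivative in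
the direction `e` by summing over an orthonormal basis. -/
def component : 𝓢(H, ℂ) :=
  (2 * Real.pi * Complex.I : ℂ)⁻¹ • HasCompactSupport.toSchwartzMap
    (hσ.hasCompactSupport.mul_left (f := fun ξ => ((inner ℝ e ξ * (‖ξ‖ ^ 2)⁻¹ : ℝ) : ℂ)))
    (hσ.contDiff_inner_div_norm_sq_mul e)

theorem component_apply (ξ : H) : hσ.component e ξ =
    (2 * Real.pi * Complex.I)⁻¹ * (((inner ℝ e ξ * (‖ξ‖ ^ 2)⁻¹ : ℝ) : ℂ) * σ ξ) := rfl

theorem annularSymbol_component : AnnularSymbol (hσ.component e) where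
  hasCompactSupport := hσ.hasCompactSupport.mono fun ξ hξ h => hξ (by simp [component_apply, h])
  eventually_eq_zero := hσ.eventually_eq_zero.mono fun ξ hξ => by simp [component_apply, hξ]

variable [FiniteDimensional ℝ H]

theorem sum_inner_mul_component (ξ : H) :
    ∑ i, (2 * Real.pi * Complex.I) * (inner ℝ (stdOrthonormalBasis ℝ H i) ξ *
      hσ.component (stdOrthonormalBasis ℝ H i) ξ) = σ ξ := by
  have term_eq (i : Fin (Module.finrank ℝ H)) :
      (2 * Real.pi * Complex.I) * (inner ℝ (stdOrthonormalBasis ℝ H i) ξ *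
        hσ.component (stdOrthonormalBasis ℝ H i) ξ) =
      ((‖inner ℝ (stdOrthonormalBasis ℝ H i) ξ‖ ^ 2 : ℝ) : ℂ) *
        ((((‖ξ‖ ^ 2)⁻¹ : ℝ) : ℂ) * σ ξ) := by
    rw [component_apply, Real.norm_eq_abs, sq_abs]
    push_cast
    field_simp [Complex.two_pi_I_ne_zero]
  rw [Finset.sum_congr rfl fun i _ => term_eq i, ← Finset.sum_mul, ← Complex.ofReal_sum,
    OrthonormalBasis.sum_sq_norm_inner_right]
  by_cases h : ξ = 0
  · rw [h, hσ.eventually_eq_zero.self_of_nhds, mul_zero, mul_zero]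
  · rw [← mul_assoc, ← Complex.ofReal_mul, mul_inv_cancel₀ (pow_ne_zero 2 (norm_ne_zero_iff.2 h)),
      Complex.ofReal_one, one_mul]

variable [MeasurableSpace H] [BorelSpace H]

theorem smul_kernel_eq_sum (l : ℝˣ) : ((l : ℝ) : ℂ) • kernel σ l =
    ∑ i, ∂_{stdOrthonormalBasis ℝ H i} (kernel (hσ.component (stdOrthonormalBasis ℝ H i)) l) := by
  simp only [kernel, SchwartzMap.lineDerivOp_fourierInv_eq]
  change ((l : ℝ) : ℂ) • FourierTransform.fourierInvCLM ℂ 𝓢(H, ℂ) _ =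
    ∑ i, FourierTransform.fourierInvCLM ℂ 𝓢(H, ℂ) _
  rw [← map_sum, ← map_smul]
  congr 1
  ext ξ
  have unit_eq : ((l : ℝ) : ℂ) * (((l⁻¹ : ℝˣ) : ℝ) : ℂ) = 1 := by
    rw [← Complex.ofReal_mul, Units.mul_inv, Complex.ofReal_one]
  simp only [sum_apply, smul_apply, smul_eq_mul, dilate_apply]
  rw [← hσ.sum_inner_mul_component, Finset.mul_sum]
  refine Finset.sum_congr rfl fun i _ => ?_
  rw [SchwartzMap.smulLeftCLM_apply_apply (by fun_prop), dilate_apply, real_inner_smul_right,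
    real_inner_comm _ ξ, Complex.real_smul, Complex.ofReal_mul]
  linear_combination (2 * Real.pi * Complex.I) *
    ((inner ℝ (stdOrthonormalBasis ℝ H i) ξ : ℝ) : ℂ) *
      hσ.component (stdOrthonormalBasis ℝ H i) (((l⁻¹ : ℝˣ) : ℝ) • ξ) * unit_eq

end AnnularSymbol

end AnnularSymbol

section Derivatives

theorem norm_iteratedFDeriv_fderiv_apply_le {H : Type*} [NormedAddCommGroup H]
    [NormedSpace ℝ H] {F : H → ℂ} {k j : ℕ} (hF : ContDiff ℝ (k + 1 : ℕ) F) (hj : j ≤ k)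
    {e : H} (he : ‖e‖ = 1) (x : H) :
    ‖iteratedFDeriv ℝ j (fun y => fderiv ℝ F y e) x‖ ≤ ‖iteratedFDeriv ℝ (j + 1) F x‖ := by
  have fderiv_contDiff : ContDiff ℝ k (fderiv ℝ F) := hF.fderiv_right (by norm_cast)
  refine (norm_iteratedFDeriv_clm_apply_const fderiv_contDiff.contDiffAt
    (mod_cast hj)).trans_eq ?_
  rw [he, one_mul, norm_iteratedFDeriv_fderiv]

variable {H : Type*} [NormedAddCommGroup H] [NormedSpace ℝ H] [FiniteDimensional ℝ H]
  [MeasurableSpace H] [BorelSpace H] {μ : Measure H} [μ.IsAddHaarMeasure]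

theorem convolution_lineDeriv {E₁ E₂ E₃ : Type*} [NormedAddCommGroup E₁] [NormedSpace ℝ E₁]
    [NormedAddCommGroup E₂] [NormedSpace ℝ E₂] [NormedAddCommGroup E₃] [NormedSpace ℝ E₃]
    {F : H → E₁} (hF : Differentiable ℝ F) (hF_tame : Tame F μ) {e : H}
    (hF'_tame : Tame (fun y => fderiv ℝ F y e) μ) (L : E₁ →L[ℝ] E₂ →L[ℝ] E₃) (h : 𝓢(H, E₂)) :
    F ⋆[L, μ] (∂_{e} h : 𝓢(H, E₂)) = (fun y => fderiv ℝ F y e) ⋆[L, μ] h := by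
  ext x
  have h_deriv (y : H) : HasLineDerivAt ℝ (fun y => h (x - y)) (-(∂_{e} h) (x - y)) y e := by
    have := ((h.hasFDerivAt (x - y)).comp y ((hasFDerivAt_id y).const_sub x)).hasLineDerivAt e
    simpa [SchwartzMap.lineDerivOp_apply_eq_fderiv, Function.comp_def] using this
  have parts := integral_bilinear_hasLineDerivAt_right_eq_neg_left_of_integrable
    (hF'_tame.convolutionExistsAt L h x)
    ((hF_tame.convolutionExistsAt L (∂_{e} h) x).neg.congr
      (Eventually.of_forall fun y => (map_neg (L (F y)) _).symm))
    (hF_tame.convolutionExistsAt L h x) (fun y _ => (hF y).hasFDerivAt.hasLineDerivAt e)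
    (fun y _ => h_deriv y)
  simp only [map_neg, integral_neg, neg_inj] at parts
  exact parts

end Derivatives

section ReverseBernstein

variable {H : Type*} [NormedAddCommGroup H] [InnerProductSpace ℝ H] [FiniteDimensional ℝ H]
  [MeasurableSpace H] [BorelSpace H] {p : ℝ≥0∞} {σ : 𝓢(H, ℂ)} {F : H → ℂ}

theorem AnnularSymbol.smul_convolution_kernel (hσ : AnnularSymbol σ) (l : ℝˣ)
    (hF : Differentiable ℝ F) (hF_tame : Tame F volume)
    (hF'_tame : ∀ i, Tame (fun y => fderiv ℝ F y (stdOrthonormalBasis ℝ H i)) volume) :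
    ((l : ℝ) : ℂ) • (F ⋆[.mul ℝ ℂ, volume] kernel σ l) = ∑ i,
      (fun y => fderiv ℝ F y (stdOrthonormalBasis ℝ H i)) ⋆[.mul ℝ ℂ, volume]
        kernel (hσ.component (stdOrthonormalBasis ℝ H i)) l := by
  have convolution_sum : F ⋆[.mul ℝ ℂ, volume] (((l : ℝ) : ℂ) • kernel σ l : 𝓢(H, ℂ)) =
      ∑ i, F ⋆[.mul ℝ ℂ, volume] (∂_{stdOrthonormalBasis ℝ H i}
        (kernel (hσ.component (stdOrthonormalBasis ℝ H i)) l) : 𝓢(H, ℂ)) := by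
    rw [hσ.smul_kernel_eq_sum]
    ext x
    rw [Finset.sum_apply]
    simp only [convolution, sum_apply, map_sum]
    exact integral_finsetSum _ fun i _ => hF_tame.convolutionExistsAt (.mul ℝ ℂ) _ x
  rw [← Finset.sum_congr rfl fun i _ => convolution_lineDeriv hF hF_tame (hF'_tame i) _ _,
    ← convolution_sum]
  ext x
  simp only [convolution, Pi.smul_apply, smul_apply, ← integral_smul]
  congr 1
  ext y
  exact (mul_smul_comm ((l : ℝ) : ℂ) (F y) (kernel σ l (x - y))).symm

theorem AnnularSymbol.enorm_mul_eLpNorm_convolution_le (hp : 1 ≤ p) (hσ : AnnularSymbol σ)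
    (l : ℝˣ) (hF : Differentiable ℝ F) (hF_tame : Tame F volume)
    (hF'_tame : ∀ i, Tame (fun y => fderiv ℝ F y (stdOrthonormalBasis ℝ H i)) volume) :
    ‖(l : ℝ)‖ₑ * eLpNorm (F ⋆[.mul ℝ ℂ, volume] kernel σ l) p volume ≤ ∑ i,
      eLpNorm ((fun y => fderiv ℝ F y (stdOrthonormalBasis ℝ H i)) ⋆[.mul ℝ ℂ, volume]
        kernel (hσ.component (stdOrthonormalBasis ℝ H i)) l) p volume := by
  have enorm_eq : ‖(l : ℝ)‖ₑ = ‖((l : ℝ) : ℂ)‖ₑ := by simp [enorm_eq_nnnorm]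
  rw [enorm_eq, ← eLpNorm_const_smul, hσ.smul_convolution_kernel l hF hF_tame hF'_tame]
  exact eLpNorm_sum_le
    (fun i _ => ((hF'_tame _).convolution (.mul ℝ ℂ) _).aestronglyMeasurable) hp

theorem AnnularSymbol.exists_pow_mul_eLpNorm_convolution_le (hp : 1 ≤ p) (k : ℕ)
    (hσ : AnnularSymbol σ) : ∃ C : ℝ≥0∞, C < ⊤ ∧ ∀ (l : ℝˣ) (F : H → ℂ), ContDiff ℝ k F →
      (∀ i ≤ k, Tame (iteratedFDeriv ℝ i F) volume) →
      ‖(l : ℝ)‖ₑ ^ k * eLpNorm (F ⋆[.mul ℝ ℂ, volume] kernel σ l) p volume ≤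
        C * eLpNorm (iteratedFDeriv ℝ k F) p volume := by
  induction k generalizing σ with
  | zero =>
    refine ⟨∫⁻ x, ‖kernel σ 1 x‖ₑ, (kernel σ 1).integrable.2, fun l F hF _ => ?_⟩
    have kernel_eq : ∫⁻ x, ‖kernel σ l x‖ₑ = ∫⁻ x, ‖kernel σ 1 x‖ₑ := by
      simpa [eLpNorm_one_eq_lintegral_enorm, enorm_eq_nnnorm, ← norm_toNNReal] using
        eLpNorm_iteratedFDeriv_kernel σ l 0 1
    have deriv_eq : eLpNorm (iteratedFDeriv ℝ 0 F) p volume = eLpNorm F p volume :=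
      eLpNorm_congr_norm_ae (Eventually.of_forall fun x => norm_iteratedFDeriv_zero)
    rw [pow_zero, one_mul, deriv_eq, ← kernel_eq, mul_comm]
    exact eLpNorm_convolution_le hp hF.continuous.aestronglyMeasurable _
  | succ k ih =>
    set b := stdOrthonormalBasis ℝ H
    choose C C_lt_top hC using fun i => ih (hσ.annularSymbol_component (b i))
    refine ⟨∑ i, C i, ENNReal.sum_lt_top.2 fun i _ => C_lt_top i, fun l F hF hF_tame => ?_⟩
    have deriv_contDiff (i) : ContDiff ℝ k fun x => fderiv ℝ F x (b i) :=
      (hF.fderiv_right (by norm_cast)).clm_apply contDiff_const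
    have norm_le (i) {j : ℕ} (hj : j ≤ k) (x : H) :=
      norm_iteratedFDeriv_fderiv_apply_le hF hj (b.norm_eq_one i) x
    have deriv_tame (i) {j : ℕ} (hj : j ≤ k) :
        Tame (iteratedFDeriv ℝ j fun x => fderiv ℝ F x (b i)) volume :=
      (hF_tame (j + 1) (by omega)).mono ((deriv_contDiff i).continuous_iteratedFDeriv
        (mod_cast hj)).aestronglyMeasurable (norm_le i hj)
    have reduce := hσ.enorm_mul_eLpNorm_convolution_le hp l (hF.differentiable (by simp))
      ((hF_tame 0 (by omega)).mono hF.continuous.aestronglyMeasurable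
        fun x => norm_iteratedFDeriv_zero.ge)
      fun i => (deriv_tame i k.zero_le).mono (deriv_contDiff i).continuous.aestronglyMeasurable
        fun x => norm_iteratedFDeriv_zero.ge
    rw [pow_succ, mul_assoc, Finset.sum_mul]
    refine (mul_le_mul_right reduce _).trans ?_
    rw [Finset.mul_sum]
    refine Finset.sum_le_sum fun i _ => ?_
    refine (hC i l _ (deriv_contDiff i) fun j hj => deriv_tame i hj).trans ?_
    gcongr
    exact eLpNorm_mono (norm_le i le_rfl)

end ReverseBernstein

section Composition

theorem hasFDerivAt_integral_unitInterval {H F : Type*} [NormedAddCommGroup H] [NormedSpace ℝ H]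
    [ProperSpace H] [NormedAddCommGroup F] [NormedSpace ℝ F] {f : H × ℝ → F}
    (hf : ContDiff ℝ 1 f) (x : H) :
    HasFDerivAt (fun x => ∫ τ in (0 : ℝ)..1, f (x, τ))
      (∫ τ in (0 : ℝ)..1, (fderiv ℝ f (x, τ)).comp (ContinuousLinearMap.inl ℝ H ℝ)) x := by
  have hc : Continuous fun p : H × ℝ => (fderiv ℝ f p).comp (ContinuousLinearMap.inl ℝ H ℝ) :=
    (hf.continuous_fderiv one_ne_zero).clm_comp continuous_const
  obtain ⟨C, hC⟩ := ((isCompact_closedBall x 1).prod isCompact_Icc).exists_bound_of_continuousOn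
    (hc.continuousOn (s := Metric.closedBall x 1 ×ˢ Icc (0 : ℝ) 1))
  have hfc := hf.continuous
  refine intervalIntegral.hasFDerivAt_integral_of_dominated_of_fderiv_le
    (F' := fun x τ => (fderiv ℝ f (x, τ)).comp (ContinuousLinearMap.inl ℝ H ℝ))
    (bound := fun _ => C) (Metric.ball_mem_nhds x one_pos)
    (Eventually.of_forall fun y => (hfc.comp (by fun_prop)).aestronglyMeasurable)
    ((hfc.comp (by fun_prop)).intervalIntegrable _ _)
    (hc.comp (by fun_prop : Continuous fun τ : ℝ => (x, τ))).aestronglyMeasurable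
    (Eventually.of_forall fun τ hτ y hy => hC (y, τ) ⟨Metric.ball_subset_closedBall hy, ?_⟩)
    intervalIntegrable_const (Eventually.of_forall fun τ _ y _ => ?_)
  · rw [uIoc_of_le zero_le_one] at hτ
    exact ⟨hτ.1.le, hτ.2⟩
  · exact (hf.differentiable one_ne_zero (y, τ)).hasFDerivAt.comp y (hasFDerivAt_prodMk_left y τ)

theorem contDiff_integral_unitInterval {H F : Type u} [NormedAddCommGroup H] [NormedSpace ℝ H]
    [ProperSpace H] [NormedAddCommGroup F] [NormedSpace ℝ F] {f : H × ℝ → F}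
    (hf : ContDiff ℝ ∞ f) : ContDiff ℝ ∞ fun x => ∫ τ in (0 : ℝ)..1, f (x, τ) := by
  refine contDiff_infty.2 fun k => ?_
  induction k generalizing F with
  | zero =>
    rw [Nat.cast_zero, contDiff_zero, continuous_iff_continuousAt]
    exact fun x => (hasFDerivAt_integral_unitInterval (hf.of_le (mod_cast le_top)) x).continuousAt
  | succ k ih =>
    rw [Nat.cast_succ, contDiff_succ_iff_hasFDerivAt]
    exact ⟨_, ih ((hf.fderiv_right (by simp)).clm_comp contDiff_const),
      hasFDerivAt_integral_unitInterval (hf.of_le (mod_cast le_top))⟩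

/-- The difference quotient `(K b - K a) / (b - a)`, extended smoothly across the diagonal by
Hadamard's integral formula. -/
def diffQuotient (K : ℝ → ℝ) (p : ℝ × ℝ) : ℝ :=
  ∫ τ in (0 : ℝ)..1, deriv K (p.1 + τ * (p.2 - p.1))

theorem contDiff_diffQuotient {K : ℝ → ℝ} (hK : ContDiff ℝ ∞ K) :
    ContDiff ℝ ∞ (diffQuotient K) :=
  contDiff_integral_unitInterval (f := fun q : (ℝ × ℝ) × ℝ =>
    deriv K (q.1.1 + q.2 * (q.1.2 - q.1.1))) ((contDiff_infty_iff_deriv.1 hK).2.comp (by fun_prop))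

theorem diffQuotient_mul_sub {K : ℝ → ℝ} (hK : ContDiff ℝ 1 K) (a b : ℝ) :
    diffQuotient K (a, b) * (b - a) = K b - K a := by
  have hderiv (τ : ℝ) : HasDerivAt (fun τ : ℝ => K (a + τ * (b - a)))
      (deriv K (a + τ * (b - a)) * (b - a)) τ := by
    refine (hK.differentiable one_ne_zero _).hasDerivAt.comp τ ?_
    simpa using ((hasDerivAt_id τ).mul_const (b - a)).const_add a
  have hcont : Continuous fun τ : ℝ => deriv K (a + τ * (b - a)) * (b - a) :=
    ((hK.continuous_deriv le_rfl).comp (by fun_prop)).mul continuous_const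
  simpa [diffQuotient, ← intervalIntegral.integral_mul_const] using
    intervalIntegral.integral_eq_sub_of_hasDerivAt (a := 0) (b := 1) (fun τ _ => hderiv τ)
      (hcont.intervalIntegrable _ _)

variable {H : Type*} [NormedAddCommGroup H] [NormedSpace ℝ H]

theorem exists_norm_iteratedFDeriv_comp_le {F G : Type*} [NormedAddCommGroup F]
    [NormedSpace ℝ F] [ProperSpace F] [NormedAddCommGroup G] [NormedSpace ℝ G] {g : F → G}
    (hg : ContDiff ℝ ∞ g) (k : ℕ) {A : ℝ} (hA : 1 ≤ A) :
    ∃ C : ℝ, 0 ≤ C ∧ ∀ l : ℝ, 0 ≤ l → ∀ w : H → F, ContDiff ℝ ∞ w → ∀ x,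
      (∀ i ≤ k, ‖iteratedFDeriv ℝ i w x‖ ≤ A * l ^ i) →
      ∀ n ≤ k, ‖iteratedFDeriv ℝ n (g ∘ w) x‖ ≤ C * l ^ n := by
  have hbound (i : ℕ) : ∃ M : ℝ, ∀ p ∈ Metric.closedBall (0 : F) A,
      ‖iteratedFDeriv ℝ i g p‖ ≤ M :=
    (isCompact_closedBall _ _).exists_bound_of_continuousOn
      (hg.continuous_iteratedFDeriv (mod_cast le_top)).continuousOn
  choose M hM using hbound
  set B := ∑ i ∈ Finset.range (k + 1), |M i|
  refine ⟨k.factorial * B * A ^ k, by positivity, fun l hl w hw x hwx n hn => ?_⟩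
  have hx : w x ∈ Metric.closedBall (0 : F) A := by simpa using hwx 0 k.zero_le
  calc ‖iteratedFDeriv ℝ n (g ∘ w) x‖
      ≤ n.factorial * B * (A * l) ^ n := by
        refine norm_iteratedFDeriv_comp_le hg hw (mod_cast le_top) x (fun j hj => ?_)
          (fun j hj1 hj => ?_)
        · exact ((hM j _ hx).trans (le_abs_self _)).trans <|
            Finset.single_le_sum (f := fun i => |M i|) (fun i _ => abs_nonneg _)
              (Finset.mem_range.2 (by omega))
        · refine (hwx j (hj.trans hn)).trans ?_
          rw [mul_pow]
          gcongr
          exact le_self_pow₀ hA (by omega)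
    _ ≤ k.factorial * B * A ^ k * l ^ n := by
        rw [mul_pow, ← mul_assoc]
        gcongr

theorem exists_norm_iteratedFDeriv_comp_sub_comp_le {K : ℝ → ℝ} (hK : ContDiff ℝ ∞ K) (k : ℕ)
    {A : ℝ} (hA : 1 ≤ A) :
    ∃ C : ℝ, 0 ≤ C ∧ ∀ l : ℝ, 0 ≤ l → ∀ w₀ w₁ : H → ℝ, ContDiff ℝ ∞ w₀ → ContDiff ℝ ∞ w₁ → ∀ x,
      (∀ i ≤ k, ‖iteratedFDeriv ℝ i w₀ x‖ ≤ A * l ^ i) →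
      (∀ i ≤ k, ‖iteratedFDeriv ℝ i w₁ x‖ ≤ A * l ^ i) →
      ∀ n ≤ k, ‖iteratedFDeriv ℝ n (fun y => K (w₁ y) - K (w₀ y)) x‖ ≤
        C * ∑ i ∈ Finset.range (n + 1), l ^ i *
          ‖iteratedFDeriv ℝ (n - i) (fun y => w₁ y - w₀ y) x‖ := by
  have hQ := contDiff_diffQuotient hK
  obtain ⟨C, hC0, hC⟩ := exists_norm_iteratedFDeriv_comp_le (H := H) hQ k hA
  refine ⟨2 ^ k * C, by positivity, fun l hl w₀ w₁ h₀ h₁ x hw₀ hw₁ n hn => ?_⟩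
  have hW : ContDiff ℝ ∞ fun y => (w₀ y, w₁ y) := h₀.prodMk h₁
  have hquot : ∀ i ≤ k, ‖iteratedFDeriv ℝ i (diffQuotient K ∘ fun y => (w₀ y, w₁ y)) x‖ ≤
      C * l ^ i := hC l hl _ hW x fun i hi => by
    rw [iteratedFDeriv_prodMk h₀.contDiffAt h₁.contDiffAt (mod_cast le_top),
      ContinuousMultilinearMap.opNorm_prod]
    exact max_le (hw₀ i hi) (hw₁ i hi)
  calc ‖iteratedFDeriv ℝ n (fun y => K (w₁ y) - K (w₀ y)) x‖
      = ‖iteratedFDeriv ℝ n (fun y => diffQuotient K (w₀ y, w₁ y) * (w₁ y - w₀ y)) x‖ := by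
        simp only [diffQuotient_mul_sub (hK.of_le (mod_cast le_top))]
    _ ≤ ∑ i ∈ Finset.range (n + 1), n.choose i *
          ‖iteratedFDeriv ℝ i (diffQuotient K ∘ fun y => (w₀ y, w₁ y)) x‖ *
          ‖iteratedFDeriv ℝ (n - i) (fun y => w₁ y - w₀ y) x‖ :=
        norm_iteratedFDeriv_mul_le (hQ.comp hW) (h₁.sub h₀) x (mod_cast le_top)
    _ ≤ ∑ i ∈ Finset.range (n + 1), 2 ^ k * (C * l ^ i) *
          ‖iteratedFDeriv ℝ (n - i) (fun y => w₁ y - w₀ y) x‖ := by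
        refine Finset.sum_le_sum fun i hi => ?_
        have hin : i ≤ n := Nat.lt_succ_iff.1 (Finset.mem_range.1 hi)
        have hchoose : (n.choose i : ℝ) ≤ 2 ^ k := mod_cast
          (n.choose_le_two_pow i).trans (Nat.pow_le_pow_right two_pos hn)
        gcongr
        exact hquot i (hin.trans hn)
    _ = 2 ^ k * C * ∑ i ∈ Finset.range (n + 1), l ^ i *
          ‖iteratedFDeriv ℝ (n - i) (fun y => w₁ y - w₀ y) x‖ := by
        rw [Finset.mul_sum]
        exact Finset.sum_congr rfl fun i _ => by ring

end Composition

section Bernstein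

theorem lintegral_enorm_iteratedFDeriv_lt_top {H F : Type*} [NormedAddCommGroup H]
    [NormedSpace ℝ H] [MeasurableSpace H] [BorelSpace H] [SecondCountableTopology H]
    [NormedAddCommGroup F] [NormedSpace ℝ F] (μ : Measure H) [μ.HasTemperateGrowth] (g : 𝓢(H, F))
    (k : ℕ) : ∫⁻ x, ‖iteratedFDeriv ℝ k g x‖ₑ ∂μ < ⊤ := by
  simpa [HasFiniteIntegral] using (g.integrable_pow_mul_iteratedFDeriv μ 0 k).2

variable {H : Type} [NormedAddCommGroup H] [InnerProductSpace ℝ H] [FiniteDimensional ℝ H]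
  [MeasurableSpace H] [BorelSpace H] {V : H → ℂ} {p : ℝ≥0∞}

theorem enorm_iteratedFDeriv_convolution_kernel_le (p q : ℝ≥0∞) [p.HolderConjugate q]
    (hV : Tame V volume) (σ : 𝓢(H, ℂ)) (l : ℝˣ) (k : ℕ) (x : H) :
    ‖iteratedFDeriv ℝ k (V ⋆[.mul ℝ ℂ, volume] kernel σ l) x‖ₑ ≤
      ‖(l : ℝ)‖ₑ ^ (k + Module.finrank ℝ H * (1 - q.toReal⁻¹)) *
        (eLpNorm (iteratedFDeriv ℝ k (kernel σ 1)) q volume * eLpNorm V p volume) := by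
  calc ‖iteratedFDeriv ℝ k (V ⋆[.mul ℝ ℂ, volume] kernel σ l) x‖ₑ
      ≤ ((fun y => ‖V y‖ₑ) ⋆ₗ[volume] fun y => ‖iteratedFDeriv ℝ k (kernel σ l) y‖ₑ) x :=
        (hV.enorm_iteratedFDeriv_convolution_le _ _ k x).trans
          (mul_le_of_le_one_left' enorm_mul_le_one)
    _ ≤ eLpNorm (fun y => ‖V y‖ₑ) p volume *
          eLpNorm (fun y => ‖iteratedFDeriv ℝ k (kernel σ l) y‖ₑ) q volume :=
        lconvolution_le_eLpNorm_mul_eLpNorm p q hV.aestronglyMeasurable.enorm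
          ((kernel σ l).smooth ⊤ |>.continuous_iteratedFDeriv (mod_cast le_top)).enorm.measurable x
    _ = _ := by
        rw [eLpNorm_enorm, eLpNorm_enorm, eLpNorm_iteratedFDeriv_kernel]
        ring

theorem eLpNorm_iteratedFDeriv_convolution_kernel_le (hp : 1 ≤ p) (hV : Tame V volume)
    (σ : 𝓢(H, ℂ)) (l : ℝˣ) (k : ℕ) :
    eLpNorm (iteratedFDeriv ℝ k (V ⋆[.mul ℝ ℂ, volume] kernel σ l)) p volume ≤
      ‖(l : ℝ)‖ₑ ^ k *
        ((∫⁻ x, ‖iteratedFDeriv ℝ k (kernel σ 1) x‖ₑ) * eLpNorm V p volume) := by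
  have kernel_eq : ∫⁻ x, ‖iteratedFDeriv ℝ k (kernel σ l) x‖ₑ =
      ‖(l : ℝ)‖ₑ ^ k * ∫⁻ x, ‖iteratedFDeriv ℝ k (kernel σ 1) x‖ₑ := by
    simpa [eLpNorm_one_eq_lintegral_enorm] using eLpNorm_iteratedFDeriv_kernel σ l k 1
  calc eLpNorm (iteratedFDeriv ℝ k (V ⋆[.mul ℝ ℂ, volume] kernel σ l)) p volume
      ≤ eLpNorm ((fun y => ‖V y‖ₑ) ⋆ₗ[volume] fun y => ‖iteratedFDeriv ℝ k (kernel σ l) y‖ₑ) p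
          volume :=
        eLpNorm_mono_enorm fun x => (hV.enorm_iteratedFDeriv_convolution_le _ _ k x).trans
          (mul_le_of_le_one_left' enorm_mul_le_one)
    _ ≤ eLpNorm (fun y => ‖V y‖ₑ) p volume * ∫⁻ x, ‖iteratedFDeriv ℝ k (kernel σ l) x‖ₑ :=
        eLpNorm_lconvolution_le hp hV.aestronglyMeasurable.enorm
          ((kernel σ l).smooth ⊤ |>.continuous_iteratedFDeriv (mod_cast le_top)).enorm.measurable
    _ = _ := by
        rw [eLpNorm_enorm, kernel_eq]
        ring

theorem eLpNorm_convolution_kernel_le (hp : 1 ≤ p) (hV : Tame V volume) (σ : 𝓢(H, ℂ)) (l : ℝˣ) :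
    eLpNorm (V ⋆[.mul ℝ ℂ, volume] kernel σ l) p volume ≤
      (∫⁻ x, ‖kernel σ 1 x‖ₑ) * eLpNorm V p volume := by
  have h := eLpNorm_iteratedFDeriv_convolution_kernel_le hp hV σ l 0
  rw [pow_zero, one_mul, eLpNorm_congr_norm_ae (.of_forall fun _ => norm_iteratedFDeriv_zero)] at h
  refine h.trans_eq ?_
  rw [← eLpNorm_one_eq_lintegral_enorm, ← eLpNorm_one_eq_lintegral_enorm,
    eLpNorm_congr_norm_ae (.of_forall fun _ => norm_iteratedFDeriv_zero)]

end Bernstein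

section LittlewoodPaley

variable {N : ℕ}

/-- The low-frequency cut-off `S_j` of functions. -/
def lowConv (P : LPCouple N) (j : ℤ) (V : E N → ℂ) : E N → ℂ :=
  V ⋆[.mul ℝ ℂ, volume] kernel P.symχ (dyadic j)

/-- The dyadic block `Δ_j` of functions. -/
def dyadConv (P : LPCouple N) (j : ℤ) (V : E N → ℂ) : E N → ℂ :=
  V ⋆[.mul ℝ ℂ, volume] kernel P.symφ (dyadic j)

variable {P : LPCouple N} {f : 𝓢'(E N, ℂ)} {V : E N → ℂ} {p : ℝ≥0∞}

theorem HasDensity.cutoff (hf : HasDensity f V) (j : ℤ) :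
    HasDensity (cutoff P j f) (lowConv P j V) := by
  rw [cutoff_eq]
  exact hf.fourierMultiplierCLM _

theorem HasDensity.block (hf : HasDensity f V) (j : ℤ) :
    HasDensity (block P j f) (dyadConv P j V) := by
  rw [block_eq]
  exact hf.fourierMultiplierCLM _

theorem contDiff_lowConv (hV : Tame V volume) (j : ℤ) : ContDiff ℝ ∞ (lowConv P j V) :=
  hV.contDiff_convolution _ _

theorem contDiff_dyadConv (hV : Tame V volume) (j : ℤ) : ContDiff ℝ ∞ (dyadConv P j V) :=
  hV.contDiff_convolution _ _

theorem Tame.dyadConv (hV : Tame V volume) (j : ℤ) : Tame (dyadConv P j V) volume :=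
  hV.convolution _ _

theorem lowConv_succ_sub (hV : Tame V volume) (j : ℤ) :
    lowConv P (j + 1) V - lowConv P j V = dyadConv P j V := by
  have kernel_add : kernel P.symχ (dyadic (j + 1)) =
      kernel P.symχ (dyadic j) + kernel P.symφ (dyadic j) := by
    have symbol_add : dilate (dyadic (j + 1))⁻¹ P.symχ =
        dilate (dyadic j)⁻¹ P.symχ + dilate (dyadic j)⁻¹ P.symφ := by
      ext ξ
      have h := P.χ_sub ((2 : ℝ) ^ (-j) • (2 * Real.pi) • ξ)
      rw [smul_smul, ← zpow_neg_one, ← zpow_add₀ two_ne_zero, show -1 + -j = -(j + 1) by ring] at h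
      rw [add_apply, dilate_symχ_apply, dilate_symχ_apply, dilate_symφ_apply, ← h]
      push_cast
      ring
    rw [kernel, symbol_add, FourierTransform.fourierInv_add, kernel, kernel]
  ext x
  rw [Pi.sub_apply, sub_eq_iff_eq_add', lowConv, kernel_add]
  exact (hV.convolutionExistsAt _ _ x).distrib_add (hV.convolutionExistsAt _ _ x)

theorem sum_dyadConv (hV : Tame V volume) (n : ℕ) :
    ∑ q ∈ Finset.Ico (-(n : ℤ)) n, dyadConv P q V = lowConv P n V - lowConv P (-n) V := by
  rw [← neg_sub, ← Finset.sum_Ico_int_sub n fun q => lowConv P q V, ← Finset.sum_neg_distrib]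
  exact Finset.sum_congr rfl fun q _ => by rw [neg_sub, lowConv_succ_sub hV]

theorem lowConv_dyadConv (hp : 1 ≤ p) (hV : MemLp V p volume) (j : ℤ) :
    lowConv P (j + 2) (dyadConv P j V) = dyadConv P j V := by
  obtain ⟨f, hf⟩ := exists_hasDensity hp hV
  have h := (hf.block (P := P) j).cutoff (P := P) (j + 2)
  rw [cutoff_block_eq_self P le_rfl] at h
  exact (Continuous.ae_eq_iff_eq volume (contDiff_lowConv (hf.tame.dyadConv j) _).continuous
    (contDiff_dyadConv hf.tame j).continuous).1 (h.ae_eq (hf.block j))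

theorem enorm_dyadic (q : ℤ) : ‖(dyadic q : ℝ)‖ₑ = (2 : ℝ≥0∞) ^ (q : ℝ) := by
  rw [coe_dyadic, Real.enorm_of_nonneg (by positivity), ← Real.rpow_intCast,
    ← ENNReal.ofReal_rpow_of_pos two_pos, ENNReal.ofReal_ofNat]

/-- The constant in Bernstein's inequality `‖Δ_q f‖_∞ ≤ C 2^{qN/2} ‖Δ_q f‖_2`. -/
def bernsteinConst (P : LPCouple N) : ℝ≥0∞ :=
  (2 : ℝ≥0∞) ^ N * eLpNorm (kernel P.symχ 1) 2 volume

theorem bernsteinConst_lt_top (P : LPCouple N) : bernsteinConst P < ⊤ :=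
  ENNReal.mul_lt_top (by finiteness) ((kernel P.symχ 1).memLp 2 volume).2

theorem enorm_lowConv_le (hV : Tame V volume) (j : ℤ) (x : E N) :
    ‖lowConv P j V x‖ₑ ≤ (2 : ℝ≥0∞) ^ ((j : ℝ) * (N / 2)) *
      (eLpNorm (kernel P.symχ 1) 2 volume * eLpNorm V 2 volume) := by
  have h := enorm_iteratedFDeriv_convolution_kernel_le 2 2 hV P.symχ (dyadic j) 0 x
  have kernel_eq : eLpNorm (iteratedFDeriv ℝ 0 (kernel P.symχ 1)) 2 volume =
      eLpNorm (kernel P.symχ 1) 2 volume :=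
    eLpNorm_congr_norm_ae (Eventually.of_forall fun x => norm_iteratedFDeriv_zero)
  rw [enorm_le_iff_norm_le.2 norm_iteratedFDeriv_zero.le |>.antisymm
    (enorm_le_iff_norm_le.2 norm_iteratedFDeriv_zero.ge), kernel_eq, enorm_dyadic,
    ← ENNReal.rpow_mul] at h
  have exponent : ((0 : ℕ) : ℝ) + Module.finrank ℝ (E N) * (1 - (2 : ℝ≥0∞).toReal⁻¹) = N / 2 := by
    rw [finrank_euclideanSpace_fin, ENNReal.toReal_ofNat]
    push_cast
    ring
  rwa [exponent] at h

theorem exists_hasDensity_block_enorm_le {q : ℤ} (hf : distNorm 2 (block P q f) < ⊤) :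
    ∃ D, HasDensity (block P q f) D ∧ ∀ x, ‖D x‖ₑ ≤
      bernsteinConst P * ((2 : ℝ≥0∞) ^ ((q : ℝ) * (N / 2)) * distNorm 2 (block P q f)) := by
  obtain ⟨V, hV, -⟩ := exists_hasDensity_of_distNorm_lt_top hf
  have h := hV.cutoff (P := P) (q + 2)
  rw [cutoff_block_eq_self P le_rfl] at h
  refine ⟨_, h, fun x => (enorm_lowConv_le hV.tame _ x).trans_eq ?_⟩
  have exponent : (((q + 2 : ℤ) : ℝ) * (N / 2)) = N + (q : ℝ) * (N / 2) := by
    push_cast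
    ring
  rw [hV.distNorm_eq, bernsteinConst, exponent, ENNReal.rpow_add _ _ two_ne_zero (by simp),
    ENNReal.rpow_natCast]
  ring

theorem MemSh.hasDensity_tsum (hf : MemSh P f) {D : ℤ → E N → ℂ}
    (hD : ∀ q, HasDensity (block P q f) (D q)) {c : ℤ → ℝ≥0∞} (hc : ∀ q x, ‖D q x‖ₑ ≤ c q)
    (hsum : ∑' q, c q < ⊤) : HasDensity f fun x => ∑' q, D q x := by
  have partialSum_le (s : Finset ℤ) (x) : ‖∑ q ∈ s, D q x‖ ≤ (∑' q, c q).toReal := by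
    rw [← toReal_enorm]
    exact ENNReal.toReal_mono hsum.ne <| (enorm_sum_le _ _).trans <|
      (Finset.sum_le_sum fun q _ => hc q x).trans (ENNReal.sum_le_tsum _)
  have hlim (x) : Tendsto (fun n : ℕ => ∑ q ∈ Finset.Ico (-(n : ℤ)) n, D q x) atTop
      (𝓝 (∑' q, D q x)) :=
    (Summable.of_enorm (ne_top_of_le_ne_top hsum.ne
      (ENNReal.tsum_le_tsum fun q => hc q x))).hasSum.comp Finset.tendsto_Ico_neg
  have hmeas (n : ℕ) : AEStronglyMeasurable (fun x => ∑ q ∈ Finset.Ico (-(n : ℤ)) n, D q x)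
      volume := Finset.aestronglyMeasurable_fun_sum _ fun q _ => (hD q).tame.aestronglyMeasurable
  refine ⟨Tame.of_ae_bound (aestronglyMeasurable_of_tendsto_ae atTop hmeas (.of_forall hlim))
    (.of_forall fun x => le_of_tendsto (hlim x).norm (.of_forall fun n => partialSum_le _ x)),
    fun g => tendsto_nhds_unique (hf.tendsto_sum_block g) ?_⟩
  have integral_lim : Tendsto (fun n : ℕ => ∫ x, g x * ∑ q ∈ Finset.Ico (-(n : ℤ)) n, D q x) atTop
      (𝓝 (∫ x, g x * ∑' q, D q x)) := by
    refine tendsto_integral_of_dominated_convergence (fun x => ‖g x‖ * (∑' q, c q).toReal)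
      (fun n => g.continuous.aestronglyMeasurable.mul (hmeas n))
      (g.integrable.norm.mul_const _) (fun n => .of_forall fun x => ?_)
      (.of_forall fun x => (hlim x).const_mul _)
    rw [norm_mul]
    gcongr
    exact partialSum_le _ x
  refine integral_lim.congr fun n => ?_
  simpa using ((HasDensity.sum (Finset.Ico (-(n : ℤ)) n) fun q _ => hD q).apply_eq g).symm

theorem MemSh.exists_hasDensity_tsum (hf : MemSh P f) (hB : besovNorm P (N / 2) f < ⊤) :
    ∃ D : ℤ → E N → ℂ, (∀ q, HasDensity (block P q f) (D q)) ∧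
      HasDensity f (fun x => ∑' q, D q x) ∧
      ∀ x, ∑' q, ‖D q x‖ₑ ≤ bernsteinConst P * besovNorm P (N / 2) f := by
  have block_lt_top (q : ℤ) : distNorm 2 (HybridBesov.block P q f) < ⊤ :=
    ENNReal.lt_top_of_mul_ne_top_right ((ENNReal.le_tsum q).trans_lt hB).ne
      (ENNReal.rpow_pos two_pos ENNReal.ofNat_ne_top).ne'
  choose D hD hD_le using fun q => exists_hasDensity_block_enorm_le (block_lt_top q)
  have tsum_eq : ∑' q : ℤ, bernsteinConst P * ((2 : ℝ≥0∞) ^ ((q : ℝ) * (N / 2)) *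
      distNorm 2 (HybridBesov.block P q f)) = bernsteinConst P * besovNorm P (N / 2) f :=
    ENNReal.tsum_mul_left
  refine ⟨D, hD, hf.hasDensity_tsum hD hD_le ?_, fun x =>
    (ENNReal.tsum_le_tsum fun q => hD_le q x).trans_eq tsum_eq⟩
  rw [tsum_eq]
  exact ENNReal.mul_lt_top (bernsteinConst_lt_top P) hB

theorem HasDensity.eLpNorm_top_le (hV : HasDensity f V) (hf : MemSh P f)
    (hB : besovNorm P (N / 2) f < ⊤) :
    eLpNorm V ⊤ volume ≤ bernsteinConst P * besovNorm P (N / 2) f := by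
  obtain ⟨D, -, hD, hD_le⟩ := hf.exists_hasDensity_tsum hB
  rw [eLpNorm_congr_ae (hV.ae_eq hD), eLpNorm_exponent_top]
  exact eLpNormEssSup_le_of_ae_enorm_bound
    (.of_forall fun x => enorm_tsum_le_tsum_enorm.trans (hD_le x))

theorem HasDensity.tendsto_lowConv_atBot (hV : HasDensity f V) (hf : MemSh P f) :
    ∀ᵐ x, Tendsto (fun n : ℕ => lowConv P (-n) V x) atTop (𝓝 0) := by
  have bound : ∀ᵐ x, ∀ n : ℕ, ‖lowConv P (-n) V x‖ₑ ≤
      distNorm ⊤ (HybridBesov.cutoff P (-n) f) := ae_all_iff.2 fun n => by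
    rw [(hV.cutoff _).distNorm_eq, eLpNorm_exponent_top]
    exact ae_le_eLpNormEssSup
  filter_upwards [bound] with x hx
  rw [tendsto_zero_iff_enorm_tendsto_zero]
  exact tendsto_of_tendsto_of_tendsto_of_le_of_le tendsto_const_nhds
    (hf.comp (tendsto_neg_atTop_atBot.comp tendsto_natCast_atTop_atTop)) (fun _ => zero_le) hx

theorem HasDensity.tendsto_lowConv_atTop (hV : HasDensity f V) (hf : MemSh P f)
    (hB : besovNorm P (N / 2) f < ⊤) :
    ∀ᵐ x, Tendsto (fun n : ℕ => lowConv P n V x) atTop (𝓝 (V x)) := by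
  obtain ⟨D, hD_block, hD, hD_le⟩ := hf.exists_hasDensity_tsum hB
  have dyad_eq : ∀ᵐ x, ∀ q, dyadConv P q V x = D q x :=
    ae_all_iff.2 fun q => (hV.block q).ae_eq (hD_block q)
  filter_upwards [hV.tendsto_lowConv_atBot hf, dyad_eq, hV.ae_eq hD] with x h_bot h_dyad h_eq
  have summable : Summable fun q => dyadConv P q V x := Summable.of_enorm <| by
    simp only [h_dyad]
    exact ne_top_of_le_ne_top (ENNReal.mul_lt_top (bernsteinConst_lt_top P) hB).ne (hD_le x)
  have h := (summable.hasSum.comp Finset.tendsto_Ico_neg).add h_bot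
  simp only [h_dyad, ← h_eq, add_zero] at h
  refine h.congr fun n => ?_
  simp only [Function.comp_apply, ← h_dyad]
  rw [← Finset.sum_apply, sum_dyadConv hV.tame, Pi.sub_apply, sub_add_cancel]

theorem IsGivenBy.locallyIntegrable {v : E N → ℝ} (h : IsGivenBy f v) :
    LocallyIntegrable (fun x => (v x : ℂ)) volume := by
  intro x
  let φ : ContDiffBump x := ⟨1, 2, one_pos, one_lt_two⟩
  have cpt : HasCompactSupport (Complex.ofRealCLM ∘ φ) := φ.hasCompactSupport.comp_left rfl
  have smooth : ContDiff ℝ ∞ (Complex.ofRealCLM ∘ φ) := Complex.ofRealCLM.contDiff.comp φ.contDiff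
  refine ⟨Metric.closedBall x 1, Metric.closedBall_mem_nhds x one_pos,
    (h (cpt.toSchwartzMap smooth)).1.integrableOn.congr_fun (fun y hy => ?_)
      Metric.isClosed_closedBall.measurableSet⟩
  simp [φ.one_of_mem_closedBall hy]

theorem IsGivenBy.hasDensity {v : E N → ℝ} (h : IsGivenBy f v) (hV : HasDensity f V) :
    HasDensity f fun x => (v x : ℂ) :=
  hV.congr <| ae_eq_of_forall_integral_schwartz_mul_eq hV.tame.locallyIntegrable
    h.locallyIntegrable fun g => by rw [← hV.apply_eq, (h g).2]

end LittlewoodPaley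

section Increments

theorem norm_iteratedFDeriv_re_le {H : Type*} [NormedAddCommGroup H] [NormedSpace ℝ H] {f : H → ℂ}
    (hf : ContDiff ℝ ∞ f) (i : ℕ) (x : H) :
    ‖iteratedFDeriv ℝ i (fun y => (f y).re) x‖ ≤ ‖iteratedFDeriv ℝ i f x‖ := by
  have h := Complex.reCLM.norm_iteratedFDeriv_comp_left (f := f) (x := x) hf.contDiffAt
    (show (i : ℕ∞ω) ≤ (∞ : ℕ∞ω) from mod_cast le_top)
  rwa [Complex.reCLM_norm, one_mul] at h

theorem norm_iteratedFDeriv_ofReal {H : Type*} [NormedAddCommGroup H] [NormedSpace ℝ H] {f : H → ℝ}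
    (hf : ContDiff ℝ ∞ f) (i : ℕ) (x : H) :
    ‖iteratedFDeriv ℝ i (fun y => (f y : ℂ)) x‖ = ‖iteratedFDeriv ℝ i f x‖ :=
  Complex.ofRealLI.norm_iteratedFDeriv_comp_left (f := f) hf.contDiffAt (mod_cast le_top)

variable {N : ℕ} {P : LPCouple N} {K : ℝ → ℝ} {V : E N → ℂ} {R : ℝ≥0} {p : ℝ≥0∞}

/-- The `j`-th increment `K(S_{j+1} V) - K(S_j V)` of Meyer's first linearization of `K(V)`, for
which only the real part of `V` matters. -/
def compDiff (P : LPCouple N) (K : ℝ → ℝ) (V : E N → ℂ) (j : ℤ) (x : E N) : ℝ :=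
  K (lowConv P (j + 1) V x).re - K (lowConv P j V x).re

theorem sum_compDiff (K : ℝ → ℝ) (V : E N → ℂ) (n : ℕ) (x : E N) :
    ∑ j ∈ Finset.Ico (-(n : ℤ)) n, compDiff P K V j x =
      K (lowConv P n V x).re - K (lowConv P (-n) V x).re := by
  rw [← neg_sub, ← Finset.sum_Ico_int_sub n fun q => K (lowConv P q V x).re,
    ← Finset.sum_neg_distrib]
  exact Finset.sum_congr rfl fun q _ => by rw [neg_sub, compDiff]

theorem Tame.of_eLpNorm_top_le (hV : AEStronglyMeasurable V volume)
    (hVR : eLpNorm V ⊤ volume ≤ R) : Tame V volume :=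
  .of_memLp le_top ⟨hV, hVR.trans_lt ENNReal.coe_lt_top⟩

theorem memLp_dyadConv (hp : 1 ≤ p) (hV : MemLp V p volume) (j : ℤ) :
    MemLp (dyadConv P j V) p volume :=
  ⟨(contDiff_dyadConv (.of_memLp hp hV) j).continuous.aestronglyMeasurable,
    (eLpNorm_convolution_le hp hV.1 _).trans_lt
      (ENNReal.mul_lt_top hV.2 (kernel P.symφ (dyadic j)).integrable.2)⟩

theorem contDiff_re_lowConv (hV : Tame V volume) (j : ℤ) :
    ContDiff ℝ ∞ fun x => (lowConv P j V x).re :=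
  Complex.reCLM.contDiff.comp (contDiff_lowConv hV j)

theorem contDiff_compDiff (hK : ContDiff ℝ ∞ K) (hV : Tame V volume) (j : ℤ) :
    ContDiff ℝ ∞ (compDiff P K V j) :=
  (hK.comp (contDiff_re_lowConv hV (j + 1))).sub (hK.comp (contDiff_re_lowConv hV j))

theorem exists_norm_iteratedFDeriv_lowConv_le (P : LPCouple N) (R : ℝ≥0) (k : ℕ) :
    ∃ A : ℝ, 1 ≤ A ∧ ∀ V : E N → ℂ, AEStronglyMeasurable V volume → eLpNorm V ⊤ volume ≤ R →
      ∀ (j : ℤ) (x : E N), ∀ i ≤ k,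
        ‖iteratedFDeriv ℝ i (lowConv P j V) x‖ ≤ A * ((2 : ℝ) ^ j) ^ i := by
  have kernel_lt_top (i : ℕ) : eLpNorm (iteratedFDeriv ℝ i (kernel P.symχ 1)) 1 volume < ⊤ := by
    rw [eLpNorm_one_eq_lintegral_enorm]
    exact lintegral_enorm_iteratedFDeriv_lt_top volume _ i
  set M : ℕ → ℝ := fun i =>
    (eLpNorm (iteratedFDeriv ℝ i (kernel P.symχ 1)) 1 volume * R).toReal
  refine ⟨1 + ∑ i ∈ Finset.range (k + 1), M i, le_add_of_nonneg_right (by positivity),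
    fun V hV hVR j x i hi => ?_⟩
  have pointwise : ‖iteratedFDeriv ℝ i (lowConv P j V) x‖ ≤ M i * ((2 : ℝ) ^ j) ^ i := by
    have h := enorm_iteratedFDeriv_convolution_kernel_le ⊤ 1 (.of_eLpNorm_top_le hV hVR) P.symχ
      (dyadic j) i x
    rw [ENNReal.toReal_one, inv_one, sub_self, mul_zero, add_zero, ENNReal.rpow_natCast] at h
    have h' := ENNReal.toReal_mono
      (ENNReal.mul_ne_top (by finiteness) (ENNReal.mul_ne_top (kernel_lt_top i).ne (by finiteness)))
      (h.trans (mul_le_mul_right (mul_le_mul_right hVR _) _))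
    rwa [toReal_enorm, ENNReal.toReal_mul, ENNReal.toReal_pow, toReal_enorm, coe_dyadic,
      Real.norm_of_nonneg (by positivity), mul_comm] at h'
  have M_le : M i ≤ ∑ i ∈ Finset.range (k + 1), M i :=
    Finset.single_le_sum (f := M) (fun _ _ => ENNReal.toReal_nonneg)
      (Finset.mem_range_succ_iff.2 hi)
  exact pointwise.trans (by gcongr; linarith)

theorem exists_norm_iteratedFDeriv_compDiff_le (P : LPCouple N) (hK : ContDiff ℝ ∞ K) (R : ℝ≥0)
    (k : ℕ) :
    ∃ C : ℝ, 0 ≤ C ∧ ∀ V : E N → ℂ, AEStronglyMeasurable V volume → eLpNorm V ⊤ volume ≤ R →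
      ∀ (j : ℤ) (x : E N), ∀ n ≤ k, ‖iteratedFDeriv ℝ n (compDiff P K V j) x‖ ≤
        C * ∑ i ∈ Finset.range (n + 1), ((2 : ℝ) ^ j) ^ i *
          ‖iteratedFDeriv ℝ (n - i) (dyadConv P j V) x‖ := by
  obtain ⟨A, one_le_A, hA⟩ := exists_norm_iteratedFDeriv_lowConv_le P R k
  have one_le_pow : (1 : ℝ) ≤ 2 ^ k := one_le_pow₀ one_le_two
  obtain ⟨C, hC, composition⟩ := exists_norm_iteratedFDeriv_comp_sub_comp_le (H := E N) hK k
    (one_le_mul_of_one_le_of_one_le one_le_A one_le_pow)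
  refine ⟨C, hC, fun V hV hVR j x n hn => ?_⟩
  have tame := Tame.of_eLpNorm_top_le hV hVR
  have low_le (i : ℕ) (hi : i ≤ k) (j : ℤ) :
      ‖iteratedFDeriv ℝ i (fun y => (lowConv P j V y).re) x‖ ≤ A * ((2 : ℝ) ^ j) ^ i :=
    (norm_iteratedFDeriv_re_le (contDiff_lowConv tame j) i x).trans (hA V hV hVR j x i hi)
  have re_sub : (fun y => (lowConv P (j + 1) V y).re - (lowConv P j V y).re) =
      fun y => (dyadConv P j V y).re := by
    rw [← lowConv_succ_sub tame]
    rfl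
  refine (composition ((2 : ℝ) ^ j) (by positivity) _ _ (contDiff_re_lowConv tame j)
    (contDiff_re_lowConv tame (j + 1)) x (fun i hi => (low_le i hi j).trans ?_)
    (fun i hi => (low_le i hi (j + 1)).trans ?_) n hn).trans ?_
  · gcongr
    exact le_mul_of_one_le_right (by linarith) one_le_pow
  · rw [zpow_add_one₀ two_ne_zero, mul_pow, mul_comm (_ ^ i), ← mul_assoc]
    gcongr
    exact one_le_two
  · rw [re_sub]
    gcongr
    exact norm_iteratedFDeriv_re_le (contDiff_dyadConv tame j) _ x

theorem LPCouple.annularSymbol_symφ (P : LPCouple N) : AnnularSymbol P.symφ where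
  hasCompactSupport := by
    refine HasCompactSupport.of_support_subset_isCompact (isCompact_closedBall (0 : E N) (8 / 3))
      (Function.support_subset_iff'.2 fun ξ hξ => ?_)
    rw [mem_closedBall_zero_iff, not_le] at hξ
    have outside : 8 / 3 < ‖(2 * Real.pi) • ξ‖ := by
      rw [norm_smul, Real.norm_of_nonneg Real.two_pi_pos.le]
      nlinarith [Real.pi_gt_three]
    exact congrArg ((↑) : ℝ → ℂ) (P.φ_eq_zero (.inr outside))
  eventually_eq_zero := by
    filter_upwards [Metric.ball_mem_nhds (0 : E N) (show (0 : ℝ) < 3 / 32 by norm_num)] with ξ hξ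
    rw [mem_ball_zero_iff] at hξ
    have inside : ‖(2 * Real.pi) • ξ‖ < 3 / 4 := by
      rw [norm_smul, Real.norm_of_nonneg Real.two_pi_pos.le]
      nlinarith [Real.pi_lt_four, Real.pi_pos, norm_nonneg ξ]
    exact congrArg ((↑) : ℝ → ℂ) (P.φ_eq_zero (.inl inside))

theorem eLpNorm_iteratedFDeriv_dyadConv_le (hp : 1 ≤ p) (hV : AEStronglyMeasurable V volume)
    (hV_top : eLpNorm V ⊤ volume < ⊤) (j : ℤ) (m : ℕ) :
    eLpNorm (iteratedFDeriv ℝ m (dyadConv P j V)) p volume ≤ ‖(dyadic j : ℝ)‖ₑ ^ m *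
      (4 ^ m * (∫⁻ x, ‖iteratedFDeriv ℝ m (kernel P.symχ 1) x‖ₑ) *
        eLpNorm (dyadConv P j V) p volume) := by
  have tame : Tame V volume :=
    .of_eLpNorm_top_le hV (ENNReal.coe_toNNReal hV_top.ne).ge
  have h := eLpNorm_iteratedFDeriv_convolution_kernel_le hp (tame.dyadConv (P := P) j) P.symχ
    (dyadic (j + 2)) m
  have norm_dyadic : ‖(dyadic (j + 2) : ℝ)‖ₑ = ‖(dyadic j : ℝ)‖ₑ * 4 := by
    rw [enorm_dyadic, enorm_dyadic, Int.cast_add, ENNReal.rpow_add _ _ two_ne_zero (by simp)]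
    norm_num
  rwa [← lowConv, lowConv_dyadConv le_top ⟨hV, hV_top⟩, norm_dyadic, mul_pow, mul_assoc,
    ← mul_assoc (4 ^ m)] at h

theorem exists_eLpNorm_iteratedFDeriv_compDiff_le (P : LPCouple N) (hK : ContDiff ℝ ∞ K) (R : ℝ≥0)
    (hp : 1 ≤ p) (k : ℕ) :
    ∃ C : ℝ≥0∞, C < ⊤ ∧ ∀ V : E N → ℂ, AEStronglyMeasurable V volume → eLpNorm V ⊤ volume ≤ R →
      ∀ j : ℤ, eLpNorm (iteratedFDeriv ℝ k fun x => (compDiff P K V j x : ℂ)) p volume ≤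
        C * (‖(dyadic j : ℝ)‖ₑ ^ k * eLpNorm (dyadConv P j V) p volume) := by
  obtain ⟨C, hC, pointwise⟩ := exists_norm_iteratedFDeriv_compDiff_le P hK R k
  set M : ℕ → ℝ≥0∞ := fun m => ∫⁻ x, ‖iteratedFDeriv ℝ m (kernel P.symχ 1) x‖ₑ
  have M_lt_top (m : ℕ) : M m < ⊤ := lintegral_enorm_iteratedFDeriv_lt_top volume _ m
  refine ⟨ENNReal.ofReal C * ∑ i ∈ Finset.range (k + 1), 4 ^ (k - i) * M (k - i), ?_,
    fun V hV hVR j => ?_⟩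
  · exact ENNReal.mul_lt_top ENNReal.ofReal_lt_top (ENNReal.sum_lt_top.2 fun i _ =>
      ENNReal.mul_lt_top (by finiteness) (M_lt_top _))
  have tame := Tame.of_eLpNorm_top_le hV hVR
  have derivative_cont (m : ℕ) : Continuous (iteratedFDeriv ℝ m (dyadConv P j V)) :=
    (contDiff_dyadConv tame j).continuous_iteratedFDeriv (mod_cast le_top)
  calc eLpNorm (iteratedFDeriv ℝ k fun x => (compDiff P K V j x : ℂ)) p volume
      ≤ eLpNorm (C • ∑ i ∈ Finset.range (k + 1), (((2 : ℝ) ^ j) ^ i) •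
          fun x => ‖iteratedFDeriv ℝ (k - i) (dyadConv P j V) x‖) p volume := by
        refine eLpNorm_mono_real fun x => ?_
        rw [norm_iteratedFDeriv_ofReal (contDiff_compDiff hK tame j)]
        simpa [Finset.sum_apply] using pointwise V hV hVR j x k le_rfl
    _ ≤ ENNReal.ofReal C * ∑ i ∈ Finset.range (k + 1), ‖(dyadic j : ℝ)‖ₑ ^ i *
          eLpNorm (iteratedFDeriv ℝ (k - i) (dyadConv P j V)) p volume := by
        rw [eLpNorm_const_smul, Real.enorm_of_nonneg hC]
        gcongr
        refine (eLpNorm_sum_le (fun i _ =>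
          (derivative_cont _).norm.aestronglyMeasurable.const_smul _) hp).trans_eq ?_
        refine Finset.sum_congr rfl fun i _ => ?_
        rw [eLpNorm_const_smul, eLpNorm_norm, enorm_pow, coe_dyadic]
    _ ≤ ENNReal.ofReal C * ∑ i ∈ Finset.range (k + 1), ‖(dyadic j : ℝ)‖ₑ ^ i *
          (‖(dyadic j : ℝ)‖ₑ ^ (k - i) *
            (4 ^ (k - i) * M (k - i) * eLpNorm (dyadConv P j V) p volume)) := by
        gcongr
        exact eLpNorm_iteratedFDeriv_dyadConv_le hp hV (hVR.trans_lt ENNReal.coe_lt_top) j _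
    _ = _ := by
        rw [mul_assoc, Finset.sum_mul]
        congr 1
        refine Finset.sum_congr rfl fun i hi => ?_
        rw [← mul_assoc, ← pow_add, Nat.add_sub_cancel' (Finset.mem_range_succ_iff.1 hi)]
        ring

theorem Tame.iteratedFDeriv_compDiff (hK : ContDiff ℝ ∞ K) (hV : AEStronglyMeasurable V volume)
    (hVR : eLpNorm V ⊤ volume ≤ R) (j : ℤ) (k : ℕ) :
    Tame (iteratedFDeriv ℝ k fun x => (compDiff P K V j x : ℂ)) volume := by
  have tame := Tame.of_eLpNorm_top_le hV hVR
  obtain ⟨C, hC, le⟩ := exists_eLpNorm_iteratedFDeriv_compDiff_le P hK R le_top k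
  have smooth : ContDiff ℝ ∞ fun x => (compDiff P K V j x : ℂ) :=
    Complex.ofRealCLM.contDiff.comp (contDiff_compDiff hK tame j)
  have memLp := memLp_dyadConv (P := P) le_top ⟨hV, hVR.trans_lt ENNReal.coe_lt_top⟩ j
  exact .of_memLp le_top
    ⟨(smooth.continuous_iteratedFDeriv (mod_cast le_top)).aestronglyMeasurable,
      (le V hV hVR j).trans_lt (ENNReal.mul_lt_top hC (ENNReal.mul_lt_top (by finiteness)
        memLp.2))⟩

theorem Tame.ofReal_compDiff (hK : ContDiff ℝ ∞ K) (hV : AEStronglyMeasurable V volume)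
    (hVR : eLpNorm V ⊤ volume ≤ R) (j : ℤ) : Tame (fun x => (compDiff P K V j x : ℂ)) volume := by
  have tame := Tame.of_eLpNorm_top_le hV hVR
  exact (Tame.iteratedFDeriv_compDiff (P := P) hK hV hVR j 0).mono
    (Complex.continuous_ofReal.comp (contDiff_compDiff hK tame j).continuous).aestronglyMeasurable
    fun x => by rw [norm_iteratedFDeriv_zero]

theorem exists_eLpNorm_dyadConv_compDiff_le (P : LPCouple N) (hK : ContDiff ℝ ∞ K) (R : ℝ≥0)
    (hp : 1 ≤ p) (k : ℕ) :
    ∃ C : ℝ≥0∞, C < ⊤ ∧ ∀ V : E N → ℂ, AEStronglyMeasurable V volume → eLpNorm V ⊤ volume ≤ R →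
      ∀ q j : ℤ, ‖(dyadic q : ℝ)‖ₑ ^ k *
          eLpNorm (dyadConv P q fun x => (compDiff P K V j x : ℂ)) p volume ≤
        C * (‖(dyadic j : ℝ)‖ₑ ^ k * eLpNorm (dyadConv P j V) p volume) := by
  obtain ⟨C₁, C₁_lt_top, derivative_le⟩ := exists_eLpNorm_iteratedFDeriv_compDiff_le P hK R hp k
  obtain ⟨C₂, C₂_lt_top, bernstein⟩ :=
    AnnularSymbol.exists_pow_mul_eLpNorm_convolution_le hp k P.annularSymbol_symφ
  refine ⟨C₂ * C₁, ENNReal.mul_lt_top C₂_lt_top C₁_lt_top, fun V hV hVR q j => ?_⟩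
  have smooth : ContDiff ℝ ∞ fun x => (compDiff P K V j x : ℂ) :=
    Complex.ofRealCLM.contDiff.comp (contDiff_compDiff hK (.of_eLpNorm_top_le hV hVR) j)
  rw [mul_assoc]
  exact (bernstein (dyadic q) _ (smooth.of_le (mod_cast le_top)) fun i _ =>
    Tame.iteratedFDeriv_compDiff hK hV hVR j i).trans
      (mul_le_mul_right (derivative_le V hV hVR j) _)

theorem tendsto_convolution_of_ae {H : Type*} [NormedAddCommGroup H] [MeasurableSpace H]
    [BorelSpace H] {μ : Measure H} [μ.IsAddLeftInvariant] [μ.IsNegInvariant] {h : H → ℂ}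
    (hh : Integrable h μ) {W : ℕ → H → ℂ} {V : H → ℂ} {B : ℝ}
    (hW : ∀ n, AEStronglyMeasurable (W n) μ) (hWB : ∀ n y, ‖W n y‖ ≤ B)
    (hlim : ∀ᵐ y ∂μ, Tendsto (fun n => W n y) atTop (𝓝 (V y))) (x : H) :
    Tendsto (fun n => (W n ⋆[.mul ℝ ℂ, μ] h) x) atTop (𝓝 ((V ⋆[.mul ℝ ℂ, μ] h) x)) := by
  have hx : Integrable (fun y => h (x - y)) μ := hh.comp_sub_left x
  refine tendsto_integral_of_dominated_convergence (fun y => B * ‖h (x - y)‖)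
    (fun n => (hW n).mul hx.1) (hx.norm.const_mul B) (fun n => .of_forall fun y => ?_) ?_
  · rw [ContinuousLinearMap.mul_apply', norm_mul]
    gcongr
    exact hWB n y
  · filter_upwards [hlim] with y hy
    exact hy.mul_const _

theorem exists_norm_comp_re_lowConv_le (hK : Continuous K) (hV : AEStronglyMeasurable V volume)
    (hVR : eLpNorm V ⊤ volume ≤ R) : ∃ B, ∀ (j : ℤ) x, ‖K (lowConv P j V x).re‖ ≤ B := by
  obtain ⟨A, -, hA⟩ := exists_norm_iteratedFDeriv_lowConv_le P R 0
  obtain ⟨B, hB⟩ := (isCompact_closedBall (0 : ℝ) A).exists_bound_of_continuousOn hK.continuousOn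
  refine ⟨B, fun j x => hB _ (mem_closedBall_zero_iff.2 ?_)⟩
  have h := hA V hV hVR j x 0 le_rfl
  rw [norm_iteratedFDeriv_zero, pow_zero, mul_one] at h
  exact (Complex.abs_re_le_norm _).trans h

theorem tendsto_sum_convolution_compDiff (hK : ContDiff ℝ ∞ K) (hK0 : K 0 = 0)
    (hV : AEStronglyMeasurable V volume) (hVR : eLpNorm V ⊤ volume ≤ R)
    (tendsto_atTop : ∀ᵐ x, Tendsto (fun n : ℕ => lowConv P n V x) atTop (𝓝 (V x)))
    (tendsto_atBot : ∀ᵐ x, Tendsto (fun n : ℕ => lowConv P (-n) V x) atTop (𝓝 0))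
    (h : 𝓢(E N, ℂ)) (x : E N) :
    Tendsto (fun n : ℕ => ∑ j ∈ Finset.Ico (-(n : ℤ)) n,
      ((fun y => (compDiff P K V j y : ℂ)) ⋆[.mul ℝ ℂ, volume] h) x) atTop
      (𝓝 (((fun y => (K (V y).re : ℂ)) ⋆[.mul ℝ ℂ, volume] h) x)) := by
  have tame (j : ℤ) := Tame.ofReal_compDiff (P := P) hK hV hVR j
  obtain ⟨B, hB⟩ := exists_norm_comp_re_lowConv_le (P := P) hK.continuous hV hVR
  have dominated := tendsto_convolution_of_ae h.integrable (B := B + B)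
    (W := fun n : ℕ => fun y => ∑ j ∈ Finset.Ico (-(n : ℤ)) n, (compDiff P K V j y : ℂ))
    (V := fun y => (K (V y).re : ℂ))
    (fun n => Finset.aestronglyMeasurable_fun_sum _ fun j _ => (tame j).aestronglyMeasurable)
    (fun n y => by
      rw [← Complex.ofReal_sum, sum_compDiff, Complex.norm_real]
      exact (norm_sub_le _ _).trans (add_le_add (hB _ _) (hB _ _))) ?_ x
  · refine dominated.congr fun n => ?_
    simp only [convolution, map_sum, sum_apply]
    exact integral_finsetSum _ fun j _ => (tame j).convolutionExistsAt _ _ x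
  · filter_upwards [tendsto_atTop, tendsto_atBot] with y top bot
    simp only [← Complex.ofReal_sum, sum_compDiff]
    have K_comp {w : ℕ → ℂ} {z : ℂ} (hw : Tendsto w atTop (𝓝 z)) :
        Tendsto (fun n => K (w n).re) atTop (𝓝 (K z.re)) :=
      (hK.continuous.tendsto _).comp ((Complex.continuous_re.tendsto _).comp hw)
    have difference := (K_comp top).sub (K_comp bot)
    rw [Complex.zero_re, hK0, sub_zero] at difference
    exact (Complex.continuous_ofReal.tendsto _).comp difference

theorem eLpNorm_convolution_comp_le (hK : ContDiff ℝ ∞ K) (hK0 : K 0 = 0)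
    (hV : AEStronglyMeasurable V volume) (hVR : eLpNorm V ⊤ volume ≤ R)
    (tendsto_atTop : ∀ᵐ x, Tendsto (fun n : ℕ => lowConv P n V x) atTop (𝓝 (V x)))
    (tendsto_atBot : ∀ᵐ x, Tendsto (fun n : ℕ => lowConv P (-n) V x) atTop (𝓝 0))
    (h : 𝓢(E N, ℂ)) (hp : 1 ≤ p) :
    eLpNorm ((fun x => (K (V x).re : ℂ)) ⋆[.mul ℝ ℂ, volume] h) p volume ≤
      ∑' j, eLpNorm ((fun x => (compDiff P K V j x : ℂ)) ⋆[.mul ℝ ℂ, volume] h) p volume := by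
  have measurable (j : ℤ) : AEStronglyMeasurable
      ((fun x => (compDiff P K V j x : ℂ)) ⋆[.mul ℝ ℂ, volume] h) volume :=
    ((Tame.ofReal_compDiff hK hV hVR j).contDiff_convolution _ h).continuous.aestronglyMeasurable
  have limit := tendsto_sum_convolution_compDiff hK hK0 hV hVR tendsto_atTop tendsto_atBot h
  refine Lp.eLpNorm_le_of_ae_tendsto (u := atTop) (.of_forall fun n => ?_)
    (fun n => Finset.aestronglyMeasurable_sum _ fun j _ => measurable j) 
    (.of_forall fun x => by simpa only [Finset.sum_apply] using limit x)
  exact (eLpNorm_sum_le (fun j _ => measurable j) hp).trans (ENNReal.sum_le_tsum _)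

end Increments

section HybridWeight

theorem two_rpow_ne_top (a : ℝ) : (2 : ℝ≥0∞) ^ a ≠ ⊤ := by simp [ENNReal.rpow_eq_top_iff]

theorem two_rpow_add (a b : ℝ) : (2 : ℝ≥0∞) ^ (a + b) = 2 ^ a * 2 ^ b :=
  ENNReal.rpow_add _ _ two_ne_zero (by simp)

theorem two_rpow_le_two_rpow {a b : ℝ} (h : a ≤ b) : (2 : ℝ≥0∞) ^ a ≤ 2 ^ b :=
  ENNReal.rpow_le_rpow_of_exponent_le one_le_two h

/-- The weight of a hybrid Besov norm of regularity `a` at low frequencies and `b` at high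
frequencies. -/
def hybridWeight (a b : ℝ) (q : ℤ) : ℝ≥0∞ := (2 : ℝ≥0∞) ^ (min (q : ℝ) 0 * a + max (q : ℝ) 0 * b)

/-- The off-diagonal decay `2^{-δ|d|}` of the frequency interactions. -/
def decay (δ : ℝ) (d : ℤ) : ℝ≥0∞ := (2 : ℝ≥0∞) ^ (-δ * |(d : ℝ)|)

variable {a b δ : ℝ} {q j : ℤ}

theorem hybridWeight_of_nonneg (h : 0 ≤ q) : hybridWeight a b q = (2 : ℝ≥0∞) ^ ((q : ℝ) * b) := by
  have h' : (0 : ℝ) ≤ q := mod_cast h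
  rw [hybridWeight, min_eq_right h', max_eq_left h', zero_mul, zero_add]

theorem tsum_decay_lt_top (hδ : 0 < δ) : ∑' d, decay δ d < ⊤ := by
  obtain ⟨ρ, hρ⟩ : ∃ ρ : ℝ≥0, (ρ : ℝ≥0∞) = 2 ^ (-δ) := ⟨_, ENNReal.coe_toNNReal (two_rpow_ne_top _)⟩
  have ρ_lt_one : ρ < 1 := by
    rw [← ENNReal.coe_lt_one_iff, hρ]
    exact ENNReal.rpow_lt_one_of_one_lt_of_neg ENNReal.one_lt_two (neg_neg_of_pos hδ)
  have decay_eq (d : ℤ) : decay δ d = ((ρ ^ d.natAbs : ℝ≥0) : ℝ≥0∞) := by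
    rw [decay, ← Int.cast_abs, Int.abs_eq_natAbs, Int.cast_natCast, ENNReal.rpow_mul,
      ENNReal.rpow_natCast, ENNReal.coe_pow, hρ]
  rw [tsum_congr decay_eq, lt_top_iff_ne_top, ENNReal.tsum_coe_ne_top_iff_summable,
    ← NNReal.summable_coe]
  have geometric : Summable fun n : ℕ => ((ρ ^ n : ℝ≥0) : ℝ) :=
    NNReal.summable_coe.2 (NNReal.summable_geometric ρ_lt_one)
  exact .of_nat_of_neg (by simpa only [Int.natAbs_natCast] using geometric)
    (by simpa only [Int.natAbs_neg, Int.natAbs_natCast] using geometric)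

theorem hybridWeight_le_of_le (ha : δ ≤ a) (hb : δ ≤ b) (h : q ≤ j) :
    hybridWeight a b q ≤ decay δ (q - j) * hybridWeight a b j := by
  rw [hybridWeight, hybridWeight, decay, ← two_rpow_add]
  refine two_rpow_le_two_rpow ?_
  have h' : (q : ℝ) ≤ j := mod_cast h
  have low := mul_le_mul_of_nonneg_left ha (sub_nonneg.2 (min_le_min_right 0 h'))
  have high := mul_le_mul_of_nonneg_left hb (sub_nonneg.2 (max_le_max_right 0 h'))
  push_cast
  rw [abs_of_nonpos (by linarith)]
  linear_combination low + high - δ * (min_add_max (j : ℝ) 0) + δ * (min_add_max (q : ℝ) 0)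

theorem hybridWeight_mul_le_of_le {k : ℕ} (ha : a + δ ≤ k) (hb : b + δ ≤ k) (h : j ≤ q) :
    hybridWeight a b q * (2 : ℝ≥0∞) ^ (((j : ℝ) - q) * k) ≤
      decay δ (q - j) * hybridWeight a b j := by
  rw [hybridWeight, hybridWeight, decay, ← two_rpow_add, ← two_rpow_add]
  refine two_rpow_le_two_rpow ?_
  have h' : (j : ℝ) ≤ q := mod_cast h
  have low := mul_le_mul_of_nonneg_left ha (sub_nonneg.2 (min_le_min_right 0 h'))
  have high := mul_le_mul_of_nonneg_left hb (sub_nonneg.2 (max_le_max_right 0 h'))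
  push_cast
  rw [abs_of_nonneg (by linarith)]
  linear_combination low + high + (k - δ) * (min_add_max (q : ℝ) 0) -
    (k - δ) * (min_add_max (j : ℝ) 0)

variable {N : ℕ} {P : LPCouple N} {K : ℝ → ℝ} {p : ℝ≥0∞}

theorem exists_hybridWeight_mul_eLpNorm_compDiff_le (P : LPCouple N) (a b : ℝ)
    (hK : ContDiff ℝ ∞ K) (R : ℝ≥0) (hp : 1 ≤ p) :
    ∃ C : ℝ≥0∞, C < ⊤ ∧ ∀ V : E N → ℂ, AEStronglyMeasurable V volume → eLpNorm V ⊤ volume ≤ R →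
      ∀ q j : ℤ, hybridWeight a b q *
          eLpNorm (dyadConv P q fun x => (compDiff P K V j x : ℂ)) p volume ≤
        C * (decay (min a b) (q - j) * (hybridWeight a b j * eLpNorm (dyadConv P j V) p volume)) :=
    by
  obtain ⟨k, hk⟩ := exists_nat_ge (max a b + min a b)
  have ha : a + min a b ≤ k := (by gcongr; exact le_max_left a b : _ ≤ _).trans hk
  have hb : b + min a b ≤ k := (by gcongr; exact le_max_right a b : _ ≤ _).trans hk
  obtain ⟨C₀, C₀_lt_top, low⟩ := exists_eLpNorm_dyadConv_compDiff_le P hK R hp 0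
  obtain ⟨C₁, C₁_lt_top, high⟩ := exists_eLpNorm_dyadConv_compDiff_le P hK R hp k
  refine ⟨max C₀ C₁, max_lt C₀_lt_top C₁_lt_top, fun V hV hVR q j => ?_⟩
  set X := eLpNorm (dyadConv P q fun x => (compDiff P K V j x : ℂ)) p volume
  set Y := eLpNorm (dyadConv P j V) p volume
  rcases le_total q j with h | h
  · have X_le : X ≤ C₀ * Y := by simpa only [pow_zero, one_mul] using low V hV hVR q j
    calc hybridWeight a b q * X
        ≤ (decay (min a b) (q - j) * hybridWeight a b j) * (max C₀ C₁ * Y) := by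
          exact mul_le_mul' (hybridWeight_le_of_le (min_le_left _ _) (min_le_right _ _) h)
            (X_le.trans (mul_le_mul_left (le_max_left _ _) _))
      _ = _ := by ring
  · have X_le : (2 : ℝ≥0∞) ^ ((q : ℝ) * k) * X ≤ C₁ * ((2 : ℝ≥0∞) ^ ((j : ℝ) * k) * Y) := by
      simpa only [enorm_dyadic, ENNReal.rpow_mul_natCast] using high V hV hVR q j
    have weight_eq : hybridWeight a b q =
        hybridWeight a b q * (2 : ℝ≥0∞) ^ (-(q : ℝ) * k) * (2 : ℝ≥0∞) ^ ((q : ℝ) * k) := by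
      rw [mul_assoc, ← two_rpow_add, neg_mul, neg_add_cancel, ENNReal.rpow_zero, mul_one]
    calc hybridWeight a b q * X
        = hybridWeight a b q * (2 : ℝ≥0∞) ^ (-(q : ℝ) * k) * ((2 : ℝ≥0∞) ^ ((q : ℝ) * k) * X) := by
          rw [← mul_assoc, ← weight_eq]
      _ ≤ hybridWeight a b q * (2 : ℝ≥0∞) ^ (-(q : ℝ) * k) *
            (max C₀ C₁ * ((2 : ℝ≥0∞) ^ ((j : ℝ) * k) * Y)) := by
          exact mul_le_mul_right (X_le.trans (mul_le_mul_left (le_max_right _ _) _)) _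
      _ = (hybridWeight a b q * (2 : ℝ≥0∞) ^ (((j : ℝ) - q) * k)) * (max C₀ C₁ * Y) := by
          rw [sub_eq_neg_add, add_mul, two_rpow_add]
          ring
      _ ≤ (decay (min a b) (q - j) * hybridWeight a b j) * (max C₀ C₁ * Y) := by
          exact mul_le_mul_left (hybridWeight_mul_le_of_le ha hb h) _
      _ = _ := by ring

end HybridWeight

section FixedTime

variable {N : ℕ} {P : LPCouple N} {K : ℝ → ℝ} {f w : 𝓢'(E N, ℂ)} {V : E N → ℂ} {R : ℝ≥0}

theorem tendsto_two_rpow_mul_atBot {a : ℝ} (ha : 0 < a) :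
    Tendsto (fun q : ℤ => (2 : ℝ≥0∞) ^ ((q : ℝ) * a)) atBot (𝓝 0) := by
  have h := ENNReal.tendsto_ofReal ((tendsto_rpow_atBot_of_base_gt_one 2 one_lt_two).comp
    ((tendsto_intCast_atBot_iff.2 tendsto_id).atBot_mul_const ha :
      Tendsto (fun q : ℤ => (q : ℝ) * a) atBot atBot))
  rw [ENNReal.ofReal_zero] at h
  refine h.congr fun q => ?_
  rw [Function.comp_apply, ← ENNReal.ofReal_rpow_of_pos two_pos, ENNReal.ofReal_ofNat]

theorem tendsto_tsum_of_dominated {ι α : Type*} {l : Filter α} [l.IsCountablyGenerated]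
    {f : α → ι → ℝ≥0∞} {g : ι → ℝ≥0∞} (bound : ι → ℝ≥0∞) (hb : ∀ a i, f a i ≤ bound i)
    (hfin : ∑' i, bound i ≠ ⊤) (hlim : ∀ i, Tendsto (fun a => f a i) l (𝓝 (g i))) :
    Tendsto (fun a => ∑' i, f a i) l (𝓝 (∑' i, g i)) := by
  let _ : MeasurableSpace ι := ⊤
  simp only [← lintegral_count] at hfin ⊢
  exact tendsto_lintegral_filter_of_dominated_convergence bound
    (.of_forall fun _ => measurable_from_top) (.of_forall fun a => .of_forall (hb a)) hfin
    (.of_forall hlim)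

theorem distNorm_block_lt_top {s : ℝ} (hB : besovNorm P s f < ⊤) (q : ℤ) :
    distNorm 2 (block P q f) < ⊤ :=
  ENNReal.lt_top_of_mul_ne_top_right ((ENNReal.le_tsum q).trans_lt hB).ne (by simp)

theorem HasDensity.eLpNorm_dyadConv_top_le (hV : HasDensity f V) {q : ℤ}
    (hf : distNorm 2 (HybridBesov.block P q f) < ⊤) :
    eLpNorm (dyadConv P q V) ⊤ volume ≤ bernsteinConst P *
      ((2 : ℝ≥0∞) ^ ((q : ℝ) * (N / 2)) * distNorm 2 (HybridBesov.block P q f)) := by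
  obtain ⟨D, hD, le⟩ := exists_hasDensity_block_enorm_le hf
  rw [eLpNorm_congr_ae ((hV.block q).ae_eq hD), eLpNorm_exponent_top]
  exact eLpNormEssSup_le_of_ae_enorm_bound (.of_forall le)

theorem tendsto_eLpNorm_lowConv_atBot (hN : 0 < N) (hV : Tame V volume)
    (hV₂ : eLpNorm V 2 volume < ⊤) :
    Tendsto (fun q : ℤ => eLpNorm (lowConv P q V) ⊤ volume) atBot (𝓝 0) := by
  have finite : eLpNorm (kernel P.symχ 1) 2 volume * eLpNorm V 2 volume ≠ ⊤ :=
    ENNReal.mul_ne_top ((kernel P.symχ 1).memLp 2 volume).2.ne hV₂.ne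
  have bound := ENNReal.Tendsto.mul_const
    (tendsto_two_rpow_mul_atBot (show 0 < (N : ℝ) / 2 by positivity)) (.inr finite)
  rw [zero_mul] at bound
  refine tendsto_of_tendsto_of_tendsto_of_le_of_le tendsto_const_nhds bound (fun _ => zero_le)
    fun q => ?_
  rw [eLpNorm_exponent_top]
  exact eLpNormEssSup_le_of_ae_enorm_bound (.of_forall fun x => enorm_lowConv_le hV q x)

theorem HasDensity.tendsto_tsum_eLpNorm_lowConv_compDiff (hN : 0 < N) (hK : ContDiff ℝ ∞ K)
    (hV : HasDensity f V) (hVR : eLpNorm V ⊤ volume ≤ R) (hB : besovNorm P (N / 2) f < ⊤) :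
    Tendsto (fun q : ℤ => ∑' j, eLpNorm (lowConv P q fun x => (compDiff P K V j x : ℂ)) ⊤ volume)
      atBot (𝓝 0) := by
  have compDiff_le (p : ℝ≥0∞) (hp : 1 ≤ p) : ∃ C : ℝ≥0∞, C < ⊤ ∧ ∀ j,
      eLpNorm (fun x => (compDiff P K V j x : ℂ)) p volume ≤
        C * eLpNorm (dyadConv P j V) p volume := by
    obtain ⟨C, C_lt_top, le⟩ := exists_eLpNorm_iteratedFDeriv_compDiff_le P hK R hp 0
    refine ⟨C, C_lt_top, fun j => ?_⟩
    have h := le V hV.tame.aestronglyMeasurable hVR j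
    rwa [pow_zero, one_mul,
      eLpNorm_congr_norm_ae (.of_forall fun _ => norm_iteratedFDeriv_zero)] at h
  obtain ⟨C₂, C₂_lt_top, le₂⟩ := compDiff_le 2 one_le_two
  obtain ⟨C, C_lt_top, le⟩ := compDiff_le ⊤ le_top
  have tame (j : ℤ) := Tame.ofReal_compDiff (P := P) hK hV.tame.aestronglyMeasurable hVR j
  have dominated (q j : ℤ) : eLpNorm (lowConv P q fun x => (compDiff P K V j x : ℂ)) ⊤ volume ≤
      (∫⁻ x, ‖kernel P.symχ 1 x‖ₑ) * (C * (bernsteinConst P *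
        ((2 : ℝ≥0∞) ^ ((j : ℝ) * (N / 2)) * distNorm 2 (HybridBesov.block P j f)))) :=
    (eLpNorm_convolution_kernel_le le_top (tame j) P.symχ (dyadic q)).trans (by
      gcongr
      exact (le j).trans (by gcongr; exact hV.eLpNorm_dyadConv_top_le (distNorm_block_lt_top hB j)))
  rw [← tsum_zero (β := ℤ) (α := ℝ≥0∞)]
  refine tendsto_tsum_of_dominated _ dominated ?_ fun j =>
    tendsto_eLpNorm_lowConv_atBot hN (tame j) ((le₂ j).trans_lt (ENNReal.mul_lt_top C₂_lt_top ?_))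
  · simp only [ENNReal.tsum_mul_left]
    exact ENNReal.mul_ne_top (kernel P.symχ 1).integrable.2.ne (ENNReal.mul_ne_top C_lt_top.ne
      (ENNReal.mul_ne_top (bernsteinConst_lt_top P).ne hB.ne))
  · rw [← (hV.block j).distNorm_eq]
    exact distNorm_block_lt_top hB j

theorem HasDensity.memSh_comp (hN : 0 < N) (hK : ContDiff ℝ ∞ K) (hK0 : K 0 = 0)
    (hV : HasDensity f V) (hVR : eLpNorm V ⊤ volume ≤ R) (hf : MemSh P f)
    (hB : besovNorm P (N / 2) f < ⊤) (hw : HasDensity w fun x => (K (V x).re : ℂ)) : MemSh P w := by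
  refine tendsto_of_tendsto_of_tendsto_of_le_of_le tendsto_const_nhds
    (hV.tendsto_tsum_eLpNorm_lowConv_compDiff hN hK hVR hB) (fun _ => zero_le) fun q => ?_
  change distNorm ⊤ (HybridBesov.cutoff P q w) ≤ _
  rw [(hw.cutoff q).distNorm_eq]
  exact eLpNorm_convolution_comp_le hK hK0 hV.tame.aestronglyMeasurable hVR
    (hV.tendsto_lowConv_atTop hf hB) (hV.tendsto_lowConv_atBot hf) _ le_top

theorem exists_hybridWeight_mul_distNorm_comp_le (P : LPCouple N) (a b : ℝ)
    (hK : ContDiff ℝ ∞ K) (hK0 : K 0 = 0) (R : ℝ≥0) :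
    ∃ C : ℝ≥0∞, C < ⊤ ∧ ∀ (f w : 𝓢'(E N, ℂ)) (V : E N → ℂ), HasDensity f V →
      eLpNorm V ⊤ volume ≤ R → MemSh P f → besovNorm P (N / 2) f < ⊤ →
      HasDensity w (fun x => (K (V x).re : ℂ)) → ∀ q,
      hybridWeight a b q * distNorm 2 (block P q w) ≤
        C * ∑' j, decay (min a b) (q - j) * (hybridWeight a b j * distNorm 2 (block P j f)) := by
  obtain ⟨C, C_lt_top, le⟩ := exists_hybridWeight_mul_eLpNorm_compDiff_le P a b hK R one_le_two
  refine ⟨C, C_lt_top, fun f w V hV hVR hf hB hw q => ?_⟩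
  have hVm := hV.tame.aestronglyMeasurable
  calc hybridWeight a b q * distNorm 2 (block P q w)
      ≤ hybridWeight a b q *
          ∑' j, eLpNorm (dyadConv P q fun x => (compDiff P K V j x : ℂ)) 2 volume := by
        rw [(hw.block q).distNorm_eq]
        gcongr
        exact eLpNorm_convolution_comp_le hK hK0 hVm hVR (hV.tendsto_lowConv_atTop hf hB)
          (hV.tendsto_lowConv_atBot hf) _ one_le_two
    _ ≤ _ := by
        rw [← ENNReal.tsum_mul_left, ← ENNReal.tsum_mul_left]
        refine ENNReal.tsum_le_tsum fun j => ?_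
        rw [(hV.block j).distNorm_eq]
        exact le V hVm hVR q j

end FixedTime

section Parts

variable {N : ℕ} {P : LPCouple N} {f g : 𝓢'(E N, ℂ)} {p : ℝ≥0∞} [Fact (1 ≤ p)] {a b : ℝ}

theorem distNorm_zero : distNorm p (0 : 𝓢'(E N, ℂ)) = 0 := by
  rw [HasDensity.zero.distNorm_eq, eLpNorm_zero]

theorem distNorm_add_le (f g : 𝓢'(E N, ℂ)) :
    distNorm p (f + g) ≤ distNorm p f + distNorm p g := by
  rcases eq_top_or_lt_top (distNorm p f + distNorm p g) with h | h
  · exact h ▸ le_top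
  obtain ⟨hf, hg⟩ := ENNReal.add_lt_top.1 h
  obtain ⟨V, hfV, hV⟩ := exists_hasDensity_of_distNorm_lt_top hf
  obtain ⟨W, hgW, hW⟩ := exists_hasDensity_of_distNorm_lt_top hg
  rw [hfV.distNorm_eq, hgW.distNorm_eq, (hfV.add hgW).distNorm_eq]
  exact eLpNorm_add_le hV.1 hW.1 Fact.out

theorem distNorm_sub_le (f g : 𝓢'(E N, ℂ)) :
    distNorm p (f - g) ≤ distNorm p f + distNorm p g := by
  rcases eq_top_or_lt_top (distNorm p f + distNorm p g) with h | h
  · exact h ▸ le_top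
  obtain ⟨hf, hg⟩ := ENNReal.add_lt_top.1 h
  obtain ⟨V, hfV, hV⟩ := exists_hasDensity_of_distNorm_lt_top hf
  obtain ⟨W, hgW, hW⟩ := exists_hasDensity_of_distNorm_lt_top hg
  rw [hfV.distNorm_eq, hgW.distNorm_eq, (hfV.sub hgW).distNorm_eq]
  exact eLpNorm_sub_le hV.1 hW.1 Fact.out

/-- A bound for the norms of the cut-offs `S_q` on all `L^p`; the summand `1` makes it nonzero, so
that its product with `⊤` is `⊤`. -/
def cutoffBound (P : LPCouple N) : ℝ≥0∞ := 1 + ∫⁻ x, ‖kernel P.symχ 1 x‖ₑ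

theorem cutoffBound_lt_top (P : LPCouple N) : cutoffBound P < ⊤ :=
  ENNReal.add_lt_top.2 ⟨ENNReal.one_lt_top, (kernel P.symχ 1).integrable.2⟩

theorem distNorm_cutoff_le (q : ℤ) (f : 𝓢'(E N, ℂ)) :
    distNorm p (cutoff P q f) ≤ cutoffBound P * distNorm p f := by
  rcases eq_top_or_lt_top (distNorm p f) with h | hf
  · rw [h, ENNReal.mul_top (by simp [cutoffBound])]
    exact le_top
  obtain ⟨V, hV, -⟩ := exists_hasDensity_of_distNorm_lt_top hf
  rw [hV.distNorm_eq, (hV.cutoff q).distNorm_eq]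
  exact (eLpNorm_convolution_kernel_le Fact.out hV.tame _ _).trans
    (mul_le_mul_left le_add_self _)

theorem memSh_cutoff (hf : MemSh P f) (j : ℤ) : MemSh P (cutoff P j f) := by
  have bound := ENNReal.Tendsto.const_mul hf (.inr (cutoffBound_lt_top P).ne)
  rw [mul_zero] at bound
  refine tendsto_of_tendsto_of_tendsto_of_le_of_le tendsto_const_nhds bound (fun _ => zero_le)
    fun q => ?_
  rw [← cutoff_comm]
  exact distNorm_cutoff_le j _

theorem memSh_sub (hf : MemSh P f) (hg : MemSh P g) : MemSh P (f - g) := by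
  have bound := hf.add hg
  rw [add_zero] at bound
  refine tendsto_of_tendsto_of_tendsto_of_le_of_le tendsto_const_nhds bound (fun _ => zero_le)
    fun q => ?_
  rw [map_sub]
  exact distNorm_sub_le _ _

theorem memSh_lowPart (hf : MemSh P f) : MemSh P (lowPart P f) := by
  rw [hf.lowPart_eq]
  exact memSh_cutoff hf 1

theorem memSh_highPart (hf : MemSh P f) : MemSh P (highPart P f) :=
  memSh_sub hf (memSh_lowPart hf)

theorem block_lowPart_eq_zero (hf : MemSh P f) {q : ℤ} (hq : 2 ≤ q) :
    block P q (lowPart P f) = 0 := by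
  rw [hf.lowPart_eq, ← cutoff_block_comm]
  exact cutoff_block_eq_zero P hq f

theorem block_highPart_eq_zero (hf : MemSh P f) {q : ℤ} (hq : q ≤ -1) :
    block P q (highPart P f) = 0 := by
  rw [highPart, map_sub, hf.lowPart_eq, ← cutoff_block_comm,
    cutoff_block_eq_self P (by lia), sub_self]

theorem distNorm_block_lowPart_le (hf : MemSh P f) (q : ℤ) :
    distNorm p (block P q (lowPart P f)) ≤ cutoffBound P * distNorm p (block P q f) := by
  rw [hf.lowPart_eq, ← cutoff_block_comm]
  exact distNorm_cutoff_le 1 _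

theorem distNorm_block_highPart_le (hf : MemSh P f) (q : ℤ) :
    distNorm p (block P q (highPart P f)) ≤ (1 + cutoffBound P) * distNorm p (block P q f) := by
  rw [highPart, map_sub, add_mul, one_mul]
  exact (distNorm_sub_le _ _).trans (add_le_add_right (distNorm_block_lowPart_le hf q) _)

theorem distNorm_block_le_add (f : 𝓢'(E N, ℂ)) (q : ℤ) : distNorm p (block P q f) ≤
    distNorm p (block P q (lowPart P f)) + distNorm p (block P q (highPart P f)) := by
  have decomposition : block P q f = block P q (lowPart P f) + block P q (highPart P f) := by
    rw [← map_add, highPart, add_sub_cancel]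
  exact decomposition ▸ distNorm_add_le _ _

theorem two_rpow_mul_distNorm_block_lowPart_le (ha : 0 ≤ a) (hb : 0 ≤ b) (hf : MemSh P f) (q : ℤ) :
    (2 : ℝ≥0∞) ^ ((q : ℝ) * a) * distNorm p (block P q (lowPart P f)) ≤
      2 ^ a * cutoffBound P * hybridWeight a b q * distNorm p (block P q f) := by
  rcases le_or_gt 2 q with hq | hq
  · rw [block_lowPart_eq_zero hf hq, distNorm_zero, mul_zero]
    exact zero_le
  have weight_le : (2 : ℝ≥0∞) ^ ((q : ℝ) * a) ≤ 2 ^ a * hybridWeight a b q := by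
    rw [hybridWeight, ← two_rpow_add]
    refine two_rpow_le_two_rpow ?_
    have hq' : (q : ℝ) ≤ 1 := mod_cast (by lia : q ≤ 1)
    rcases le_total (q : ℝ) 0 with h | h <;> simp only [h, min_eq_left, min_eq_right, max_eq_left,
      max_eq_right] <;> nlinarith
  calc _ ≤ 2 ^ a * hybridWeight a b q * (cutoffBound P * distNorm p (block P q f)) :=
        mul_le_mul' weight_le (distNorm_block_lowPart_le hf q)
    _ = _ := by ring

theorem two_rpow_mul_distNorm_block_highPart_le (a b : ℝ) (hf : MemSh P f) (q : ℤ) :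
    (2 : ℝ≥0∞) ^ ((q : ℝ) * b) * distNorm p (block P q (highPart P f)) ≤
      (1 + cutoffBound P) * hybridWeight a b q * distNorm p (block P q f) := by
  rcases le_or_gt q (-1) with hq | hq
  · rw [block_highPart_eq_zero hf hq, distNorm_zero, mul_zero]
    exact zero_le
  rw [hybridWeight_of_nonneg (by lia)]
  calc _ ≤ (2 : ℝ≥0∞) ^ ((q : ℝ) * b) * ((1 + cutoffBound P) * distNorm p (block P q f)) :=
        mul_le_mul_right (distNorm_block_highPart_le hf q) _
    _ = _ := by ring

theorem hybridWeight_mul_distNorm_block_le (ha : 0 ≤ a) (hb : 0 ≤ b) (hf : MemSh P f) (q : ℤ) :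
    hybridWeight a b q * distNorm p (block P q f) ≤
      2 ^ b * (2 : ℝ≥0∞) ^ ((q : ℝ) * a) * distNorm p (block P q (lowPart P f)) +
        (2 : ℝ≥0∞) ^ ((q : ℝ) * b) * distNorm p (block P q (highPart P f)) := by
  refine (mul_le_mul_right (distNorm_block_le_add f q) _).trans ?_
  rw [mul_add]
  refine add_le_add ?_ ?_
  · rcases le_or_gt 2 q with hq | hq
    · rw [block_lowPart_eq_zero hf hq, distNorm_zero, mul_zero]
      exact zero_le
    · refine mul_le_mul_left ?_ _
      rw [hybridWeight, ← two_rpow_add]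
      refine two_rpow_le_two_rpow ?_
      have hq' : (q : ℝ) ≤ 1 := mod_cast (by lia : q ≤ 1)
      rcases le_total (q : ℝ) 0 with h | h <;> simp only [h, min_eq_left, min_eq_right, max_eq_left,
        max_eq_right] <;> nlinarith
  · rcases le_or_gt q (-1) with hq | hq
    · rw [block_highPart_eq_zero hf hq, distNorm_zero, mul_zero]
      exact zero_le
    · rw [hybridWeight_of_nonneg (by lia)]

end Parts

section Time

variable {α : Type*} [MeasurableSpace α] {μ : Measure α} {p : ℝ≥0∞}

theorem eLpNorm_ennreal_const_mul {c : ℝ≥0∞} (hc : c ≠ ⊤) (f : α → ℝ≥0∞) (p : ℝ≥0∞) :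
    eLpNorm (fun t => c * f t) p μ = c * eLpNorm f p μ := by
  rcases eq_or_ne p 0 with rfl | hp0
  · simp
  rcases eq_or_ne p ⊤ with rfl | hp
  · simp only [eLpNorm_exponent_top, eLpNormEssSup, enorm_eq_self]
    exact ENNReal.essSup_const_mul
  have hr := ENNReal.toReal_pos hp0 hp
  rw [eLpNorm_eq_lintegral_rpow_enorm_toReal hp0 hp, eLpNorm_eq_lintegral_rpow_enorm_toReal hp0 hp]
  simp only [enorm_eq_self, ENNReal.mul_rpow_of_nonneg _ _ hr.le]
  rw [lintegral_const_mul' _ _ (ENNReal.rpow_ne_top_of_nonneg hr.le hc),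
    ENNReal.mul_rpow_of_nonneg _ _ (by positivity), ← ENNReal.rpow_mul,
    mul_one_div_cancel hr.ne', ENNReal.rpow_one]

theorem eLpNorm_le_mul_eLpNorm {c d : ℝ≥0∞} (hc : c ≠ ⊤) (hd : d ≠ ⊤) {f g : α → ℝ≥0∞}
    (h : ∀ᵐ t ∂μ, c * f t ≤ d * g t) : c * eLpNorm f p μ ≤ d * eLpNorm g p μ := by
  rw [← eLpNorm_ennreal_const_mul hc, ← eLpNorm_ennreal_const_mul hd]
  exact eLpNorm_mono_enorm_ae (by simpa only [enorm_eq_self] using h)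

theorem eLpNorm_finset_sum_le_tsum {ι : Type*} (hp : 1 ≤ p) {f : ι → α → ℝ≥0∞}
    (hf : ∀ i, AEMeasurable (f i) μ) (s : Finset ι) :
    eLpNorm (fun t => ∑ i ∈ s, f i t) p μ ≤ ∑' i, eLpNorm (f i) p μ := by
  have h := eLpNorm_sum_le (s := s) (fun i _ => (hf i).aestronglyMeasurable) hp
  exact ((Finset.sum_fn s f).symm ▸ h).trans (ENNReal.sum_le_tsum s)

theorem eLpNorm_tsum_le {ι : Type*} [Countable ι] (hp : 1 ≤ p) {f : ι → α → ℝ≥0∞}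
    (hf : ∀ i, AEMeasurable (f i) μ) :
    eLpNorm (fun t => ∑' i, f i t) p μ ≤ ∑' i, eLpNorm (f i) p μ := by
  rcases eq_or_ne p ⊤ with rfl | hp_top
  · simp only [eLpNorm_exponent_top]
    refine eLpNormEssSup_le_of_ae_enorm_bound ?_
    filter_upwards [ae_all_iff.2 fun i => enorm_ae_le_eLpNormEssSup (f i) μ] with t ht
    exact ENNReal.tsum_le_tsum ht
  have hp_ne := (one_pos.trans_le hp).ne'
  have hr := ENNReal.toReal_pos hp_ne hp_top
  have tsum_rpow (t : α) : (∑' i, f i t) ^ p.toReal = ⨆ s, (∑ i ∈ s, f i t) ^ p.toReal := by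
    rw [ENNReal.tsum_eq_iSup_sum]
    exact (ENNReal.orderIsoRpow p.toReal hr).map_iSup _
  have directed : Directed (· ≤ ·) fun (s : Finset ι) t => (∑ i ∈ s, f i t) ^ p.toReal :=
    Monotone.directed_le fun s s' h t =>
      ENNReal.rpow_le_rpow (Finset.sum_le_sum_of_subset h) hr.le
  rw [eLpNorm_eq_lintegral_rpow_enorm_toReal hp_ne hp_top, one_div,
    ENNReal.rpow_inv_le_iff hr]
  simp only [enorm_eq_self, tsum_rpow]
  rw [lintegral_iSup_directed
    (fun s => (Finset.aemeasurable_fun_sum s fun i _ => hf i).pow_const _) directed]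
  refine iSup_le fun s => (ENNReal.rpow_inv_le_iff hr).1 ?_
  simpa only [eLpNorm_eq_lintegral_rpow_enorm_toReal hp_ne hp_top, enorm_eq_self, one_div] using
    eLpNorm_finset_sum_le_tsum hp hf s

theorem tsum_eLpNorm_le_of_le_tsum_sub {G : Type*} [AddGroup G] [Countable G] (hp : 1 ≤ p)
    {C : ℝ≥0∞} (hC : C ≠ ⊤) {κ : G → ℝ≥0∞} (hκ : ∀ d, κ d ≠ ⊤) {f g : G → α → ℝ≥0∞}
    (hg : ∀ j, AEMeasurable (g j) μ)
    (h : ∀ q, ∀ᵐ t ∂μ, f q t ≤ C * ∑' j, κ (q - j) * g j t) :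
    ∑' q, eLpNorm (f q) p μ ≤ C * (∑' d, κ d) * ∑' j, eLpNorm (g j) p μ := by
  have minkowski (q : G) : eLpNorm (f q) p μ ≤ C * ∑' j, κ (q - j) * eLpNorm (g j) p μ :=
    calc eLpNorm (f q) p μ ≤ eLpNorm (fun t => C * ∑' j, κ (q - j) * g j t) p μ :=
          eLpNorm_mono_enorm_ae (by simpa only [enorm_eq_self] using h q)
      _ ≤ C * ∑' j, eLpNorm (fun t => κ (q - j) * g j t) p μ := by
          rw [eLpNorm_ennreal_const_mul hC]
          exact mul_le_mul_right (eLpNorm_tsum_le hp fun j => (hg j).const_mul _) _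
      _ = C * ∑' j, κ (q - j) * eLpNorm (g j) p μ := by
          simp only [eLpNorm_ennreal_const_mul (hκ _)]
  have shift (j : G) : ∑' q, κ (q - j) = ∑' d, κ d := (Equiv.subRight j).tsum_eq κ
  calc ∑' q, eLpNorm (f q) p μ
      ≤ ∑' q, C * ∑' j, κ (q - j) * eLpNorm (g j) p μ := ENNReal.tsum_le_tsum minkowski
    _ = C * ∑' j, (∑' q, κ (q - j)) * eLpNorm (g j) p μ := by
        simp only [ENNReal.tsum_mul_left, ← ENNReal.tsum_mul_right]
        rw [ENNReal.tsum_comm]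
    _ = C * (∑' d, κ d) * ∑' j, eLpNorm (g j) p μ := by
        simp only [shift, ENNReal.tsum_mul_left, mul_assoc]

end Time

section DensityFamily

variable {N : ℕ} {P : LPCouple N} {α : Type*} [MeasurableSpace α] {μ : Measure α}
  {F G : α → 𝓢'(E N, ℂ)} {V W : α → E N → ℂ}

/-- `V` is a jointly measurable choice of densities of the distributions `F t`, for almost every
`t`. -/
structure HasDensityFamily (μ : Measure α) (F : α → 𝓢'(E N, ℂ)) (V : α → E N → ℂ) : Prop where
  stronglyMeasurable : StronglyMeasurable (Function.uncurry V)
  ae_hasDensity : ∀ᵐ t ∂μ, HasDensity (F t) (V t)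

theorem exists_hasDensityFamily {v : α → E N → ℝ}
    (hv : AEStronglyMeasurable (Function.uncurry v) (μ.prod volume))
    (h : ∀ᵐ t ∂μ, HasDensity (F t) fun x => (v t x : ℂ)) :
    ∃ V : α → E N → ℂ, HasDensityFamily μ F V := by
  refine ⟨fun t x => (hv.mk _ (t, x) : ℂ),
    Complex.continuous_ofReal.comp_stronglyMeasurable hv.stronglyMeasurable_mk, ?_⟩
  filter_upwards [Measure.ae_ae_of_ae_prod hv.ae_eq_mk, h] with t ae_eq ht
  exact ht.congr (ae_eq.mono fun x hx => congrArg Complex.ofReal hx)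

theorem stronglyMeasurable_convolution (hV : StronglyMeasurable (Function.uncurry V))
    (h : 𝓢(E N, ℂ)) :
    StronglyMeasurable (Function.uncurry fun t => V t ⋆[.mul ℝ ℂ, volume] h) := by
  have integrand : StronglyMeasurable fun z : (α × E N) × E N => V z.1.1 z.2 * h (z.1.2 - z.2) :=
    (hV.comp_measurable (measurable_fst.fst.prodMk measurable_snd)).mul
      (h.continuous.stronglyMeasurable.comp_measurable (by fun_prop))
  exact integrand.integral_prod_right'

theorem HasDensityFamily.cutoff (hV : HasDensityFamily μ F V) (j : ℤ) :
    HasDensityFamily μ (fun t => cutoff P j (F t)) fun t => lowConv P j (V t) :=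
  ⟨stronglyMeasurable_convolution hV.1 _, hV.2.mono fun _ h => h.cutoff j⟩

theorem HasDensityFamily.block (hV : HasDensityFamily μ F V) (j : ℤ) :
    HasDensityFamily μ (fun t => block P j (F t)) fun t => dyadConv P j (V t) :=
  ⟨stronglyMeasurable_convolution hV.1 _, hV.2.mono fun _ h => h.block j⟩

theorem HasDensityFamily.sub (hV : HasDensityFamily μ F V) (hW : HasDensityFamily μ G W) :
    HasDensityFamily μ (fun t => F t - G t) fun t => V t - W t :=
  ⟨hV.1.sub hW.1, by filter_upwards [hV.2, hW.2] with t h h' using h.sub h'⟩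

theorem HasDensityFamily.lowPart (hV : HasDensityFamily μ F V) (hF : ∀ᵐ t ∂μ, MemSh P (F t)) :
    HasDensityFamily μ (fun t => lowPart P (F t)) fun t => lowConv P 1 (V t) where
  stronglyMeasurable := (hV.cutoff 1).1
  ae_hasDensity := by
    filter_upwards [(hV.cutoff 1).2, hF] with t h hFt
    rwa [hFt.lowPart_eq]

theorem HasDensityFamily.highPart (hV : HasDensityFamily μ F V) (hF : ∀ᵐ t ∂μ, MemSh P (F t)) :
    HasDensityFamily μ (fun t => highPart P (F t)) fun t => V t - lowConv P 1 (V t) :=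
  hV.sub (hV.lowPart hF)

theorem HasDensityFamily.aemeasurable_distNorm_two (hV : HasDensityFamily μ F V) :
    AEMeasurable (fun t => distNorm 2 (F t)) μ := by
  have measurable : Measurable fun t => eLpNorm (V t) 2 volume := by
    simp only [eLpNorm_eq_lintegral_rpow_enorm_toReal two_ne_zero ENNReal.ofNat_ne_top]
    exact (Measurable.lintegral_prod_right' (f := fun z : α × E N => ‖V z.1 z.2‖ₑ ^ _)
      (hV.1.enorm.pow_const _)).pow_const _
  exact measurable.aemeasurable.congr (hV.2.mono fun t h => h.distNorm_eq.symm)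

theorem HasDensityFamily.aestronglyMeasurable_apply (hV : HasDensityFamily μ F V) (g : 𝓢(E N, ℂ)) :
    AEStronglyMeasurable (fun t => F t g) μ := by
  have integrand : StronglyMeasurable fun z : α × E N => g z.2 * V z.1 z.2 :=
    (g.continuous.stronglyMeasurable.comp_measurable measurable_snd).mul hV.1
  exact integrand.integral_prod_right'.aestronglyMeasurable.congr
    (hV.2.mono fun t h => (h.apply_eq g).symm)

end DensityFamily

section HybridNorm

variable {N : ℕ} {P : LPCouple N} {T : ℝ} {r : ℝ≥0∞} {a b : ℝ} {u : ℝ → 𝓢'(E N, ℂ)}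

/-- The Chemin–Lerner norm with regularity `a` on the low and `b` on the high frequencies. It is
equivalent to the sum of the norms of the low and high parts. -/
def hybridNorm (P : LPCouple N) (T : ℝ) (r : ℝ≥0∞) (a b : ℝ) (u : ℝ → 𝓢'(E N, ℂ)) : ℝ≥0∞ :=
  ∑' q : ℤ, hybridWeight a b q *
    eLpNorm (fun t => distNorm 2 (block P q (u t))) r (timeMeasure T)

theorem clNorm_lowPart_le (ha : 0 ≤ a) (hb : 0 ≤ b) (hu : ∀ᵐ t ∂timeMeasure T, MemSh P (u t)) :
    clNorm P T r a (fun t => lowPart P (u t)) ≤ 2 ^ a * cutoffBound P * hybridNorm P T r a b u := by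
  rw [hybridNorm, ← ENNReal.tsum_mul_left]
  refine ENNReal.tsum_le_tsum fun q => ?_
  rw [← mul_assoc]
  refine eLpNorm_le_mul_eLpNorm (two_rpow_ne_top _)
    (ENNReal.mul_ne_top (ENNReal.mul_ne_top (two_rpow_ne_top _) (cutoffBound_lt_top P).ne)
      (two_rpow_ne_top _)) ?_
  exact hu.mono fun t ht => two_rpow_mul_distNorm_block_lowPart_le ha hb ht q

theorem clNorm_highPart_le (a b : ℝ) (hu : ∀ᵐ t ∂timeMeasure T, MemSh P (u t)) :
    clNorm P T r b (fun t => highPart P (u t)) ≤ (1 + cutoffBound P) * hybridNorm P T r a b u := by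
  rw [hybridNorm, ← ENNReal.tsum_mul_left]
  refine ENNReal.tsum_le_tsum fun q => ?_
  rw [← mul_assoc]
  refine eLpNorm_le_mul_eLpNorm (two_rpow_ne_top _)
    (ENNReal.mul_ne_top (ENNReal.add_ne_top.2 ⟨ENNReal.one_ne_top, (cutoffBound_lt_top P).ne⟩)
      (two_rpow_ne_top _)) ?_
  exact hu.mono fun t ht => two_rpow_mul_distNorm_block_highPart_le a b ht q

theorem hybridNorm_le (hr : 1 ≤ r) (ha : 0 ≤ a) (hb : 0 ≤ b) {V : ℝ → E N → ℂ}
    (hV : HasDensityFamily (timeMeasure T) u V) (hu : ∀ᵐ t ∂timeMeasure T, MemSh P (u t)) :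
    hybridNorm P T r a b u ≤ 2 ^ b *
      (clNorm P T r a (fun t => lowPart P (u t)) + clNorm P T r b (fun t => highPart P (u t))) := by
  have low_meas (q : ℤ) := ((hV.lowPart hu).block (P := P) q).aemeasurable_distNorm_two
  have high_meas (q : ℤ) := ((hV.highPart hu).block (P := P) q).aemeasurable_distNorm_two
  simp only [clNorm, ← ENNReal.tsum_add, ← ENNReal.tsum_mul_left]
  refine ENNReal.tsum_le_tsum fun q => ?_
  simp only [← eLpNorm_ennreal_const_mul (two_rpow_ne_top _)]
  rw [hybridWeight, ← eLpNorm_ennreal_const_mul (two_rpow_ne_top _)]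
  refine le_trans ?_ (mul_le_mul_right (eLpNorm_add_le
    ((low_meas q).const_mul _).aestronglyMeasurable
    ((high_meas q).const_mul _).aestronglyMeasurable hr) _)
  rw [← eLpNorm_ennreal_const_mul (two_rpow_ne_top _)]
  refine eLpNorm_mono_enorm_ae (hu.mono fun t ht => ?_)
  simp only [enorm_eq_self, Pi.add_apply]
  refine (hybridWeight_mul_distNorm_block_le ha hb ht q).trans ?_
  rw [mul_add, mul_assoc]
  exact add_le_add_right (le_mul_of_one_le_left' (by simpa using two_rpow_le_two_rpow hb)) _

end HybridNorm

section Composition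

variable {N : ℕ} {P : LPCouple N} {T : ℝ} {K : ℝ → ℝ} {f : 𝓢'(E N, ℂ)} {y : E N → ℝ}
  {u : ℝ → 𝓢'(E N, ℂ)} {v : ℝ → E N → ℝ}

theorem HasDensity.isGivenBy (h : HasDensity f fun x => (y x : ℂ)) : IsGivenBy f y :=
  fun g => ⟨h.tame.integrable_schwartz_mul g, h.apply_eq g⟩

theorem IsGivenBy.hasDensity_of_besovNorm_lt_top (h : IsGivenBy f y) (hf : MemSh P f)
    (hB : besovNorm P (N / 2) f < ⊤) : HasDensity f fun x => (y x : ℂ) :=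
  have ⟨_, _, hD, _⟩ := hf.exists_hasDensity_tsum hB
  h.hasDensity hD

theorem eLpNorm_complex_ofReal {α : Type*} [MeasurableSpace α] (g : α → ℝ) (p : ℝ≥0∞)
    (μ : Measure α) : eLpNorm (fun x => (g x : ℂ)) p μ = eLpNorm g p μ :=
  eLpNorm_congr_norm_ae (.of_forall fun x => Complex.norm_real (g x))

theorem ae_hasDensity (huv : ∀ᵐ t ∂timeMeasure T, IsGivenBy (u t) (v t))
    (hu : MemLinftyBesov P T (N / 2) u) :
    ∀ᵐ t ∂timeMeasure T, HasDensity (u t) fun x => (v t x : ℂ) := by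
  filter_upwards [huv, hu.mem] with t h ht
  exact h.hasDensity_of_besovNorm_lt_top ht.1 ht.2

theorem supNorm_lt_top (huv : ∀ᵐ t ∂timeMeasure T, IsGivenBy (u t) (v t))
    (hu : MemLinftyBesov P T (N / 2) u) : supNorm T v < ⊤ := by
  refine lt_of_le_of_lt ?_ (ENNReal.mul_lt_top (bernsteinConst_lt_top P) hu.bound)
  rw [supNorm, ← one_mul (eLpNorm (fun t => eLpNorm (v t) ⊤ volume) ⊤ _)]
  refine eLpNorm_le_mul_eLpNorm ENNReal.one_ne_top (bernsteinConst_lt_top P).ne ?_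
  filter_upwards [ae_hasDensity huv hu, hu.mem] with t h ht
  rw [one_mul, ← eLpNorm_complex_ofReal]
  exact h.eLpNorm_top_le ht.1 ht.2

theorem ae_eLpNorm_top_le_supNorm (T : ℝ) (v : ℝ → E N → ℝ) :
    ∀ᵐ t ∂timeMeasure T, eLpNorm (fun x => (v t x : ℂ)) ⊤ volume ≤ supNorm T v := by
  simp only [eLpNorm_complex_ofReal]
  exact ae_le_eLpNormEssSup (f := fun t => eLpNorm (v t) ⊤ volume) (μ := timeMeasure T)

theorem exists_hasDensity_comp (hK : Continuous K) {V : E N → ℂ} (hV : MemLp V ⊤ volume) :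
    ∃ w : 𝓢'(E N, ℂ), HasDensity w fun x => (K (V x).re : ℂ) := by
  obtain ⟨M, hM⟩ := (isCompact_closedBall (0 : ℝ) (eLpNorm V ⊤ volume).toReal
    ).exists_bound_of_continuousOn hK.continuousOn
  refine exists_hasDensity le_top (memLp_top_of_bound ((Complex.continuous_ofReal.comp
    (hK.comp Complex.continuous_re)).comp_aestronglyMeasurable hV.1) M ?_)
  filter_upwards [enorm_ae_le_eLpNormEssSup V volume] with x hx
  rw [Complex.norm_real]
  refine hM _ (mem_closedBall_zero_iff.2 ((Complex.abs_re_le_norm _).trans ?_))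
  rw [← toReal_enorm]
  exact ENNReal.toReal_mono hV.2.ne hx

theorem exists_comp_distribution (hN : 0 < N) (hK : ContDiff ℝ ∞ K) (hK0 : K 0 = 0)
    (huv : ∀ᵐ t ∂timeMeasure T, IsGivenBy (u t) (v t)) (hu : MemLinftyBesov P T (N / 2) u) :
    ∃ w : ℝ → 𝓢'(E N, ℂ), ∀ᵐ t ∂timeMeasure T,
      HasDensity (w t) (fun x => (K (v t x) : ℂ)) ∧ MemSh P (w t) := by
  have pointwise : ∀ᵐ t ∂timeMeasure T, ∃ w : 𝓢'(E N, ℂ),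
      HasDensity w (fun x => (K (v t x) : ℂ)) ∧ MemSh P w := by
    filter_upwards [ae_hasDensity huv hu, hu.mem, ae_eLpNorm_top_le_supNorm T v] with t h ht hv
    have hv_top := hv.trans_lt (supNorm_lt_top huv hu)
    obtain ⟨w, hw⟩ := exists_hasDensity_comp hK.continuous ⟨h.tame.1, hv_top⟩
    exact ⟨w, hw, h.memSh_comp (R := (supNorm T v).toNNReal) hN hK hK0
      (hv.trans_eq (ENNReal.coe_toNNReal (supNorm_lt_top huv hu).ne).symm) ht.1 ht.2 hw⟩
  exact ⟨fun t => Classical.epsilon _, pointwise.mono fun t => Classical.epsilon_spec⟩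

theorem exists_hybridNorm_comp_le (P : LPCouple N) {a b : ℝ} (ha : 0 < a) (hb : 0 < b)
    (hK : ContDiff ℝ ∞ K) (hK0 : K 0 = 0) (R : ℝ≥0) :
    ∃ C : ℝ≥0∞, C < ⊤ ∧ ∀ r : ℝ≥0∞, 1 ≤ r → ∀ (T : ℝ) (u w : ℝ → 𝓢'(E N, ℂ))
      (v : ℝ → E N → ℝ), AEStronglyMeasurable (Function.uncurry v) ((timeMeasure T).prod volume) →
      (∀ᵐ t ∂timeMeasure T, IsGivenBy (u t) (v t)) → MemLinftyBesov P T (N / 2) u →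
      supNorm T v ≤ R → (∀ᵐ t ∂timeMeasure T, HasDensity (w t) fun x => (K (v t x) : ℂ)) →
      hybridNorm P T r a b w ≤ C * hybridNorm P T r a b u := by
  obtain ⟨C, hC, hC_le⟩ := exists_hybridWeight_mul_distNorm_comp_le P a b hK hK0 R
  refine ⟨C * ∑' d, decay (min a b) d, ENNReal.mul_lt_top hC (tsum_decay_lt_top (lt_min ha hb)),
    fun r hr T u w v hv huv hu hvR hw => ?_⟩
  obtain ⟨V, hV⟩ := exists_hasDensityFamily hv (ae_hasDensity huv hu)
  simp only [hybridNorm]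
  simp only [← eLpNorm_ennreal_const_mul (two_rpow_ne_top _), hybridWeight]
  refine tsum_eLpNorm_le_of_le_tsum_sub hr hC.ne (fun _ => two_rpow_ne_top _)
    (fun q => ((hV.block q).aemeasurable_distNorm_two).const_mul _) fun q => ?_
  filter_upwards [ae_hasDensity huv hu, hu.mem, ae_eLpNorm_top_le_supNorm T v, hw]
    with t h ht h_sup hwt
  exact hC_le _ _ _ h (h_sup.trans hvR) ht.1 ht.2 hwt q

theorem exists_clNorm_comp_le (P : LPCouple N) {a b : ℝ} (ha : 0 < a) (hb : 0 < b)
    (hK : ContDiff ℝ ∞ K) (hK0 : K 0 = 0) (R : ℝ≥0) :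
    ∃ C : ℝ≥0, ∀ r : ℝ≥0∞, 1 ≤ r → ∀ (T : ℝ) (u w : ℝ → 𝓢'(E N, ℂ))
      (v : ℝ → E N → ℝ), AEStronglyMeasurable (Function.uncurry v) ((timeMeasure T).prod volume) →
      (∀ᵐ t ∂timeMeasure T, IsGivenBy (u t) (v t)) → MemLinftyBesov P T (N / 2) u →
      supNorm T v ≤ R →
      (∀ᵐ t ∂timeMeasure T, HasDensity (w t) (fun x => (K (v t x) : ℂ)) ∧ MemSh P (w t)) →
      clNorm P T r a (fun t => lowPart P (w t)) ≤
        C * (clNorm P T r a (fun t => lowPart P (u t)) +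
          clNorm P T r b fun t => highPart P (u t)) ∧
      clNorm P T r b (fun t => highPart P (w t)) ≤
        C * (clNorm P T r a (fun t => lowPart P (u t)) +
          clNorm P T r b fun t => highPart P (u t)) := by
  obtain ⟨C, hC, hC_le⟩ := exists_hybridNorm_comp_le P ha hb hK hK0 R
  set A := max (2 ^ a * cutoffBound P) (1 + cutoffBound P)
  have hA : A < ⊤ := max_lt
    (ENNReal.mul_lt_top (two_rpow_ne_top _).lt_top (cutoffBound_lt_top P))
    (ENNReal.add_lt_top.2 ⟨ENNReal.one_lt_top, cutoffBound_lt_top P⟩)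
  have hM : A * (C * 2 ^ b) < ⊤ :=
    ENNReal.mul_lt_top hA (ENNReal.mul_lt_top hC (two_rpow_ne_top _).lt_top)
  refine ⟨(A * (C * 2 ^ b)).toNNReal, fun r hr T u w v hv huv hu hvR hw => ?_⟩
  obtain ⟨V, hV⟩ := exists_hasDensityFamily hv (ae_hasDensity huv hu)
  have hybrid_le := (hC_le r hr T u w v hv huv hu hvR (hw.mono fun t ht => ht.1)).trans
    (mul_le_mul_right (hybridNorm_le hr ha.le hb.le hV (hu.mem.mono fun t ht => ht.1)) C)
  have hwS := hw.mono fun t ht => ht.2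
  rw [ENNReal.coe_toNNReal hM.ne, mul_assoc, mul_assoc]
  exact ⟨(clNorm_lowPart_le ha.le hb.le hwS).trans (mul_le_mul' (le_max_left _ _) hybrid_le),
    (clNorm_highPart_le a b hwS).trans (mul_le_mul' (le_max_right _ _) hybrid_le)⟩

end Composition

theorem exists_monotone_ge_natCeil (c : ℕ → ℝ≥0) :
    ∃ C : ℝ≥0 → ℝ≥0, Monotone C ∧ ∀ R, c ⌈R⌉₊ ≤ C R := by
  refine ⟨fun R => ∑ i ∈ Finset.range (⌈R⌉₊ + 1), c i, fun R R' h => ?_, fun R => ?_⟩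
  · exact Finset.sum_le_sum_of_subset (Finset.range_mono (by gcongr))
  · exact Finset.single_le_sum (fun i _ => zero_le) (Finset.self_mem_range_succ _)

end HybridBesov

end

open HybridBesov in
theorem lemma7p1_general (N : ℕ) (hN : 0 < N) (P : LPCouple N) (a b : ℝ) (ha : 0 < a) (hb : 0 < b)
    (K : ℝ → ℝ) (hK : ContDiff ℝ ∞ K) (hK0 : K 0 = 0) :
    ∃ C : ℝ≥0 → ℝ≥0, Monotone C ∧ ∀ r : ℝ≥0∞, 1 ≤ r → ∀ (T : ℝ)
      (u : ℝ → 𝓢'(E N, ℂ)) (v : ℝ → E N → ℝ),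
        AEStronglyMeasurable (Function.uncurry v) ((timeMeasure T).prod (volume : Measure (E N))) →
        (∀ᵐ t ∂timeMeasure T, IsGivenBy (u t) (v t)) →
        MemLinftyBesov P T ((N : ℝ) / 2) u →
        MemCL P T r a (fun t => lowPart P (u t)) →
        MemCL P T r b (fun t => highPart P (u t)) →
        supNorm T v < ⊤ ∧
        ∃ w : ℝ → 𝓢'(E N, ℂ),
          (∀ᵐ t ∂timeMeasure T, IsGivenBy (w t) (fun x => K (v t x)) ∧ MemSh P (w t)) ∧
          MemCL P T r a (fun t => lowPart P (w t)) ∧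
          MemCL P T r b (fun t => highPart P (w t)) ∧
          clNorm P T r a (fun t => lowPart P (w t)) ≤ (C (supNorm T v).toNNReal : ℝ≥0∞) *
            (clNorm P T r a (fun t => lowPart P (u t)) +
              clNorm P T r b (fun t => highPart P (u t))) ∧
          clNorm P T r b (fun t => highPart P (w t)) ≤ (C (supNorm T v).toNNReal : ℝ≥0∞) *
            (clNorm P T r a (fun t => lowPart P (u t)) +
              clNorm P T r b (fun t => highPart P (u t))) := by
  choose c hc using fun n : ℕ => exists_clNorm_comp_le P ha hb hK hK0 n
  obtain ⟨C, hC, hcC⟩ := exists_monotone_ge_natCeil c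
  refine ⟨C, hC, fun r hr T u v hv huv hu hlow hhigh => ?_⟩
  have h_sup := supNorm_lt_top huv hu
  have sup_le : supNorm T v ≤ ((⌈(supNorm T v).toNNReal⌉₊ : ℝ≥0) : ℝ≥0∞) :=
    (ENNReal.coe_toNNReal h_sup.ne).symm.trans_le (ENNReal.coe_le_coe.2 (Nat.le_ceil _))
  obtain ⟨w, hw⟩ := exists_comp_distribution hN hK hK0 huv hu
  have hwS := hw.mono fun t ht => ht.2
  obtain ⟨W, hW⟩ := exists_hasDensityFamily (hK.continuous.comp_aestronglyMeasurable hv)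
    (hw.mono fun t ht => ht.1)
  obtain ⟨low_le, high_le⟩ := hc _ r hr T u w v hv huv hu sup_le hw
  have const_le := ENNReal.coe_le_coe.2 (hcC (supNorm T v).toNNReal)
  replace low_le := low_le.trans (mul_le_mul_left const_le _)
  replace high_le := high_le.trans (mul_le_mul_left const_le _)
  have finite := ENNReal.mul_lt_top (ENNReal.coe_lt_top (r := C (supNorm T v).toNNReal))
    (ENNReal.add_lt_top.2 ⟨hlow.bound, hhigh.bound⟩)
  exact ⟨h_sup, w, hw.mono fun t ht => ⟨ht.1.isGivenBy, ht.2⟩,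
    ⟨(hW.lowPart hwS).aestronglyMeasurable_apply, hwS.mono fun _ => memSh_lowPart,
      low_le.trans_lt finite⟩,
    ⟨(hW.highPart hwS).aestronglyMeasurable_apply, hwS.mono fun _ => memSh_highPart,
      high_le.trans_lt finite⟩, low_le, high_le⟩

theorem lemma7p1 (N : ℕ) (hN : 2 ≤ N) (P : HybridBesov.LPCouple N) (s : ℝ) (hs : 0 ≤ s)
    (K : ℝ → ℝ) (hK : ContDiff ℝ ∞ K) (hK0 : K 0 = 0) :
    ∃ C : ℝ≥0 → ℝ≥0, Monotone C ∧
      ∀ (r : ℝ≥0∞), 1 ≤ r → ∀ (T : ℝ), 0 < T →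
      -- `u t` is the tempered distribution given by the real function `v t`
      ∀ (u : ℝ → 𝓢'(HybridBesov.E N, ℂ)) (v : ℝ → HybridBesov.E N → ℝ),
        AEStronglyMeasurable (Function.uncurry v)
          ((HybridBesov.timeMeasure T).prod (volume : Measure (HybridBesov.E N))) →
        (∀ᵐ t ∂HybridBesov.timeMeasure T, HybridBesov.IsGivenBy (u t) (v t)) →
        HybridBesov.MemLinftyBesov P T ((N : ℝ) / 2) u →
        HybridBesov.MemCL P T r ((N : ℝ) / 2 + s) (fun t => HybridBesov.lowPart P (u t)) →
        HybridBesov.MemCL P T r ((N : ℝ) / 2) (fun t => HybridBesov.highPart P (u t)) →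
        HybridBesov.supNorm T v < ⊤ ∧
        -- `w` is `K(u)` as a tempered distribution
        ∃ w : ℝ → 𝓢'(HybridBesov.E N, ℂ),
          (∀ᵐ t ∂HybridBesov.timeMeasure T,
            HybridBesov.IsGivenBy (w t) (fun x => K (v t x)) ∧ HybridBesov.MemSh P (w t)) ∧
          HybridBesov.MemCL P T r ((N : ℝ) / 2 + s) (fun t => HybridBesov.lowPart P (w t)) ∧
          HybridBesov.MemCL P T r ((N : ℝ) / 2) (fun t => HybridBesov.highPart P (w t)) ∧
          HybridBesov.clNorm P T r ((N : ℝ) / 2 + s) (fun t => HybridBesov.lowPart P (w t)) ≤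
            (C (HybridBesov.supNorm T v).toNNReal : ℝ≥0∞) *
              (HybridBesov.clNorm P T r ((N : ℝ) / 2 + s)
                  (fun t => HybridBesov.lowPart P (u t)) +
                HybridBesov.clNorm P T r ((N : ℝ) / 2)
                  (fun t => HybridBesov.highPart P (u t))) ∧
          HybridBesov.clNorm P T r ((N : ℝ) / 2) (fun t => HybridBesov.highPart P (w t)) ≤
            (C (HybridBesov.supNorm T v).toNNReal : ℝ≥0∞) *
              (HybridBesov.clNorm P T r ((N : ℝ) / 2 + s)
                  (fun t => HybridBesov.lowPart P (u t)) +
                HybridBesov.clNorm P T r ((N : ℝ) / 2)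
                  (fun t => HybridBesov.highPart P (u t))) := by
  obtain ⟨C, hC, h⟩ := lemma7p1_general N (by lia) P (N / 2 + s) (N / 2) (by positivity)
    (by positivity) K hK hK0
  exact ⟨C, hC, fun r hr T _ => h r hr T⟩
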